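/- An oracle is a set $A\subseteq\{0,1\}^{<\omega}$ of finite binary strings; identifying $A$ with its characteristic function, the set of all oracles is the Cantor space $2^{\{0,1\}^{<\omega}}\cong 2^\omega$ with the product topology. For an oracle $A$ let $\mathbf{P}^A$ and $\mathbf{NP}^A$ be the classes of languages over $\{0,1\}$ decided in polynomial time by deterministic, respectively nondeterministic, Turing machines with oracle $A$. Put $$\mathbf{O}=\{A : \mathbf{P}^A\neq \mathbf{NP}^A\},\qquad H=\{b\in 2^\omega : b(n)=1 \text{ for infinitely many } n\}.$$ A subset of a topological space is $\boldsymbol{\Sigma}^0_2$ if it is a countable union of closed sets, and $\boldsymbol{\Pi}^0_2$ if it is a countable intersection of open sets; it is $\boldsymbol{\Pi}^0_2$-hard if it is not $\boldsymbol{\Sigma}^0_2$, and $\boldsymbol{\Pi}^0_2$-complete if it is both $\boldsymbol{\Pi}^0_2$ and $\boldsymbol{\Pi}^0_2$-hard. Then: 1. $\mathbf{O}$ is $\boldsymbol{\Pi}^0_2$-hard. 2. There is a continuous reduction of $H$ to $\mathbf{O}$, that is, a continuous map $f$ from $2^\omega$ to the space of oracles such that for all $b\in 2^\omega$: $b\in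 H$ if and only if $f(b)\in\mathbf{O}$. 3. $\mathbf{O}$ is $\boldsymbol{\Pi}^0_2$-complete. -/

import Mathlib

namespace OracleSeparation

/-- An oracle is a language over `{0, 1}`, given by its characteristic function. The type carries
the product of the discrete topologies, so it is the Cantor space `2^ω` up to an enumeration of
the countably many strings. -/
abbrev Oracle : Type := List Bool → Bool

/-- What an oracle Turing machine with state set `Q` and `k + 1` tapes can do in one step. The tape
symbols are `some false`, `some true` and the blank `none`. Besides its tapes the machine has a
write-only query tape. -/
inductive Action (Q : Type) (k : ℕ) : Type where
  /-- Halt, accepting (`true`) or rejecting (`false`). -/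
  | halt (verdict : Bool)
  /-- Ask whether the string on the query tape is in the oracle, erase the query tape, and go to
  the state `onYes` or `onNo` according to the answer. -/
  | query (onYes onNo : Q)
  /-- Write `symbols i` on the scanned cell of tape `i`, then move the head of tape `i` one cell
  in the direction `moves i` (`none`: stay), append the bit `out`, if any, to the query tape, and
  go to the state `next`. -/
  | act (next : Q) (symbols : Fin (k + 1) → Option Bool) (moves : Fin (k + 1) → Option Turing.Dir)
      (out : Option Bool)

/-- A nondeterministic oracle Turing machine with state set `Q` (required to be finite in the
definitions of `P` and `NP`) and `k + 1` two-way infinite tapes. For a state and a tuple of scanned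
symbols, `δ` is the set of allowed actions. -/
structure OracleTM (Q : Type) (k : ℕ) : Type where
  /-- The initial state. -/
  start : Q
  /-- The transition relation. -/
  δ : Q → (Fin (k + 1) → Option Bool) → Set (Action Q k)

/-- Configurations. The status `Sum.inl q` is "running, in state `q`", the status `Sum.inr b` is
"halted with verdict `b`". -/
@[ext]
structure Config (Q : Type) (k : ℕ) : Type where
  /-- The state, or the verdict of a computation that has halted. -/
  status : Q ⊕ Bool
  /-- The tapes with their heads. -/
  tapes : Fin (k + 1) → Turing.Tape (Option Bool)
  /-- The string on the query tape. -/
  queryTape : List Bool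

/-- The configuration after an action, relative to the oracle `A`. -/
def Config.perform {Q : Type} {k : ℕ} (A : Oracle) (c : Config Q k) : Action Q k → Config Q k
  | .halt b => { c with status := Sum.inr b }
  | .query onYes onNo =>
      { c with
        status := Sum.inl (if A c.queryTape then onYes else onNo)
        queryTape := [] }
  | .act next symbols moves out =>
      { status := Sum.inl next
        tapes := fun i =>
          match moves i with
          | none => (c.tapes i).write (symbols i)
          | some d => ((c.tapes i).write (symbols i)).move d
        queryTape := c.queryTape ++ out.toList }

namespace OracleTM

variable {Q : Type} {k : ℕ}

/-- A machine is deterministic if there is exactly one allowed action in every situation. -/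
def Deterministic (M : OracleTM Q k) : Prop :=
  ∀ q s, ∃! a, a ∈ M.δ q s

/-- The initial configuration: the input is on tape `0` with the head on its first symbol, the other
tapes and the query tape are empty. -/
def init (M : OracleTM Q k) (x : List Bool) : Config Q k where
  status := Sum.inl M.start
  tapes i := Turing.Tape.mk₁ (if i = 0 then x.map some else [])
  queryTape := []

/-- `M.Step A c c'`: the machine `M` with oracle `A` can go from `c` to `c'` in one step. -/
def Step (M : OracleTM Q k) (A : Oracle) (c c' : Config Q k) : Prop :=
  ∃ q, c.status = Sum.inl q ∧ ∃ a ∈ M.δ q (fun i => (c.tapes i).head), c' = c.perform A a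

/-- `M.Reaches A n c c'`: the machine `M` with oracle `A` can go from `c` to `c'` in exactly `n`
steps. -/
inductive Reaches (M : OracleTM Q k) (A : Oracle) : ℕ → Config Q k → Config Q k → Prop where
  | refl (c : Config Q k) : Reaches M A 0 c c
  | tail {n : ℕ} {c c' c'' : Config Q k} : Reaches M A n c c' → M.Step A c' c'' →
      Reaches M A (n + 1) c c''

/-- The input `x` is accepted if some computation on it halts with the verdict "accept". -/
def Accepts (M : OracleTM Q k) (A : Oracle) (x : List Bool) : Prop :=
  ∃ n c, M.Reaches A n (M.init x) c ∧ c.status = Sum.inr true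

/-- With oracle `A`, the machine runs in time `p`: every computation on every input `x`, whatever the
nondeterministic choices, has at most `p |x|` steps. -/
def RunsInTime (M : OracleTM Q k) (A : Oracle) (p : ℕ → ℕ) : Prop :=
  ∀ x n c, M.Reaches A n (M.init x) c → n ≤ p x.length

/-- With oracle `A`, the machine decides `L` in polynomial time. -/
def DecidesInPolyTime (M : OracleTM Q k) (A : Oracle) (L : Language Bool) : Prop :=
  (∃ p : Polynomial ℕ, M.RunsInTime A fun n => p.eval n) ∧ ∀ x, x ∈ L ↔ M.Accepts A x

end OracleTM

/-- The relativized class `P^A`. -/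
def P (A : Oracle) : Set (Language Bool) :=
  {L | ∃ (Q : Type) (_ : Finite Q) (k : ℕ) (M : OracleTM Q k),
    M.Deterministic ∧ M.DecidesInPolyTime A L}

/-- The relativized class `NP^A`. -/
def NP (A : Oracle) : Set (Language Bool) :=
  {L | ∃ (Q : Type) (_ : Finite Q) (k : ℕ) (M : OracleTM Q k), M.DecidesInPolyTime A L}

/-- The set of oracles that separate `P` from `NP`. -/
def O : Set Oracle := {A | P A ≠ NP A}

/-- The set of binary sequences that are `1` infinitely often. -/
def H : Set (ℕ → Bool) := {b | {n | b n = true}.Infinite}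

/-- Boldface `Σ⁰₂`: countable unions of closed sets. -/
def IsSigmaTwo {X : Type*} [TopologicalSpace X] (S : Set X) : Prop :=
  ∃ F : ℕ → Set X, (∀ n, IsClosed (F n)) ∧ S = ⋃ n, F n

/-- Boldface `Π⁰₂`: countable intersections of open sets. -/
def IsPiTwo {X : Type*} [TopologicalSpace X] (S : Set X) : Prop :=
  IsGδ S

/-- A set is `Π⁰₂`-hard if it is not `Σ⁰₂`. -/
def IsPiTwoHard {X : Type*} [TopologicalSpace X] (S : Set X) : Prop :=
  ¬ IsSigmaTwo S

/-- A set is `Π⁰₂`-complete if it is `Π⁰₂` and `Π⁰₂`-hard. -/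
def IsPiTwoComplete {X : Type*} [TopologicalSpace X] (S : Set X) : Prop :=
  IsPiTwo S ∧ IsPiTwoHard S

end OracleSeparation

namespace OracleSeparation

open Turing

/-! Upper bound. One nondeterministic machine `universal` runs in linear time with every oracle, and
its language is complete for `NP A` under polynomial-time many-one reductions, for every `A`
(`NP_subset_P_of_universal_mem`). So `A` separates iff this language is not in `P A`, that is, iff
no deterministic machine with a polynomial clock decides it. There are countably many clocked
machines. For a fixed one, the oracles with which it keeps its clock and agrees with `universal`
form a closed set, because at each input and each number of steps only finitely many strings of the
oracle matter (`isClosed_decides`). Hence `O` is a countable intersection of open sets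
(`isPiTwo_of_complete`).

Hardness. An accepting computation of `universal` never has a string as long as its input on the
query tape, so recursion on length gives an oracle `B` that equals the universal language relative
to `B` (`fixedOracle`). That language is then trivially in `P B`, so `B` does not separate. Given
`b`, the oracle `f b` arises from `B` in stages: whenever `b n = 1`, the strings of one length `l n`
are changed by the Baker-Gill-Solovay argument so that the next clocked machine fails to decide the
language of lengths of strings in the oracle (`exists_diagonal`). If `b` has infinitely many ones,
every clocked machine is defeated and `f b` separates. If it has finitely many, `f b` differs from
`B` at finitely many strings, and a finite change can be absorbed into the states of a machine
(`not_mem_O_of_finite`). Each value of `f b` is settled after finitely many stages, so `f` is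
continuous. The set `H` is not a countable union of closed sets by the Baire category theorem, and
preimages carry this to `O`.

Completeness of `universal` is the bulk of the work. Its input is fuel in unary followed by a
program, a list of blocks of elementary operations. It executes blocks in an order of its own
choosing; control flow lives in the program, where every block first tests and then sets a counter.
To simulate a machine with `k + 1` tapes, the tapes are interleaved on one work tape, a second tape
marks the heads, and scanned symbols are guessed first and verified later (`universal_sound`,
`universal_complete`, `accepts_of_programAccepts`, `programAccepts_of_accepts`). The reduction
prints a polynomial number of ones and then a letterwise translation of the reversed input between
two fixed strings. An explicit deterministic machine does this (`padder_computes`), and composing it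
with a machine for the universal language finishes the argument (`preimage_mem_P`). -/

/-! ### Tapes as functions on the integers -/

/-- The tape `T` has the content `f`, and its head is at the position `p`. -/
def Holds (T : Tape (Option Bool)) (f : ℤ → Option Bool) (p : ℤ) : Prop :=
  ∀ i, T.nth i = f (p + i)

/-- The content of a tape with the string `l` written from the position `0` on. -/
def listContent (l : List Bool) (z : ℤ) : Option Bool :=
  if 0 ≤ z then l[z.toNat]? else none

/-- Write a symbol, then move. -/
def actOn (s : Option Bool) (d : Option Dir) (T : Tape (Option Bool)) : Tape (Option Bool) :=
  match d with
  | none => T.write s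
  | some d => (T.write s).move d

/-- The displacement of the head. -/
def dirShift : Option Dir → ℤ
  | none => 0
  | some .left => -1
  | some .right => 1

theorem tape_ext {T T' : Tape (Option Bool)} (h : ∀ i, T.nth i = T'.nth i) : T = T' := by
  obtain ⟨a, L, R⟩ := T
  obtain ⟨a', L', R'⟩ := T'
  congr 1
  · exact h 0
  -- The left half is stored with the cell nearest to the head first, so its `n`-th entry is the
  -- cell `-(n + 1)`.
  · exact ListBlank.ext fun n => h (-(n + 1 : ℕ))
  · exact ListBlank.ext fun n => h (n + 1 : ℕ)

namespace Holds

variable {T T' : Tape (Option Bool)} {f g : ℤ → Option Bool} {p : ℤ}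

theorem head (h : Holds T f p) : T.head = f p := by
  simpa using h 0

theorem write (h : Holds T f p) (s : Option Bool) :
    Holds (T.write s) (Function.update f p s) p := by
  intro i
  rw [Tape.write_nth, Function.update_apply, h i]
  by_cases hi : i = 0 <;> simp [hi]

theorem move (h : Holds T f p) (d : Dir) : Holds (T.move d) f (p + dirShift (some d)) := by
  intro i
  cases d
  · rw [Tape.move_left_nth, h]; congr 1; simp only [dirShift]; ring
  · rw [Tape.move_right_nth, h]; congr 1; simp only [dirShift]; ring

theorem actOn (h : Holds T f p) (s : Option Bool) (d : Option Dir) :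
    Holds (actOn s d T) (Function.update f p s) (p + dirShift d) := by
  cases d with
  | none => simpa [OracleSeparation.actOn, dirShift] using h.write s
  | some d => exact (h.write s).move d

theorem actOn_self (h : Holds T f p) {s : Option Bool} (hs : s = f p) (d : Option Dir) :
    Holds (OracleSeparation.actOn s d T) f (p + dirShift d) := by
  have := h.actOn s d
  rwa [hs, Function.update_eq_self, ← hs] at this

theorem eq (h : Holds T f p) (h' : Holds T' f p) : T = T' :=
  tape_ext fun i => (h i).trans (h' i).symm

theorem congr (h : Holds T f p) (hfg : ∀ z, f z = g z) : Holds T g p :=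
  fun i => (h i).trans (hfg _)

end Holds

theorem holds_mk₁ (l : List Bool) : Holds (Tape.mk₁ (l.map some)) (listContent l) 0 := by
  intro i
  rw [zero_add]
  unfold listContent
  rcases lt_or_ge i 0 with hi | hi
  · obtain ⟨n, rfl⟩ : ∃ n : ℕ, i = -(n + 1 : ℕ) := ⟨(-i - 1).toNat, by omega⟩
    have : ¬ (0 : ℤ) ≤ -(n + 1 : ℕ) := by omega
    simp only [this, if_false]
    change (ListBlank.mk []).nth n = none
    simp only [ListBlank.nth_mk, List.getI_nil]
    rfl
  · obtain ⟨n, rfl⟩ := Int.eq_ofNat_of_zero_le hi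
    have h1 : (Tape.mk₁ (l.map some)).nth (n : ℤ) = (ListBlank.mk (l.map some)).nth n :=
      Tape.mk'_nth_nat _ _ _
    rw [h1, ListBlank.nth_mk]
    simp only [hi, if_true, Int.toNat_natCast, List.getI_eq_getElem?_getD, List.getElem?_map]
    cases l[n]? <;> rfl

theorem holds_mk₁_nil : Holds (Tape.mk₁ []) (fun _ => none) 0 :=
  (holds_mk₁ []).congr fun z => by simp [listContent]

theorem listContent_append_length (l r : List Bool) (b : Bool) :
    listContent (l ++ b :: r) l.length = some b := by
  simp [listContent]

theorem listContent_length (l : List Bool) : listContent l l.length = none := by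
  simp [listContent]

theorem listContent_neg (l : List Bool) {z : ℤ} (hz : z < 0) : listContent l z = none := by
  simp [listContent, not_le.mpr hz]

/-- Writing on the first blank cell after a string lengthens the string. This is how tapes that grow
by one symbol per step are followed. -/
theorem update_listContent (l : List Bool) (b : Bool) :
    Function.update (listContent l) l.length (some b) = listContent (l ++ [b]) := by
  funext z
  rw [Function.update_apply]
  unfold listContent
  split_ifs with h1 h2 h2
  · subst h1; simp
  · omega
  · obtain ⟨n, rfl⟩ := Int.eq_ofNat_of_zero_le h2
    simp only [Int.toNat_natCast]
    have : n ≠ l.length := by rintro rfl; simp at h1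
    rcases lt_or_gt_of_ne this with h | h
    · rw [List.getElem?_append_left h]
    · rw [List.getElem?_eq_none (by omega), List.getElem?_eq_none (by simp; omega)]
  · rfl

/-! ### Computations -/

theorem perform_act {Q : Type} {k : ℕ} (A : Oracle) (c : Config Q k) (q : Q)
    (s : Fin (k + 1) → Option Bool) (d : Fin (k + 1) → Option Dir) (o : Option Bool) :
    c.perform A (.act q s d o) =
      { status := Sum.inl q
        tapes := fun i => actOn (s i) (d i) (c.tapes i)
        queryTape := c.queryTape ++ o.toList } := by
  simp only [Config.perform, Config.mk.injEq, true_and, and_true]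
  funext i
  unfold actOn
  cases d i <;> rfl

namespace OracleTM

variable {Q Q' : Type} {k k' : ℕ} {M : OracleTM Q k} {M' : OracleTM Q' k'} {A A' : Oracle}
  {c c' c'' : Config Q k} {m n : ℕ}

theorem Reaches.trans (h : M.Reaches A m c c') (h' : M.Reaches A n c' c'') :
    M.Reaches A (m + n) c c'' := by
  induction h' with
  | refl => exact h
  | tail _ hs ih => exact (ih h).tail hs

theorem Reaches.one (h : M.Step A c c') : M.Reaches A 1 c c' := (Reaches.refl c).tail h

theorem Reaches.head (h : M.Step A c c') (h' : M.Reaches A n c' c'') :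
    M.Reaches A (n + 1) c c'' := by
  rw [add_comm]; exact (Reaches.one h).trans h'

theorem reaches_zero (h : M.Reaches A 0 c c') : c = c' := by
  cases h; rfl

theorem reaches_succ (h : M.Reaches A (n + 1) c c'') :
    ∃ c', M.Reaches A n c c' ∧ M.Step A c' c'' := by
  cases h with
  | tail h hs => exact ⟨_, h, hs⟩

theorem Reaches.split (h : M.Reaches A (m + n) c c'') :
    ∃ c', M.Reaches A m c c' ∧ M.Reaches A n c' c'' := by
  induction n generalizing c'' with
  | zero => exact ⟨_, h, .refl _⟩
  | succ n ih =>
    obtain ⟨d, hd, hs⟩ := reaches_succ h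
    obtain ⟨c', h1, h2⟩ := ih hd
    exact ⟨c', h1, h2.tail hs⟩

theorem not_step_of_halted {b : Bool} (h : c.status = Sum.inr b) : ¬ M.Step A c c' := by
  rintro ⟨q, hq, _⟩
  rw [h] at hq
  cases hq

theorem Deterministic.step_unique (hM : M.Deterministic) (h : M.Step A c c')
    (h' : M.Step A c c'') : c' = c'' := by
  obtain ⟨q, hq, a, ha, rfl⟩ := h
  obtain ⟨q', hq', a', ha', rfl⟩ := h'
  obtain rfl : q = q' := by rw [hq] at hq'; exact Sum.inl.inj hq'
  rw [(hM q _).unique ha ha']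

theorem Deterministic.exists_step (hM : M.Deterministic) {q : Q} (h : c.status = Sum.inl q) :
    ∃ c', M.Step A c c' :=
  let ⟨a, ha, _⟩ := hM q (fun i => (c.tapes i).head)
  ⟨_, q, h, a, ha, rfl⟩

theorem Deterministic.reaches_unique (hM : M.Deterministic) (h : M.Reaches A n c c')
    (h' : M.Reaches A n c c'') : c' = c'' := by
  induction n generalizing c' c'' with
  | zero => exact (reaches_zero h).symm.trans (reaches_zero h')
  | succ n ih =>
    obtain ⟨d, hd, hs⟩ := reaches_succ h
    obtain ⟨d', hd', hs'⟩ := reaches_succ h'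
    obtain rfl := ih hd hd'
    exact hM.step_unique hs hs'

/-- The longer of two computations from the same configuration extends the shorter one, and a halted
configuration has no successor. -/
theorem Deterministic.halted_unique (hM : M.Deterministic) {b b' : Bool}
    (h : M.Reaches A m c c') (hb : c'.status = Sum.inr b)
    (h' : M.Reaches A n c c'') (hb' : c''.status = Sum.inr b') : b = b' := by
  rcases le_total m n with hmn | hmn
  · obtain ⟨r, rfl⟩ := Nat.exists_eq_add_of_le hmn
    obtain ⟨d, hd, hr⟩ := h'.split
    obtain rfl := hM.reaches_unique h hd
    cases r with
    | zero => obtain rfl := reaches_zero hr; exact Sum.inr.inj (hb.symm.trans hb')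
    | succ r =>
      rw [add_comm] at hr
      obtain ⟨e, he, -⟩ := hr.split
      obtain ⟨_, h0, hs⟩ := reaches_succ he
      obtain rfl := reaches_zero h0
      exact absurd hs (not_step_of_halted hb)
  · obtain ⟨r, rfl⟩ := Nat.exists_eq_add_of_le hmn
    obtain ⟨d, hd, hr⟩ := h.split
    obtain rfl := hM.reaches_unique h' hd
    cases r with
    | zero => obtain rfl := reaches_zero hr; exact Sum.inr.inj (hb.symm.trans hb')
    | succ r =>
      rw [add_comm] at hr
      obtain ⟨e, he, -⟩ := hr.split
      obtain ⟨_, h0, hs⟩ := reaches_succ he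
      obtain rfl := reaches_zero h0
      exact absurd hs (not_step_of_halted hb')

/-- A running configuration of a deterministic machine always has a successor, so a computation that
never halted would outlast the bound `N`. -/
theorem Deterministic.exists_halted (hM : M.Deterministic) {N : ℕ}
    (hN : ∀ n c', M.Reaches A n c c' → n ≤ N) :
    ∃ n c' b, n ≤ N ∧ M.Reaches A n c c' ∧ c'.status = Sum.inr b := by
  by_contra! hcon
  have key : ∀ n, ∃ c', M.Reaches A n c c' := by
    intro n
    induction n with
    | zero => exact ⟨_, .refl _⟩
    | succ n ih =>
      obtain ⟨c', hc'⟩ := ih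
      cases hst : c'.status with
      | inl q =>
        obtain ⟨d, hd⟩ := hM.exists_step (A := A) hst
        exact ⟨d, hc'.tail hd⟩
      | inr b => exact absurd hst (hcon n c' b (hN _ _ hc') hc')
  obtain ⟨c', hc'⟩ := key (N + 1)
  have := hN _ _ hc'
  omega

/-- A map of configurations that commutes with steps, in both directions, commutes with
computations. -/
theorem reaches_map_iff {F : Config Q k → Config Q' k'}
    (hF : ∀ c d, M'.Step A' (F c) d ↔ ∃ c', M.Step A c c' ∧ d = F c') {d : Config Q' k'} :
    M'.Reaches A' n (F c) d ↔ ∃ c', M.Reaches A n c c' ∧ d = F c' := by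
  induction n generalizing d with
  | zero =>
    constructor
    · intro h; exact ⟨c, .refl _, (reaches_zero h).symm⟩
    · rintro ⟨c', h, rfl⟩; rw [← reaches_zero h]; exact .refl _
  | succ n ih =>
    constructor
    · intro h
      obtain ⟨e, he, hs⟩ := reaches_succ h
      obtain ⟨c', hc', rfl⟩ := ih.1 he
      obtain ⟨c'', hc'', rfl⟩ := (hF _ _).1 hs
      exact ⟨c'', hc'.tail hc'', rfl⟩
    · rintro ⟨c'', h, rfl⟩
      obtain ⟨c', hc', hs⟩ := reaches_succ h
      exact (ih.2 ⟨c', hc', rfl⟩).tail ((hF _ _).2 ⟨_, hs, rfl⟩)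

/-- Computations correspond with equal numbers of steps, so even the polynomial is kept. Serves both
the renaming of states and the finite changes of the oracle. -/
theorem decides_of_map {F : Config Q k → Config Q' k'}
    (hF : ∀ c d, M'.Step A' (F c) d ↔ ∃ c', M.Step A c c' ∧ d = F c')
    (hinit : ∀ x, M'.init x = F (M.init x))
    (hacc : ∀ c, (F c).status = Sum.inr true ↔ c.status = Sum.inr true)
    {L : Language Bool} (h : M.DecidesInPolyTime A L) : M'.DecidesInPolyTime A' L := by
  obtain ⟨⟨p, hp⟩, hL⟩ := h
  refine ⟨⟨p, fun x n d hd => ?_⟩, fun x => (hL x).trans ⟨?_, ?_⟩⟩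
  · rw [hinit] at hd
    obtain ⟨c', hc', -⟩ := (reaches_map_iff hF).1 hd
    exact hp x n c' hc'
  · rintro ⟨n, c, hc, hst⟩
    exact ⟨n, F c, by rw [hinit]; exact (reaches_map_iff hF).2 ⟨c, hc, rfl⟩, (hacc c).2 hst⟩
  · rintro ⟨n, d, hd, hst⟩
    rw [hinit] at hd
    obtain ⟨c', hc', rfl⟩ := (reaches_map_iff hF).1 hd
    exact ⟨n, c', hc', (hacc _).1 hst⟩

/-! ### Locality -/

theorem perform_congr (a : Action Q k) (h : A c.queryTape = A' c.queryTape) :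
    c.perform A a = c.perform A' a := by
  cases a <;> simp [Config.perform, h]

theorem Step.congr (hs : M.Step A c c') (h : A c.queryTape = A' c.queryTape) :
    M.Step A' c c' := by
  obtain ⟨q, hq, a, ha, rfl⟩ := hs
  exact ⟨q, hq, a, ha, perform_congr a h⟩

theorem Step.queryTape_length_le (hs : M.Step A c c') :
    c'.queryTape.length ≤ c.queryTape.length + 1 := by
  obtain ⟨q, hq, a, ha, rfl⟩ := hs
  cases a with
  | halt b => simp [Config.perform]
  | query y n => simp [Config.perform]
  | act q s d o => cases o <;> simp [Config.perform]

theorem Reaches.queryTape_length_le (h : M.Reaches A n c c') :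
    c'.queryTape.length ≤ c.queryTape.length + n := by
  induction h with
  | refl => simp
  | tail _ hs ih => have := hs.queryTape_length_le; omega

theorem Reaches.congr (h : M.Reaches A n c c')
    (hA : ∀ m d q, M.Reaches A m c d → d.status = Sum.inl q → A d.queryTape = A' d.queryTape) :
    M.Reaches A' n c c' := by
  induction h with
  | refl => exact .refl _
  | tail h hs ih =>
    obtain ⟨q, hq, _⟩ := id hs
    exact (ih hA).tail (hs.congr (hA _ _ q h hq))

/-- A computation of `n` steps asks at most `n` queries. -/
theorem Reaches.exists_queries (h : M.Reaches A n c c') :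
    ∃ S : Finset (List Bool), S.card ≤ n ∧ (∀ w ∈ S, w.length < c.queryTape.length + n) ∧
      ∀ A' : Oracle, (∀ w ∈ S, A w = A' w) → M.Reaches A' n c c' := by
  induction h with
  | refl => exact ⟨∅, by simp, by simp, fun _ _ => .refl _⟩
  | @tail n c d e h hs ih =>
    obtain ⟨S, hc, hl, hS⟩ := ih
    -- The query tape is recorded at every step, whether or not the step is a query; one string per
    -- step is all that the count needs.
    refine ⟨insert d.queryTape S, (Finset.card_insert_le _ _).trans (by omega), ?_, ?_⟩
    · intro w hw
      rcases Finset.mem_insert.1 hw with rfl | hw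
      · have := h.queryTape_length_le; omega
      · have := hl w hw; omega
    · intro A' hA'
      exact (hS A' fun w hw => hA' w (Finset.mem_insert_of_mem hw)).tail
        (hs.congr (hA' _ (Finset.mem_insert_self _ _)))

/-- The query tape starts empty and gains at most one bit per step, so `n` steps only see strings
shorter than `n`. -/
theorem Reaches.congr_length {x : List Bool} (h : M.Reaches A n (M.init x) c')
    (hA : ∀ w : List Bool, w.length < n → A w = A' w) : M.Reaches A' n (M.init x) c' := by
  obtain ⟨S, -, hl, hS⟩ := h.exists_queries
  exact hS A' fun w hw => hA w (by simpa [init] using hl w hw)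

end OracleTM

/-! ### Renaming of states, and the countable set of clocked deterministic machines -/

theorem P_subset_NP (A : Oracle) : P A ⊆ NP A := by
  rintro L ⟨Q, hQ, k, M, -, hM⟩
  exact ⟨Q, hQ, k, M, hM⟩

instance : Finite Dir :=
  Finite.of_injective (β := Bool) (fun d => match d with | .left => false | .right => true) (by
    intro a b; cases a <;> cases b <;> simp)

instance {Q : Type} [Finite Q] {k : ℕ} : Finite (Action Q k) := by
  let f : Action Q k → Bool ⊕ (Q × Q) ⊕ (Q × (Fin (k + 1) → Option Bool) ×
      (Fin (k + 1) → Option Dir) × Option Bool) := fun a => match a with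
    | .halt b => .inl b
    | .query y n => .inr (.inl (y, n))
    | .act q s d o => .inr (.inr (q, s, d, o))
  refine Finite.of_injective f ?_
  intro a b h
  cases a <;> cases b <;> simp_all [f]

instance {Q : Type} [Finite Q] {k : ℕ} : Finite (OracleTM Q k) := by
  refine Finite.of_injective
    (fun M : OracleTM Q k => (M.start, M.δ)) ?_
  rintro ⟨s, d⟩ ⟨s', d'⟩ h
  simpa using h

/-- Apply a map to the states that occur in an action. -/
def Action.map {Q Q' : Type} {k : ℕ} (f : Q → Q') : Action Q k → Action Q' k
  | .halt b => .halt b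
  | .query y n => .query (f y) (f n)
  | .act q s d o => .act (f q) s d o

/-- Apply a map to the state of a configuration. -/
def Config.mapState {Q Q' : Type} {k : ℕ} (f : Q → Q') (c : Config Q k) : Config Q' k where
  status := c.status.map f id
  tapes := c.tapes
  queryTape := c.queryTape

theorem Config.perform_mapState {Q Q' : Type} {k : ℕ} (f : Q → Q') (A : Oracle)
    (c : Config Q k) (a : Action Q k) :
    (c.mapState f).perform A (a.map f) = (c.perform A a).mapState f := by
  cases a with
  | halt b => rfl
  | query y n => by_cases h : A c.queryTape <;> simp [Config.perform, Config.mapState, Action.map, h]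
  | act q s d o => rfl

/-- Rename the states of a machine. -/
def OracleTM.rename {Q Q' : Type} {k : ℕ} (M : OracleTM Q k) (e : Q ≃ Q') : OracleTM Q' k where
  start := e M.start
  δ q s := Action.map e '' M.δ (e.symm q) s

theorem OracleTM.Deterministic.rename {Q Q' : Type} {k : ℕ} {M : OracleTM Q k}
    (hM : M.Deterministic) (e : Q ≃ Q') : (M.rename e).Deterministic := by
  intro q s
  obtain ⟨a, ha, hu⟩ := hM (e.symm q) s
  refine ⟨a.map e, ⟨a, ha, rfl⟩, ?_⟩
  rintro _ ⟨b, hb, rfl⟩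
  rw [hu b hb]

theorem OracleTM.step_rename_iff {Q Q' : Type} {k : ℕ} {M : OracleTM Q k} {e : Q ≃ Q'}
    {A : Oracle} (c : Config Q k) (d : Config Q' k) :
    (M.rename e).Step A (c.mapState e) d ↔ ∃ c', M.Step A c c' ∧ d = c'.mapState e := by
  constructor
  · rintro ⟨q, hq, _, ⟨a, ha, rfl⟩, rfl⟩
    rw [Config.perform_mapState]
    refine ⟨_, ⟨e.symm q, ?_, a, ha, rfl⟩, rfl⟩
    cases hst : c.status with
    | inl r => simp [Config.mapState, hst] at hq; simp [← hq]
    | inr b => simp [Config.mapState, hst] at hq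
  · rintro ⟨_, ⟨q, hq, a, ha, rfl⟩, rfl⟩
    rw [← Config.perform_mapState]
    exact ⟨e q, by simp [Config.mapState, hq], _,
      ⟨a, by rw [Equiv.symm_apply_apply]; exact ha, rfl⟩, rfl⟩

theorem OracleTM.DecidesInPolyTime.rename {Q Q' : Type} {k : ℕ} {M : OracleTM Q k}
    {A : Oracle} {L : Language Bool} (h : M.DecidesInPolyTime A L) (e : Q ≃ Q') :
    (M.rename e).DecidesInPolyTime A L := by
  refine decides_of_map OracleTM.step_rename_iff (fun x => rfl) (fun c => ?_) h
  cases hst : c.status <;> simp [Config.mapState, hst]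

/-- A deterministic machine on a standard state set, with a polynomial. -/
structure Decider : Type where
  /-- The number of states. -/
  q : ℕ
  /-- The number of tapes, minus one. -/
  k : ℕ
  /-- The machine. -/
  machine : OracleTM (Fin q) k
  /-- The clock. -/
  clock : Polynomial ℕ
  det : machine.Deterministic

/-- The oracles with which the machine decides in the time given by the clock. -/
def Decider.Decides (D : Decider) (A : Oracle) (L : Language Bool) : Prop :=
  D.machine.RunsInTime A (fun n => D.clock.eval n) ∧ ∀ x, x ∈ L ↔ D.machine.Accepts A x

instance : Countable (Polynomial ℕ) := by
  rw [← Cardinal.mk_le_aleph0_iff]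
  exact Polynomial.cardinalMk_le_max.trans (by simp)

instance : Countable Decider := by
  refine Function.Injective.countable
    (f := fun D : Decider => (⟨D.q, D.k, D.machine, D.clock⟩ :
      Σ q : ℕ, Σ k : ℕ, OracleTM (Fin q) k × Polynomial ℕ)) ?_
  rintro ⟨q, k, M, p, h⟩ ⟨q', k', M', p', h'⟩ heq
  simp only [Sigma.mk.injEq] at heq
  obtain ⟨rfl, h1⟩ := heq
  simp only [heq_eq_eq, Sigma.mk.injEq] at h1
  obtain ⟨rfl, h2⟩ := h1
  simp only [heq_eq_eq, Prod.mk.injEq] at h2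
  obtain ⟨rfl, rfl⟩ := h2
  rfl

/-- Renumbering a finite state set as `Fin q` replaces the quantifier over all finite types by one
over a countable type. -/
theorem mem_P_iff_exists_decider {A : Oracle} {L : Language Bool} :
    L ∈ P A ↔ ∃ D : Decider, D.Decides A L := by
  constructor
  · rintro ⟨Q, hQ, k, M, hdet, hM⟩
    obtain ⟨q, ⟨e⟩⟩ := Finite.exists_equiv_fin Q
    obtain ⟨⟨p, hp⟩, hL⟩ := hM.rename e
    exact ⟨⟨q, k, M.rename e, p, hdet.rename e⟩, hp, hL⟩
  · rintro ⟨D, h1, h2⟩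
    exact ⟨Fin D.q, inferInstance, D.k, D.machine, D.det, ⟨D.clock, h1⟩, h2⟩

/-! ### Sets of oracles with finite use -/

theorem finite_length_lt (n : ℕ) : {w : List Bool | w.length < n}.Finite :=
  List.finite_length_lt Bool n

/-- There are finitely many strings shorter than `n`, so the oracles agreeing with `A` on them form
a basic open neighbourhood of `A`. -/
theorem isOpen_of_local {S : Set Oracle} (n : ℕ)
    (h : ∀ A A' : Oracle, (∀ w : List Bool, w.length < n → A w = A' w) → A ∈ S → A' ∈ S) :
    IsOpen S := by
  rw [isOpen_iff_forall_mem_open]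
  intro A hA
  refine ⟨{A' | ∀ w ∈ {w : List Bool | w.length < n}, A w = A' w},
    fun A' hA' => h A A' hA' hA, ?_, fun _ _ => rfl⟩
  have : {A' : Oracle | ∀ w ∈ {w : List Bool | w.length < n}, A w = A' w} =
      ⋂ w ∈ {w : List Bool | w.length < n}, {A' : Oracle | A' w = A w} := by
    ext A'; simp [eq_comm]
  rw [this]
  refine (finite_length_lt n).isOpen_biInter fun w _ => ?_
  exact isOpen_discrete ({A w} : Set Bool) |>.preimage (continuous_apply (A := fun _ => Bool) w)

theorem isClopen_of_local {S : Set Oracle} (n : ℕ)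
    (h : ∀ A A' : Oracle, (∀ w : List Bool, w.length < n → A w = A' w) → A ∈ S → A' ∈ S) :
    IsClopen S := by
  refine ⟨⟨isOpen_of_local n fun A A' hA hS hS' => hS ?_⟩, isOpen_of_local n h⟩
  exact h A' A (fun w hw => (hA w hw).symm) hS'

namespace OracleTM

variable {Q Q' : Type} {k k' : ℕ}

/-- Acceptance within a given number of steps. -/
def AcceptsWithin (M : OracleTM Q k) (A : Oracle) (N : ℕ) (x : List Bool) : Prop :=
  ∃ n ≤ N, ∃ c, M.Reaches A n (M.init x) c ∧ c.status = Sum.inr true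

theorem RunsInTime.accepts_iff {M : OracleTM Q k} {A : Oracle} {p : ℕ → ℕ}
    (h : M.RunsInTime A p) (x : List Bool) :
    M.Accepts A x ↔ M.AcceptsWithin A (p x.length) x :=
  ⟨fun ⟨n, c, hc, hs⟩ => ⟨n, h x n c hc, c, hc, hs⟩, fun ⟨n, _, c, hc, hs⟩ => ⟨n, c, hc, hs⟩⟩

theorem AcceptsWithin.congr {M : OracleTM Q k} {A A' : Oracle} {N : ℕ} {x : List Bool}
    (h : M.AcceptsWithin A N x) (hA : ∀ w : List Bool, w.length < N → A w = A' w) :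
    M.AcceptsWithin A' N x := by
  obtain ⟨n, hn, c, hc, hs⟩ := h
  exact ⟨n, hn, c, hc.congr_length fun w hw => hA w (by omega), hs⟩

/-- For fixed `x`, `n` and `c`, reaching `c` in `n` steps is a clopen condition on the oracle;
obeying the bound is an intersection of such conditions. -/
theorem isClosed_runsInTime (M : OracleTM Q k) (p : ℕ → ℕ) :
    IsClosed {A | M.RunsInTime A p} := by
  simp only [RunsInTime, Set.ofPred_forall]
  refine isClosed_iInter fun x => isClosed_iInter fun n => isClosed_iInter fun c => ?_
  refine (isClopen_of_local n fun A A' hA h => ?_).1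
  exact fun hr => h (Reaches.congr_length hr fun w hw => (hA w hw).symm)

/-- Acceptance alone is only an open condition. Once both machines obey time bounds it may be
replaced by acceptance within the bound, which is clopen for each input. -/
theorem isClosed_decides (M : OracleTM Q k) (p : ℕ → ℕ) (N : OracleTM Q' k') (r : ℕ → ℕ)
    (hN : ∀ A, N.RunsInTime A r) :
    IsClosed {A | M.RunsInTime A p ∧ ∀ x, N.Accepts A x ↔ M.Accepts A x} := by
  have : {A | M.RunsInTime A p ∧ ∀ x, N.Accepts A x ↔ M.Accepts A x} =
      {A | M.RunsInTime A p} ∩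
        ⋂ x, {A | N.AcceptsWithin A (r x.length) x ↔ M.AcceptsWithin A (p x.length) x} := by
    ext A
    simp only [Set.mem_ofPred_eq, Set.mem_inter_iff, Set.mem_iInter]
    refine and_congr_right fun h => forall_congr' fun x => ?_
    rw [h.accepts_iff, (hN A).accepts_iff]
  rw [this]
  refine (isClosed_runsInTime M p).inter (isClosed_iInter fun x => ?_)
  refine (isClopen_of_local (max (r x.length) (p x.length)) fun A A' hA h => ?_).1
  have hA' : ∀ w : List Bool, w.length < max (r x.length) (p x.length) → A' w = A w :=
    fun w hw => (hA w hw).symm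
  constructor
  · intro h'
    exact (h.1 (h'.congr fun w hw => hA' w (lt_max_of_lt_left hw))).congr
      fun w hw => hA w (lt_max_of_lt_right hw)
  · intro h'
    exact (h.2 (h'.congr fun w hw => hA' w (lt_max_of_lt_right hw))).congr
      fun w hw => hA w (lt_max_of_lt_left hw)

end OracleTM

/-! ### The upper bound from a complete language -/

/-- The language accepted by a machine. -/
def OracleTM.language {Q : Type} {k : ℕ} (M : OracleTM Q k) (A : Oracle) : Language Bool :=
  fun x => M.Accepts A x

/-- If one machine, fast with every oracle, accepts a complete language, the separating oracles
form a `Π⁰₂` set. -/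
theorem isPiTwo_of_complete {Q : Type} [Finite Q] {k : ℕ} (U : OracleTM Q k) (r : Polynomial ℕ)
    (hU : ∀ A, U.RunsInTime A fun n => r.eval n)
    (hcomplete : ∀ A, U.language A ∈ P A → NP A ⊆ P A) : IsPiTwo O := by
  have hO : O = ⋂ D : Decider,
      {A | D.machine.RunsInTime A (fun n => D.clock.eval n) ∧
        ∀ x, U.Accepts A x ↔ D.machine.Accepts A x}ᶜ := by
    ext A
    -- The machine `U` itself puts its language into `NP A`, so equality of the classes puts it into
    -- `P A`; completeness gives the converse.
    have h1 : A ∈ O ↔ ¬ U.language A ∈ P A := by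
      refine not_congr ⟨fun h => ?_, fun h => (P_subset_NP A).antisymm (hcomplete A h)⟩
      rw [h]
      exact ⟨Q, inferInstance, k, U, ⟨r, hU A⟩, fun x => Iff.rfl⟩
    rw [h1, mem_P_iff_exists_decider]
    simp only [Set.mem_iInter, Set.mem_compl_iff, not_exists]
    rfl
  rw [hO]
  exact IsGδ.iInter_of_isOpen fun D =>
    (OracleTM.isClosed_decides _ _ U _ hU).isOpen_compl

/-! ### Finite modifications of the oracle -/

/-- Simulate a machine with an oracle that differs from the actual one on the set `D` of strings of
length at most `N`; the first `N + 1` bits on the query tape are remembered in the state. -/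
def OracleTM.patch {Q : Type} {k : ℕ} (M : OracleTM Q k) (D : Set (List Bool)) [DecidablePred (· ∈ D)]
    (N : ℕ) : OracleTM (Q × {l : List Bool // l.length ≤ N + 1}) k where
  start := (M.start, ⟨[], by simp⟩)
  δ q s := (fun a : Action Q k => match a with
    | .halt b => .halt b
    | .query y n => if q.2.1 ∈ D then .query (n, ⟨[], by simp⟩) (y, ⟨[], by simp⟩)
        else .query (y, ⟨[], by simp⟩) (n, ⟨[], by simp⟩)
    | .act r s d o => .act (r, ⟨(q.2.1 ++ o.toList).take (N + 1), by simp⟩) s d o) '' M.δ q.1 s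

/-- The configuration of the patched machine that corresponds to a configuration. -/
def Config.patch {Q : Type} {k : ℕ} (N : ℕ) (c : Config Q k) :
    Config (Q × {l : List Bool // l.length ≤ N + 1}) k where
  status := c.status.map (fun q => (q, ⟨c.queryTape.take (N + 1), by simp⟩)) id
  tapes := c.tapes
  queryTape := c.queryTape

/-- On `D` the two oracles disagree, so exchanging the two successor states of a query restores the
answer of `A`; off `D` they agree. The remembered string remains a prefix of the query tape, because
cutting before or after appending a bit gives the same prefix. -/
theorem OracleTM.step_patch_iff {Q : Type} {k : ℕ} {M : OracleTM Q k} {A A' : Oracle}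
    {D : Set (List Bool)} [DecidablePred (· ∈ D)] {N : ℕ} (hN : ∀ w ∈ D, w.length ≤ N)
    (hD : ∀ w, w ∈ D ↔ A w ≠ A' w) (c : Config Q k)
    (d : Config (Q × {l : List Bool // l.length ≤ N + 1}) k) :
    (M.patch D N).Step A' (c.patch N) d ↔ ∃ c', M.Step A c c' ∧ d = c'.patch N := by
  -- Remembering `N + 1` bits rather than `N` matters: a string longer than `N` leaves a prefix of
  -- length `N + 1`, which is too long to be in `D`.
  have hmem : ∀ w : List Bool, w.take (N + 1) ∈ D ↔ w ∈ D := by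
    intro w
    rcases le_or_gt w.length N with h | h
    · rw [List.take_of_length_le (by omega)]
    · constructor
      · intro h'
        have := hN _ h'
        rw [List.length_take] at this
        omega
      · intro h'
        have := hN _ h'
        omega
  have key : ∀ (q : Q) (a : Action Q k), c.status = Sum.inl q →
      (c.patch N).perform A' ((fun a : Action Q k => match a with
        | .halt b => .halt b
        | .query y n => if c.queryTape.take (N + 1) ∈ D
            then .query (n, ⟨[], by simp⟩) (y, ⟨[], by simp⟩)
            else .query (y, ⟨[], by simp⟩) (n, ⟨[], by simp⟩)
        | .act r s d o => .act (r, ⟨(c.queryTape.take (N + 1) ++ o.toList).take (N + 1),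
            by simp⟩) s d o) a) = (c.perform A a).patch N := by
    intro q a hq
    cases a with
    | halt b => rfl
    | query y n =>
      simp only [hmem]
      by_cases h : c.queryTape ∈ D
      · have h' := (hD _).1 h
        rw [if_pos h]
        cases h1 : A c.queryTape <;> cases h2 : A' c.queryTape <;>
          simp_all [Config.perform, Config.patch]
      · have h' : A c.queryTape = A' c.queryTape := by
          by_contra hne; exact h ((hD _).2 hne)
        rw [if_neg h]
        cases h1 : A c.queryTape <;> simp_all [Config.perform, Config.patch]
    | act r s d o =>
      simp only [Config.perform, Config.patch, Sum.map_inl, Config.mk.injEq, and_true]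
      congr 3
      rw [List.take_append, List.take_append, List.take_take, min_self, List.length_take]
      rcases le_total (N + 1) c.queryTape.length with h | h
      · simp [h]
      · simp [h]
  constructor
  · rintro ⟨r, hr, _, ⟨a, ha, rfl⟩, rfl⟩
    cases hst : c.status with
    | inr b => simp [Config.patch, hst] at hr
    | inl q =>
      simp only [Config.patch, hst, Sum.map_inl, Sum.inl.injEq] at hr
      subst hr
      exact ⟨_, ⟨q, hst, a, ha, rfl⟩, key q a hst⟩
  · rintro ⟨_, ⟨q, hq, a, ha, rfl⟩, rfl⟩
    refine ⟨(q, ⟨c.queryTape.take (N + 1), by simp⟩), by simp [Config.patch, hq], _,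
      ⟨a, ha, rfl⟩, (key q a hq).symm⟩

instance (N : ℕ) : Finite {l : List Bool // l.length ≤ N + 1} :=
  (List.finite_length_le Bool (N + 1)).to_subtype

theorem OracleTM.DecidesInPolyTime.exists_patch {A A' : Oracle} (h : {w | A w ≠ A' w}.Finite)
    {Q : Type} {k : ℕ} {M : OracleTM Q k} {L : Language Bool} (hM : M.DecidesInPolyTime A L) :
    ∃ (N : ℕ) (M' : OracleTM (Q × {l : List Bool // l.length ≤ N + 1}) k),
      (M.Deterministic → M'.Deterministic) ∧ M'.DecidesInPolyTime A' L := by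
  classical
  obtain ⟨N, hN⟩ : ∃ N, ∀ w ∈ {w | A w ≠ A' w}, w.length ≤ N := by
    obtain ⟨N, hN⟩ := (h.image List.length).bddAbove
    exact ⟨N, fun w hw => hN ⟨w, hw, rfl⟩⟩
  refine ⟨N, M.patch {w | A w ≠ A' w} N, fun hdet q s => ?_, ?_⟩
  · obtain ⟨a, ha, hu⟩ := hdet q.1 s
    refine ⟨_, ⟨a, ha, rfl⟩, ?_⟩
    rintro _ ⟨b, hb, rfl⟩
    rw [hu b hb]
  · refine decides_of_map (OracleTM.step_patch_iff hN fun w => Iff.rfl) (fun x => ?_)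
      (fun c => ?_) hM
    · simp [OracleTM.init, Config.patch, OracleTM.patch]
    · cases hst : c.status <;> simp [Config.patch, hst]

theorem P_subset_of_finite {A A' : Oracle} (h : {w | A w ≠ A' w}.Finite) : P A ⊆ P A' := by
  rintro L ⟨Q, hQ, k, M, hdet, hM⟩
  obtain ⟨N, M', h1, h2⟩ := hM.exists_patch h
  exact ⟨_, inferInstance, k, M', h1 hdet, h2⟩

theorem NP_subset_of_finite {A A' : Oracle} (h : {w | A w ≠ A' w}.Finite) : NP A ⊆ NP A' := by
  rintro L ⟨Q, hQ, k, M, hM⟩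
  obtain ⟨N, M', -, h2⟩ := hM.exists_patch h
  exact ⟨_, inferInstance, k, M', h2⟩

/-- Both relativized classes are invariant under finite changes of the oracle. -/
theorem not_mem_O_of_finite {A A' : Oracle} (h : {w | A w ≠ A' w}.Finite) (hA : A ∉ O) :
    A' ∉ O := by
  have h' : {w | A' w ≠ A w}.Finite := by simpa only [ne_comm] using h
  have hA : P A = NP A := not_not.1 hA
  have : P A' = NP A' := by
    refine (P_subset_NP A').antisymm ((NP_subset_of_finite h').trans ?_)
    rw [← hA]
    exact P_subset_of_finite h
  exact not_not.2 this

/-! ### The language of lengths of strings in the oracle -/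

/-- The strings that are as long as some string in the oracle. -/
def levelLanguage (A : Oracle) : Language Bool :=
  fun x => ∃ y : List Bool, y.length = x.length ∧ A y = true

/-- Guess a string that is as long as the input, and query it. The states are `0` (guess), `1` and
`2` (the answer was yes, no). -/
def levelMachine : OracleTM (Fin 3) 0 where
  start := 0
  δ q s :=
    if q = 0 then
      if s 0 = none then {.query 1 2} else {a | ∃ b, a = .act 0 s (fun _ => some .right) (some b)}
    else {.halt (q == 1)}

/-- The step number determines the phase: `x.length` guesses, one query, one verdict. This gives the
time bound and soundness together. -/
theorem levelMachine_inv {A : Oracle} {x : List Bool} {n : ℕ} {c : Config (Fin 3) 0}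
    (h : levelMachine.Reaches A n (levelMachine.init x) c) :
    (n ≤ x.length ∧ c.status = Sum.inl 0 ∧ Holds (c.tapes 0) (listContent x) n ∧
      c.queryTape.length = n) ∨
    (n = x.length + 1 ∧ ∃ y : List Bool, y.length = x.length ∧
      c.status = Sum.inl (if A y then 1 else 2)) ∨
    (n = x.length + 2 ∧ ∃ y : List Bool, y.length = x.length ∧ c.status = Sum.inr (A y)) := by
  induction n generalizing c with
  | zero =>
    rw [← OracleTM.reaches_zero h]
    exact Or.inl ⟨Nat.zero_le _, rfl, by simpa [OracleTM.init] using holds_mk₁ x, rfl⟩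
  | succ n ih =>
    obtain ⟨d, hd, q, hq, a, ha, rfl⟩ := OracleTM.reaches_succ h
    rcases ih hd with ⟨hn, hst, hT, hl⟩ | ⟨rfl, y, hy, hst⟩ | ⟨rfl, y, hy, hst⟩
    · rw [hst] at hq
      obtain rfl := Sum.inl.inj hq
      simp only [levelMachine, if_true] at ha
      rcases hn.lt_or_eq with hlt | rfl
      · have hne : (d.tapes 0).head ≠ none := by
          rw [hT.head, listContent]; simp [hlt]
        rw [if_neg hne] at ha
        obtain ⟨b, rfl⟩ := ha
        refine Or.inl ⟨hlt, rfl, ?_, by simp [Config.perform, hl]⟩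
        rw [perform_act]
        simpa [dirShift] using hT.actOn_self hT.head (some .right)
      · have he : (d.tapes 0).head = none := by rw [hT.head, listContent_length]
        rw [if_pos he] at ha
        obtain rfl := ha
        exact Or.inr (Or.inl ⟨rfl, d.queryTape, hl, rfl⟩)
    · rw [hst] at hq
      obtain rfl := Sum.inl.inj hq
      refine Or.inr (Or.inr ⟨rfl, y, hy, ?_⟩)
      cases hA : A y <;> simp [hA, levelMachine] at ha <;> subst ha <;> rfl
    · rw [hst] at hq; cases hq

theorem levelMachine_guess {A : Oracle} {x : List Bool} (y : List Bool)
    (hy : y.length ≤ x.length) :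
    ∃ c, levelMachine.Reaches A y.length (levelMachine.init x) c ∧ c.status = Sum.inl 0 ∧
      Holds (c.tapes 0) (listContent x) y.length ∧ c.queryTape = y := by
  induction y using List.reverseRecOn with
  | nil => exact ⟨_, .refl _, rfl, by simpa [OracleTM.init] using holds_mk₁ x, rfl⟩
  | append_singleton y b ih =>
    simp only [List.length_append, List.length_singleton] at hy ⊢
    obtain ⟨c, hc, hst, hT, hq⟩ := ih (by omega)
    refine ⟨_, hc.tail ⟨0, hst, .act 0 (fun i => (c.tapes i).head) (fun _ => some .right) (some b),
      ?_, rfl⟩, rfl, ?_, ?_⟩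
    · have hne : (c.tapes 0).head ≠ none := by
        rw [hT.head, listContent]; simp; omega
      simp only [levelMachine, if_true]
      rw [if_neg hne]
      exact ⟨b, rfl⟩
    · rw [perform_act]
      simpa [dirShift] using hT.actOn_self hT.head (some .right)
    · simp [Config.perform, hq]

theorem levelLanguage_mem_NP (A : Oracle) : levelLanguage A ∈ NP A := by
  refine ⟨Fin 3, inferInstance, 0, levelMachine, ⟨Polynomial.X + 2, fun x n c hc => ?_⟩,
    fun x => ⟨?_, ?_⟩⟩
  · simp only [Polynomial.eval_add, Polynomial.eval_X, Polynomial.eval_ofNat]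
    rcases levelMachine_inv hc with h | h | h <;> omega
  · rintro ⟨y, hy, hA⟩
    obtain ⟨c, hc, hst, hT, hq⟩ := levelMachine_guess (A := A) (x := x) y hy.le
    have he : (c.tapes 0).head = none := by rw [hT.head, hy, listContent_length]
    refine ⟨_, _, (hc.tail ⟨0, hst, .query 1 2, ?_, rfl⟩).tail
      ⟨1, ?_, .halt true, by simp [levelMachine], rfl⟩, rfl⟩
    · simp only [levelMachine, if_true]
      rw [if_pos he]
      rfl
    · simp [Config.perform, hq, hA]
  · rintro ⟨n, c, hc, hst⟩
    rcases levelMachine_inv hc with h | ⟨-, y, hy, h⟩ | ⟨-, y, hy, h⟩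
    · rw [h.2.1] at hst; cases hst
    · rw [h] at hst; cases hst
    · exact ⟨y, hy, Sum.inr.inj (h.symm.trans hst)⟩

/-! ### Diagonalization -/

/-- The Baker-Gill-Solovay step. With level `l` empty, a clocked machine that rejects `0 ^ l` has
looked at fewer than `2 ^ l` strings, so some string of length `l` can be added without its
noticing. The bound `L` exceeds the length of every string involved, so the failure survives all
later changes at lengths from `L` on. -/
theorem exists_diagonal (D : Decider) {l L : ℕ} (hexp : D.clock.eval l < 2 ^ l)
    (hL : D.clock.eval l ≤ L) (hlL : l < L) (A : Oracle) :
    ∃ A' : Oracle, (∀ w : List Bool, w.length ≠ l → A' w = A w) ∧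
      ∀ A'' : Oracle, (∀ w : List Bool, w.length < L → A'' w = A' w) →
        ¬ D.Decides A'' (levelLanguage A'') := by
  classical
  let A₀ : Oracle := fun w => if w.length = l then false else A w
  let x : List Bool := List.replicate l false
  have hx : x.length = l := by simp [x]
  -- If some one-element level makes the machine not accept, that level is used, as `x` then belongs
  -- to the language. Otherwise the level is left empty, and rejecting `x` will contradict
  -- acceptance with an unseen `y` added.
  by_cases h : ∃ y : List Bool, y.length = l ∧
      ¬ D.machine.AcceptsWithin (Function.update A₀ y true) (D.clock.eval l) x
  · obtain ⟨y, hy, hacc⟩ := h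
    refine ⟨Function.update A₀ y true, fun w hw => ?_, fun A'' hA'' hD => ?_⟩
    · rw [Function.update_of_ne (by rintro rfl; exact hw hy)]
      simp [A₀, hw]
    · have hmem : x ∈ levelLanguage A'' :=
        ⟨y, hy.trans hx.symm, by rw [hA'' y (by omega)]; simp⟩
      rw [hD.2, hD.1.accepts_iff, hx] at hmem
      exact hacc (hmem.congr fun w hw => hA'' w (by omega))
  · push Not at h
    refine ⟨A₀, fun w hw => by simp [A₀, hw], fun A'' hA'' hD => ?_⟩
    have hnot : ¬ D.machine.Accepts A'' x := by
      rw [← hD.2]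
      rintro ⟨y, hy, hA⟩
      rw [hx] at hy
      rw [hA'' y (by omega)] at hA
      simp [A₀, hy] at hA
    obtain ⟨n, c, b, hn, hc, hb⟩ := D.det.exists_halted (A := A'') (c := D.machine.init x)
      (hD.1 x)
    cases b with
    | true => exact hnot ⟨n, c, hc, hb⟩
    | false =>
      replace hn : n ≤ D.clock.eval l := by rwa [hx] at hn
      obtain ⟨S, hcard, hlen, hS⟩ := hc.exists_queries
      -- There are `2 ^ l` strings of length `l`, and `S` has at most `D.clock.eval l` elements.
      obtain ⟨y, hy, hyS⟩ : ∃ y : List Bool, y.length = l ∧ y ∉ S := by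
        by_contra! hcon
        have : Fintype.card (List.Vector Bool l) ≤ S.card := by
          rw [← Finset.card_univ]
          exact Finset.card_le_card_of_injOn (fun v : List.Vector Bool l => v.1)
            (fun v _ => hcon v.1 v.2) (fun v _ w _ hvw => Subtype.ext hvw)
        rw [card_vector, Fintype.card_bool] at this
        omega
      obtain ⟨n', -, c', hc', hb'⟩ := h y hy
      -- The rejecting computation persists when `y` is added, although by `h` the machine then
      -- accepts; determinism forbids both.
      have hr := hS (Function.update A₀ y true) fun w hw => by
        have h1 : w ≠ y := by rintro rfl; exact hyS hw
        have h2 : w.length < n := by simpa [OracleTM.init] using hlen w hw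
        rw [Function.update_of_ne h1, hA'' w (by omega)]
      exact Bool.false_ne_true (D.det.halted_unique hr hb hc' hb')

/-! ### Growth of polynomials and the choice of levels -/

theorem exists_poly_bound (p : Polynomial ℕ) : ∃ c d : ℕ, ∀ n, p.eval n ≤ c * (n + 1) ^ d := by
  induction p using Polynomial.induction_on' with
  | add p q hp hq =>
    obtain ⟨c, d, h⟩ := hp
    obtain ⟨c', d', h'⟩ := hq
    -- With base `n + 1` the powers increase with the exponent even at `n = 0`, so both summands fit
    -- under the exponent `d + d'`.
    refine ⟨c + c', d + d', fun n => ?_⟩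
    rw [Polynomial.eval_add, add_mul]
    refine add_le_add ((h n).trans ?_) ((h' n).trans ?_) <;>
    · refine Nat.mul_le_mul_left _ (Nat.pow_le_pow_right (by omega) (by omega))
  | monomial d c =>
    refine ⟨c, d, fun n => ?_⟩
    rw [Polynomial.eval_monomial]
    exact Nat.mul_le_mul_left _ (Nat.pow_le_pow_left (by omega) _)

theorem eventually_poly_lt_two_pow (p : Polynomial ℕ) :
    ∀ᶠ n : ℕ in Filter.atTop, p.eval n < 2 ^ n := by
  obtain ⟨c, d, h⟩ := exists_poly_bound p
  have h1 := (isLittleO_pow_const_const_pow_of_one_lt (R := ℝ) d (one_lt_two : (1 : ℝ) < 2))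
  -- The factor `2 ^ d` pays for replacing `n + 1` by `2 * n`, and `c + 1` for the coefficient, with
  -- strictness to spare.
  have h2 := h1.def (c := 1 / ((c + 1) * 2 ^ d : ℝ)) (by positivity)
  filter_upwards [h2, Filter.eventually_ge_atTop 1] with n hn h1n
  simp only [norm_pow, RCLike.norm_natCast, Real.norm_ofNat] at hn
  rw [div_mul_eq_mul_div, one_mul, le_div_iff₀ (by positivity)] at hn
  have hn' : n ^ d * ((c + 1) * 2 ^ d) ≤ 2 ^ n := by exact_mod_cast hn
  refine (h n).trans_lt (lt_of_lt_of_le ?_ hn')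
  calc c * (n + 1) ^ d ≤ c * (2 * n) ^ d :=
        Nat.mul_le_mul_left _ (Nat.pow_le_pow_left (by omega) _)
    _ = n ^ d * (c * 2 ^ d) := by rw [mul_pow]; ring
    _ < n ^ d * ((c + 1) * 2 ^ d) := by
        apply Nat.mul_lt_mul_of_pos_left
        · apply Nat.mul_lt_mul_of_pos_right <;> [omega; positivity]
        · positivity

/-- At stage `n` only the clocks `e ≤ n` matter, so finitely many eventual conditions must be met.
The first leaves an unseen string at the level, the second puts the next level out of reach of the
computation just treated. -/
theorem exists_levels (p : ℕ → Polynomial ℕ) :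
    ∃ l : ℕ → ℕ, StrictMono l ∧ ∀ n, ∀ e ≤ n,
      (p e).eval (l n) < 2 ^ l n ∧ (p e).eval (l n) ≤ l (n + 1) := by
  have hex : ∀ n m : ℕ, ∃ N, m < N ∧ (∀ e ≤ n, (p e).eval N < 2 ^ N) ∧
      ∀ e ≤ n, (p e).eval m ≤ N := by
    intro n m
    have h1 : ∀ᶠ N : ℕ in Filter.atTop, ∀ e ∈ Set.Iic n, (p e).eval N < 2 ^ N :=
      (Filter.eventually_all_finite (Set.finite_Iic n)).2 fun e _ => eventually_poly_lt_two_pow _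
    have h2 : ∀ᶠ N : ℕ in Filter.atTop, ∀ e ∈ Set.Iic n, (p e).eval m ≤ N :=
      (Filter.eventually_all_finite (Set.finite_Iic n)).2 fun e _ => Filter.eventually_ge_atTop _
    obtain ⟨N, a, b, c⟩ := (h1.and (h2.and (Filter.eventually_gt_atTop m))).exists
    exact ⟨N, c, a, b⟩
  choose F hF1 hF2 hF3 using hex
  let l : ℕ → ℕ := fun n => Nat.rec (F 0 0) (fun n m => F (n + 1) m) n
  have hl : ∀ n, l (n + 1) = F (n + 1) (l n) := fun n => rfl
  refine ⟨l, strictMono_nat_of_lt_succ fun n => by rw [hl]; exact hF1 _ _, fun n e he => ⟨?_, ?_⟩⟩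
  · cases n with
    | zero => exact hF2 0 0 e he
    | succ n => exact hF2 (n + 1) (l n) e he
  · rw [hl]; exact hF3 _ _ e (by omega)

/-! ### The reduction, built in stages -/

instance : Nonempty Decider :=
  ⟨⟨1, 0, ⟨0, fun _ _ => {.halt true}⟩, 0, fun _ _ => ⟨_, rfl, fun _ h => h⟩⟩⟩

/-- Start from an oracle `B`, and apply the `n`-th modification if `b n = 1`; the modification may
depend on the number of earlier ones in `b`. -/
def stageOracle (B : Oracle) (next : ℕ → ℕ → Oracle → Oracle) (b : ℕ → Bool) : ℕ → Oracle
  | 0 => B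
  | n + 1 =>
    if b n then next n (Nat.count (fun i => b i = true) n) (stageOracle B next b n)
    else stageOracle B next b n

section Stage

variable {B : Oracle} {next : ℕ → ℕ → Oracle → Oracle} {l : ℕ → ℕ} {b : ℕ → Bool}

/-- The first `n` stages read only the first `n` bits, counts of ones included. This is the source
of continuity. -/
theorem stageOracle_congr {b' : ℕ → Bool} {n : ℕ} (h : ∀ i < n, b i = b' i) :
    stageOracle B next b n = stageOracle B next b' n := by
  induction n with
  | zero => rfl
  | succ n ih =>
    have hc : Nat.count (fun i => b i = true) n = Nat.count (fun i => b' i = true) n := by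
      rw [Nat.count_eq_card_filter_range, Nat.count_eq_card_filter_range]
      congr 1
      refine Finset.filter_congr fun i hi => ?_
      rw [h i (by have := Finset.mem_range.1 hi; omega)]
    simp only [stageOracle]
    rw [h n (by omega), hc, ih fun i hi => h i (by omega)]

/-- Stages from `m` on act at lengths `l m` and above, so shorter strings are settled. -/
theorem stageOracle_eq_of_le (hl : StrictMono l)
    (hnext : ∀ n e A w, w.length ≠ l n → next n e A w = A w) {m n : ℕ} (hmn : m ≤ n)
    {w : List Bool} (hw : w.length < l m) :
    stageOracle B next b n w = stageOracle B next b m w := by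
  induction n, hmn using Nat.le_induction with
  | base => rfl
  | succ n hmn ih =>
    rw [← ih]
    simp only [stageOracle]
    split_ifs
    · exact hnext _ _ _ _ (by have := hl.monotone hmn; omega)
    · rfl

theorem exists_of_stageOracle_ne (hnext : ∀ n e A w, w.length ≠ l n → next n e A w = A w)
    {n : ℕ} {w : List Bool} (h : stageOracle B next b n w ≠ B w) :
    ∃ i, b i = true ∧ w.length = l i := by
  induction n with
  | zero => exact absurd rfl h
  | succ n ih =>
    by_contra hcon
    push Not at hcon
    apply h
    simp only [stageOracle]
    by_contra h'
    split_ifs at h' with hb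
    · rw [hnext _ _ _ _ (hcon n hb)] at h'
      exact absurd (ih h') (by push Not; exact hcon)
    · exact absurd (ih h') (by push Not; exact hcon)

end Stage

/-- A continuous reduction of `H` to `O`, given an oracle that does not separate. -/
theorem exists_continuous_reduction {B : Oracle} (hB : B ∉ O) :
    ∃ f : (ℕ → Bool) → Oracle, Continuous f ∧ ∀ b, b ∈ H ↔ f b ∈ O := by
  obtain ⟨D, hD⟩ := exists_surjective_nat Decider
  obtain ⟨l, hl, hp⟩ := exists_levels fun e => (D e).clock
  have hex : ∀ n e (A : Oracle), ∃ A' : Oracle, (∀ w : List Bool, w.length ≠ l n → A' w = A w) ∧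
      (e ≤ n → ∀ A'' : Oracle, (∀ w : List Bool, w.length < l (n + 1) → A'' w = A' w) →
        ¬ (D e).Decides A'' (levelLanguage A'')) := by
    intro n e A
    by_cases he : e ≤ n
    · obtain ⟨A', h1, h2⟩ := exists_diagonal (D e) (hp n e he).1 (hp n e he).2
        (hl (Nat.lt_succ_self n)) A
      exact ⟨A', h1, fun _ => h2⟩
    · exact ⟨A, fun _ _ => rfl, fun h => absurd h he⟩
  choose next hnext hdiag using hex
  -- Since `l` is strictly increasing, `w.length < l (w.length + 1)`, so the value at `w` is final
  -- after `w.length + 1` stages.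
  refine ⟨fun b w => stageOracle B next b (w.length + 1) w, ?_, fun b => ⟨fun hb => ?_, ?_⟩⟩
  · refine continuous_pi fun w => continuous_discrete_rng.2 fun v => ?_
    rw [isOpen_iff_forall_mem_open]
    intro b hb
    refine ⟨⋂ i ∈ Set.Iio (w.length + 1), {b' : ℕ → Bool | b' i = b i}, fun b' hb' => ?_,
      (Set.finite_Iio _).isOpen_biInter fun i _ => ?_, by simp⟩
    · simp only [Set.mem_iInter, Set.mem_Iio, Set.mem_ofPred_eq] at hb'
      have := stageOracle_congr (B := B) (next := next) hb'
      rw [Set.mem_preimage, this]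
      exact hb
    · exact isOpen_discrete ({b i} : Set Bool) |>.preimage (continuous_apply (A := fun _ => Bool) i)
  · intro heq
    have hmem := levelLanguage_mem_NP (fun w => stageOracle B next b (w.length + 1) w)
    rw [← heq, mem_P_iff_exists_decider] at hmem
    obtain ⟨E, hE⟩ := hmem
    obtain ⟨e, rfl⟩ := hD E
    have hinf : (Set.ofPred fun i => b i = true).Infinite := hb
    -- Machine `e` is treated at the position `n` of the one of `b` that has exactly `e` ones before
    -- it. Then `e ≤ n`, so the growth conditions for its clock hold at level `l n`.
    have hbn : b (Nat.nth (fun i => b i = true) e) = true := Nat.nth_mem_of_infinite hinf e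
    have hcount := Nat.count_nth_of_infinite hinf e
    set n := Nat.nth (fun i => b i = true) e with hn
    refine hdiag n e (stageOracle B next b n) ?_ _ (fun w hw => ?_) hE
    · rw [← hcount]; exact Nat.count_le _
    · have h1 : stageOracle B next b (n + 1) = next n e (stageOracle B next b n) := by
        simp only [stageOracle]
        rw [if_pos hbn, hcount]
      rw [← h1]
      have h2 : w.length < l (w.length + 1) := hl.le_apply
      rcases le_total (w.length + 1) (n + 1) with h | h
      · exact (stageOracle_eq_of_le hl hnext h h2).symm
      · exact stageOracle_eq_of_le hl hnext h hw
  · intro hO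
    by_contra hb
    refine not_mem_O_of_finite ?_ hB hO
    -- Only the levels `l i` with `b i = 1` were touched, and each contains finitely many strings.
    have hfin : {n | b n = true}.Finite := Set.not_infinite.1 hb
    refine Set.Finite.subset (hfin.biUnion (t := fun i => {w : List Bool | w.length = l i})
      fun i _ => List.finite_length_eq Bool (l i)) ?_
    intro w hw
    obtain ⟨i, hi, hwi⟩ := exists_of_stageOracle_ne hnext (Ne.symm hw)
    exact Set.mem_biUnion (x := i) hi hwi

/-! ### Hardness -/

theorem dense_of_eventually_const (v : Bool) {S : Set (ℕ → Bool)}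
    (h : ∀ (b : ℕ → Bool) N, (fun i => if i < N then b i else v) ∈ S) : Dense S := by
  intro b
  refine mem_closure_of_tendsto (b := Filter.atTop) (f := fun N i => if i < N then b i else v)
    ?_ (Filter.Eventually.of_forall (h b))
  rw [tendsto_pi_nhds]
  intro i
  refine tendsto_const_nhds.congr' ?_
  filter_upwards [Filter.eventually_gt_atTop i] with N hN
  simp [hN]

theorem isGδ_H : IsGδ H := by
  have : H = ⋂ m : ℕ, ⋃ n : Set.Ici m, {b : ℕ → Bool | b n = true} := by
    ext b
    simp only [Set.mem_iInter, Set.mem_iUnion, Set.mem_ofPred_eq]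
    constructor
    · intro hb m
      obtain ⟨n, hn, hmn⟩ := Set.Infinite.exists_gt hb m
      exact ⟨⟨n, hmn.le⟩, hn⟩
    · intro hb
      refine Set.infinite_of_forall_exists_gt fun m => ?_
      obtain ⟨⟨n, hn⟩, hbn⟩ := hb (m + 1)
      exact ⟨n, hbn, hn⟩
  rw [this]
  refine IsGδ.iInter_of_isOpen fun m => isOpen_iUnion fun n => ?_
  exact isOpen_discrete ({true} : Set Bool) |>.preimage (continuous_apply (A := fun _ => Bool) n.1)

/-- Sequences that are eventually one, and those eventually zero, are dense. If `H` were a countable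
union of closed sets, then `H` and its complement would be disjoint dense countable intersections of
open sets, contrary to Baire. -/
theorem not_isSigmaTwo_H : ¬ IsSigmaTwo H := by
  rintro ⟨F, hF, hH⟩
  have hd : Dense H := dense_of_eventually_const true fun b N => by
    refine Set.infinite_of_forall_exists_gt fun m => ⟨max N (m + 1), ?_, ?_⟩
    · simp
    · simp
  have hdc : Dense Hᶜ := dense_of_eventually_const false fun b N => by
    refine Set.not_infinite.2 ((Set.finite_Iio N).subset fun i hi => ?_)
    by_contra hiN
    simp only [Set.mem_Iio] at hiN
    simp [hiN] at hi
  have hG : IsGδ Hᶜ := by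
    rw [hH, Set.compl_iUnion]
    exact IsGδ.iInter_of_isOpen fun n => (hF n).isOpen_compl
  have := hd.inter_of_Gδ isGδ_H hG hdc
  rw [Set.inter_compl_self] at this
  simpa using this.nonempty

theorem isPiTwoHard_of_reduction {f : (ℕ → Bool) → Oracle} (hf : Continuous f)
    (h : ∀ b, b ∈ H ↔ f b ∈ O) : IsPiTwoHard O := by
  rintro ⟨F, hF, hO⟩
  refine not_isSigmaTwo_H ⟨fun n => f ⁻¹' F n, fun n => (hF n).preimage hf, ?_⟩
  ext b
  rw [h b, hO]
  simp

/-! ### A universal nondeterministic machine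

The program of the machine is a list of blocks of elementary operations on three tapes. The machine
executes blocks in an arbitrary order, as long as its fuel, given in unary, lasts. -/

/-- The elementary operations. -/
inductive Op : Type where
  /-- On tape `i`, stop unless the scanned symbol is `test`, write `set`, and move. -/
  | basic (i : Fin 3) (test set : Option (Option Bool)) (move : Option Dir)
  /-- Append a bit to the query tape. -/
  | out (b : Bool)
  /-- Query the oracle, and stop unless the answer is `b`. -/
  | ask (b : Bool)
  /-- Accept. -/
  | acc

instance : Finite Op := by
  let f : Op → (Fin 3 × Option (Option Bool) × Option (Option Bool) × Option Dir) ⊕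
      Bool ⊕ Bool ⊕ Unit := fun o => match o with
    | .basic i t s d => .inl (i, t, s, d)
    | .out b => .inr (.inl b)
    | .ask b => .inr (.inr (.inl b))
    | .acc => .inr (.inr (.inr ()))
  refine Finite.of_injective f ?_
  intro a b h
  cases a <;> cases b <;> simp_all [f]

/-- The number of operations. -/
noncomputable def opCount : ℕ := Nat.card Op

/-- A numbering of the operations. -/
noncomputable def opCode : Op ≃ Fin opCount := Finite.equivFin Op

/-- The memory on which the operations act. -/
structure Mem : Type where
  /-- The tapes. -/
  tapes : Fin 3 → Tape (Option Bool)
  /-- The string on the query tape. -/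
  query : List Bool

/-- The effect of an operation, `none` if the operation is not possible. -/
def Op.run (A : Oracle) : Op → Mem → Option Mem
  | .basic i t s d, σ =>
    if ∀ v ∈ t, (σ.tapes i).head = v then
      some ⟨Function.update σ.tapes i (actOn (s.getD (σ.tapes i).head) d (σ.tapes i)), σ.query⟩
    else none
  | .out b, σ => some { σ with query := σ.query ++ [b] }
  | .ask b, σ => if A σ.query = b then some { σ with query := [] } else none
  | .acc, _ => none

/-- The effect of a list of operations. -/
def runOps (A : Oracle) : List Op → Mem → Option Mem
  | [], σ => some σ
  | o :: l, σ => (o.run A σ).bind (runOps A l)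

theorem runOps_append (A : Oracle) (l l' : List Op) (σ : Mem) :
    runOps A (l ++ l') σ = (runOps A l σ).bind (runOps A l') := by
  induction l generalizing σ with
  | nil => rfl
  | cons o l ih =>
    simp only [List.cons_append, runOps]
    cases o.run A σ with
    | none => rfl
    | some τ => exact ih τ

/-- The states of the universal machine. -/
inductive UState : Type where
  | load
  | idle
  | check
  | exec (j : Fin (opCount + 1))
  | ask (b : Bool)
  | reject

instance : Finite UState := by
  let f : UState → Fin 4 ⊕ Fin (opCount + 1) ⊕ Bool := fun q => match q with
    | .load => .inl 0
    | .idle => .inl 1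
    | .check => .inl 2
    | .reject => .inl 3
    | .exec j => .inr (.inl j)
    | .ask b => .inr (.inr b)
  refine Finite.of_injective f ?_
  intro a b h
  cases a <;> cases b <;> simp_all [f]

/-- A function on the indices of the tapes of the universal machine, given by its values at the
program tape, the fuel tape, and the work tapes. -/
def tapeCases {α : Type} (a b : α) (f : Fin 3 → α) : Fin 5 → α :=
  Fin.cons (α := fun _ => α) a (Fin.cons (α := fun _ => α) b f)

@[simp] theorem tapeCases_zero {α : Type} (a b : α) (f : Fin 3 → α) :
    tapeCases a b f 0 = a := rfl

@[simp] theorem tapeCases_one {α : Type} (a b : α) (f : Fin 3 → α) :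
    tapeCases a b f 1 = b := rfl

@[simp] theorem tapeCases_work {α : Type} (a b : α) (f : Fin 3 → α) (i : Fin 3) :
    tapeCases a b f i.succ.succ = f i := rfl

theorem tapeCases_ext {α : Type} {f g : Fin 5 → α} (h0 : f 0 = g 0) (h1 : f 1 = g 1)
    (h : ∀ i : Fin 3, f i.succ.succ = g i.succ.succ) : f = g := by
  funext i
  refine Fin.cases h0 (fun i => ?_) i
  exact Fin.cases h1 h i

/-- Move the program head in the direction `d`, and use one unit of fuel. -/
noncomputable def burn (next : UState) (d : Dir) (s : Fin 5 → Option Bool) : Action UState 4 :=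
  .act next s (tapeCases (some d) (some .left) fun _ => none) none

/-- The action for an operation. -/
noncomputable def opAct (s : Fin 5 → Option Bool) : Op → Action UState 4
  | .basic i t v d =>
    if ∀ u ∈ t, s i.succ.succ = u then
      .act (.exec 0)
        (tapeCases (s 0) (s 1)
          (Function.update (fun i => s i.succ.succ) i (v.getD (s i.succ.succ))))
        (tapeCases (some .right) (some .left) (Function.update (fun _ => none) i d)) none
    else .halt false
  | .out b => .act (.exec 0) s (tapeCases (some .right) (some .left) fun _ => none) (some b)
  | .ask b => burn (.ask b) .right s
  | .acc => .halt true

/-- The universal machine. -/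
noncomputable def universal : OracleTM UState 4 where
  start := .load
  δ q s := match q with
    | .load => {match s 0 with
      | some true => .act .load (tapeCases (s 0) (some true) fun i => s i.succ.succ)
          (tapeCases (some .right) (some .right) fun _ => none) none
      | some false => .act .idle
          (tapeCases (s 0) (s 1) (Function.update (fun i => s i.succ.succ) 0 (some true)))
          (tapeCases (some .right) (some .left) fun _ => none) none
      | none => .halt false}
    | .reject => {.halt false}
    | .ask b => {if b then .query (.exec 0) .reject else .query .reject (.exec 0)}
    | .idle =>
      if s 1 = some true then
        {a | a = burn .idle .left s ∨ a = burn .idle .right s ∨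
          (s 0 = some false ∧ a = burn .check .right s)}
      else {.halt false}
    | .check => {if s 1 = some true ∧ s 0 = some false then burn (.exec 0) .right s
        else .halt false}
    | .exec j => {if s 1 = some true then
        match s 0 with
        | some true => if h : (j : ℕ) + 1 < opCount + 1 then burn (.exec ⟨j + 1, h⟩) .right s
            else .halt false
        | some false => Fin.cases (burn .idle .right s) (fun i => opAct s (opCode.symm i)) j
        | none => .halt false
      else .halt false}

/-- A configuration of the universal machine. -/
def ucfg (q : UState) (T F : Tape (Option Bool)) (σ : Mem) : Config UState 4 where
  status := Sum.inl q
  tapes := tapeCases T F σ.tapes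
  queryTape := σ.query

/-- The steps of the universal machine that use fuel. -/
inductive UStep (A : Oracle) :
    UState → Tape (Option Bool) → Mem → UState → Tape (Option Bool) → Mem → Prop where
  | left {T σ} : UStep A .idle T σ .idle (T.move .left) σ
  | right {T σ} : UStep A .idle T σ .idle (T.move .right) σ
  | start {T σ} : T.head = some false → UStep A .idle T σ .check (T.move .right) σ
  | begin {T σ} : T.head = some false → UStep A .check T σ (.exec 0) (T.move .right) σ
  | count {T σ} (j : Fin (opCount + 1)) (h : (j : ℕ) + 1 < opCount + 1) : T.head = some true →
      UStep A (.exec j) T σ (.exec ⟨j + 1, h⟩) (T.move .right) σ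
  | finish {T σ} : T.head = some false → UStep A (.exec 0) T σ .idle (T.move .right) σ
  | op {T σ σ'} (o : Op) : T.head = some false → (∀ b, o ≠ .ask b) → o.run A σ = some σ' →
      UStep A (.exec (opCode o).succ) T σ (.exec 0) (T.move .right) σ'
  | ask {T σ} (b : Bool) : T.head = some false →
      UStep A (.exec (opCode (.ask b)).succ) T σ (.ask b) (T.move .right) σ

theorem actOn_head (T : Tape (Option Bool)) (d : Dir) : actOn T.head (some d) T = T.move d := by
  simp [actOn]

theorem actOn_head_none (T : Tape (Option Bool)) : actOn T.head none T = T := by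
  simp [actOn]

/-- The symbols scanned in a configuration. -/
def uheads (T F : Tape (Option Bool)) (σ : Mem) : Fin 5 → Option Bool :=
  tapeCases T.head F.head fun i => (σ.tapes i).head

theorem ucfg_heads (q : UState) (T F : Tape (Option Bool)) (σ : Mem) :
    (fun i => ((ucfg q T F σ).tapes i).head) = uheads T F σ :=
  tapeCases_ext rfl rfl fun _ => rfl

theorem perform_burn (A : Oracle) (q q' : UState) (T F : Tape (Option Bool)) (σ : Mem) (d : Dir) :
    (ucfg q T F σ).perform A (burn q' d (uheads T F σ)) =
      ucfg q' (T.move d) (F.move .left) σ := by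
  rw [burn, perform_act]
  simp only [ucfg, Option.toList_none, List.append_nil, Config.mk.injEq, true_and, and_true]
  exact tapeCases_ext (actOn_head _ _) (actOn_head _ _) fun i => actOn_head_none _

/-- The operation `ask` is not completed by this action: one action cannot both move heads and
query, so the query follows in a step of its own. -/
theorem perform_opAct (A : Oracle) (q : UState) (T F : Tape (Option Bool)) (σ : Mem) (o : Op) :
    (o = .acc ∧ (ucfg q T F σ).perform A (opAct (uheads T F σ) o) =
      { ucfg q T F σ with status := Sum.inr true }) ∨
    (∃ b, o = .ask b ∧ (ucfg q T F σ).perform A (opAct (uheads T F σ) o) =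
      ucfg (.ask b) (T.move .right) (F.move .left) σ) ∨
    ((∀ b, o ≠ .ask b) ∧ ∃ σ', o.run A σ = some σ' ∧
      (ucfg q T F σ).perform A (opAct (uheads T F σ) o) =
      ucfg (.exec 0) (T.move .right) (F.move .left) σ') ∨
    (o.run A σ = none ∧ (ucfg q T F σ).perform A (opAct (uheads T F σ) o) =
      { ucfg q T F σ with status := Sum.inr false }) := by
  cases o with
  | acc => exact Or.inl ⟨rfl, rfl⟩
  | ask b => exact Or.inr (Or.inl ⟨b, rfl, perform_burn A q _ T F σ _⟩)
  | out b =>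
    refine Or.inr (Or.inr (Or.inl ⟨by simp, _, rfl, ?_⟩))
    rw [opAct, perform_act]
    simp only [ucfg, Option.toList_some, Config.mk.injEq, true_and, and_true]
    exact tapeCases_ext (actOn_head _ _) (actOn_head _ _) fun i => actOn_head_none _
  | basic i t v d =>
    by_cases h : ∀ u ∈ t, (σ.tapes i).head = u
    · refine Or.inr (Or.inr (Or.inl ⟨by simp, _, if_pos h, ?_⟩))
      have h' : ∀ u ∈ t, uheads T F σ i.succ.succ = u := h
      rw [opAct, if_pos h', perform_act]
      simp only [ucfg, Option.toList_none, List.append_nil, Config.mk.injEq, true_and, and_true]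
      refine tapeCases_ext (actOn_head _ _) (actOn_head _ _) fun j => ?_
      simp only [tapeCases_work, uheads]
      by_cases hj : j = i
      · subst hj; simp
      · simp [hj, actOn_head_none]
    · refine Or.inr (Or.inr (Or.inr ⟨if_neg h, ?_⟩))
      have h' : ¬ ∀ u ∈ t, uheads T F σ i.succ.succ = u := h
      rw [opAct, if_neg h']
      rfl

theorem universal_step_of_UStep {A : Oracle} {q q' : UState} {T T' F : Tape (Option Bool)}
    {σ σ' : Mem} (h : UStep A q T σ q' T' σ') (hF : F.head = some true) :
    universal.Step A (ucfg q T F σ) (ucfg q' T' (F.move .left) σ') := by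
  refine ⟨q, rfl, ?_⟩
  rw [ucfg_heads]
  have hF' : uheads T F σ 1 = some true := hF
  cases h with
  | left => exact ⟨_, by simp only [universal, if_pos hF']; exact Or.inl rfl,
      (perform_burn _ _ _ _ _ _ _).symm⟩
  | right => exact ⟨_, by simp only [universal, if_pos hF']; exact Or.inr (Or.inl rfl),
      (perform_burn _ _ _ _ _ _ _).symm⟩
  | start hT => exact ⟨_, by simp only [universal, if_pos hF']; exact Or.inr (Or.inr ⟨hT, rfl⟩),
      (perform_burn _ _ _ _ _ _ _).symm⟩
  | begin hT =>
    have hT' : uheads T F σ 0 = some false := hT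
    exact ⟨_, by simp only [universal, hF', hT', and_self, if_true]; rfl,
      (perform_burn _ _ _ _ _ _ _).symm⟩
  | count j hj hT =>
    have hT' : uheads T F σ 0 = some true := hT
    exact ⟨_, by simp only [universal, if_pos hF', hT', dif_pos hj]; rfl,
      (perform_burn _ _ _ _ _ _ _).symm⟩
  | finish hT =>
    have hT' : uheads T F σ 0 = some false := hT
    exact ⟨_, by simp only [universal, if_pos hF', hT']; rfl,
      (perform_burn _ _ _ _ _ _ _).symm⟩
  | op o hT ho hrun =>
    have hT' : uheads T F σ 0 = some false := hT
    refine ⟨opAct (uheads T F σ) o, ?_, ?_⟩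
    · simp only [universal, if_pos hF', hT', Fin.cases_succ, Equiv.symm_apply_apply]; rfl
    · rcases perform_opAct A (.exec (opCode o).succ) T F σ o with
        ⟨rfl, _⟩ | ⟨b, rfl, _⟩ | ⟨_, τ, hτ, h⟩ | ⟨h, _⟩
      · cases hrun
      · exact absurd rfl (ho b)
      · rw [hrun] at hτ
        obtain rfl := Option.some.inj hτ
        exact h.symm
      · rw [hrun] at h; cases h
  | ask b hT =>
    have hT' : uheads T F σ 0 = some false := hT
    refine ⟨opAct (uheads T F σ) (.ask b), ?_, (perform_burn _ _ _ _ _ _ _).symm⟩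
    simp only [universal, if_pos hF', hT', Fin.cases_succ, Equiv.symm_apply_apply]; rfl

theorem universal_step_ask {A : Oracle} {T F : Tape (Option Bool)} {σ : Mem} (b : Bool) :
    universal.Step A (ucfg (.ask b) T F σ)
      (ucfg (if A σ.query = b then .exec 0 else .reject) T F { σ with query := [] }) := by
  refine ⟨_, rfl, _, rfl, ?_⟩
  cases b <;> cases h : A σ.query <;> simp [Config.perform, ucfg, h]

theorem universal_step_acc {A : Oracle} {T F : Tape (Option Bool)} {σ : Mem}
    (hT : T.head = some false) (hF : F.head = some true) :
    universal.Step A (ucfg (.exec (opCode .acc).succ) T F σ)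
      { ucfg (.exec (opCode .acc).succ) T F σ with status := Sum.inr true } := by
  refine ⟨_, rfl, .halt true, ?_, rfl⟩
  rw [ucfg_heads]
  have hF' : uheads T F σ 1 = some true := hF
  have hT' : uheads T F σ 0 = some false := hT
  simp only [universal, if_pos hF', hT', Fin.cases_succ, Equiv.symm_apply_apply]; rfl

/-- Inversion of the transition relation after loading. Apart from halting, only the query step
burns no fuel. -/
theorem universal_step_cases {A : Oracle} {q : UState} {T F : Tape (Option Bool)} {σ : Mem}
    {c : Config UState 4} (hq : q ≠ .load) (h : universal.Step A (ucfg q T F σ) c) :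
    c.status = Sum.inr false ∨
    (c.status = Sum.inr true ∧ q = .exec (opCode .acc).succ ∧ T.head = some false) ∨
    (F.head = some true ∧ ∃ q' T' σ', UStep A q T σ q' T' σ' ∧
      c = ucfg q' T' (F.move .left) σ') ∨
    (∃ b, q = .ask b ∧
      c = ucfg (if A σ.query = b then .exec 0 else .reject) T F { σ with query := [] }) := by
  obtain ⟨q₁, hq₁, a, ha, rfl⟩ := h
  obtain rfl : q = q₁ := Sum.inl.inj hq₁
  rw [ucfg_heads] at ha
  cases q with
  | load => exact absurd rfl hq
  | reject => obtain rfl := ha; exact Or.inl rfl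
  | ask b =>
    obtain rfl := ha
    refine Or.inr (Or.inr (Or.inr ⟨b, rfl, ?_⟩))
    cases b <;> cases h : A σ.query <;> simp [Config.perform, ucfg, h]
  | idle =>
    by_cases hF : uheads T F σ 1 = some true
    · simp only [universal, if_pos hF] at ha
      refine Or.inr (Or.inr (Or.inl ⟨hF, ?_⟩))
      rcases ha with rfl | rfl | ⟨hT, rfl⟩
      · exact ⟨_, _, _, .left, perform_burn _ _ _ _ _ _ _⟩
      · exact ⟨_, _, _, .right, perform_burn _ _ _ _ _ _ _⟩
      · exact ⟨_, _, _, .start hT, perform_burn _ _ _ _ _ _ _⟩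
    · simp only [universal, if_neg hF] at ha
      obtain rfl := ha
      exact Or.inl rfl
  | check =>
    by_cases hF : uheads T F σ 1 = some true ∧ uheads T F σ 0 = some false
    · simp only [universal, if_pos hF] at ha
      obtain rfl := ha
      exact Or.inr (Or.inr (Or.inl ⟨hF.1, _, _, _, .begin hF.2, perform_burn _ _ _ _ _ _ _⟩))
    · simp only [universal, if_neg hF] at ha
      obtain rfl := ha
      exact Or.inl rfl
  | exec j =>
    by_cases hF : uheads T F σ 1 = some true
    · simp only [universal, if_pos hF] at ha
      cases hT : uheads T F σ 0 with
      | none =>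
        rw [hT] at ha
        obtain rfl := ha
        exact Or.inl rfl
      | some v =>
        cases v with
        | true =>
          rw [hT] at ha
          by_cases hj : (j : ℕ) + 1 < opCount + 1
          · simp only [dif_pos hj] at ha
            obtain rfl := ha
            exact Or.inr (Or.inr (Or.inl ⟨hF, _, _, _, .count j hj hT,
              perform_burn _ _ _ _ _ _ _⟩))
          · simp only [dif_neg hj] at ha
            obtain rfl := ha
            exact Or.inl rfl
        | false =>
          rw [hT] at ha
          obtain rfl := ha
          induction j using Fin.cases with
          | zero =>
            exact Or.inr (Or.inr (Or.inl ⟨hF, _, _, _, .finish hT, perform_burn _ _ _ _ _ _ _⟩))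
          | succ i =>
            obtain ⟨o, rfl⟩ := opCode.surjective i
            simp only [Fin.cases_succ, Equiv.symm_apply_apply]
            rcases perform_opAct A (.exec (opCode o).succ) T F σ o with
              ⟨rfl, h⟩ | ⟨b, rfl, h⟩ | ⟨ho, τ, hτ, h⟩ | ⟨_, h⟩
            · rw [h]; exact Or.inr (Or.inl ⟨rfl, rfl, hT⟩)
            · exact Or.inr (Or.inr (Or.inl ⟨hF, _, _, _, .ask b hT, h⟩))
            · exact Or.inr (Or.inr (Or.inl ⟨hF, _, _, _, .op o hT ho hτ, h⟩))
            · rw [h]; exact Or.inl rfl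
    · simp only [universal, if_neg hF] at ha
      obtain rfl := ha
      exact Or.inl rfl

/-! ### The universal machine is fast -/

/-- The empty memory. -/
def blankMem : Mem := ⟨fun _ => Tape.mk₁ [], []⟩

/-- The memory at the beginning of the execution of a program: tape `0` has one mark. -/
def startMem : Mem := ⟨Function.update (fun _ => Tape.mk₁ []) 0 ((Tape.mk₁ []).write (some true)), []⟩

theorem universal_init (w : List Bool) :
    universal.init w = ucfg .load (Tape.mk₁ (w.map some)) (Tape.mk₁ []) blankMem := by
  simp only [OracleTM.init, ucfg, blankMem, Config.mk.injEq, and_true]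
  refine ⟨rfl, tapeCases_ext ?_ ?_ fun i => ?_⟩
  · simp
  · simp
  · simp [Fin.succ_ne_zero]

/-- Each leading `true` becomes a unit of fuel. The first `false` ends loading, puts the mark on
work tape `0`, and takes the fuel head back to the last unit. -/
theorem universal_step_load_iff {A : Oracle} {T F : Tape (Option Bool)} {c : Config UState 4} :
    universal.Step A (ucfg .load T F blankMem) c ↔
      (T.head = some true ∧
        c = ucfg .load (T.move .right) ((F.write (some true)).move .right) blankMem) ∨
      (T.head = some false ∧ c = ucfg .idle (T.move .right) (F.move .left) startMem) ∨
      (T.head = none ∧ c = { ucfg .load T F blankMem with status := Sum.inr false }) := by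
  have key : universal.Step A (ucfg .load T F blankMem) c ↔
      ∃ a ∈ universal.δ .load (uheads T F blankMem),
        c = (ucfg .load T F blankMem).perform A a := by
    constructor
    · rintro ⟨q, hq, h⟩
      obtain rfl := Sum.inl.inj hq
      rwa [ucfg_heads] at h
    · intro h
      exact ⟨.load, rfl, by rwa [ucfg_heads]⟩
  rw [key]
  have h0 : uheads T F blankMem 0 = T.head := rfl
  cases hT : T.head with
  | none => simp [universal, h0, hT, Config.perform]
  | some v =>
    cases v with
    | true =>
      simp only [universal, h0, hT, Set.mem_singleton_iff, exists_eq_left]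
      rw [perform_act]
      have : (fun i => actOn (tapeCases (some true) (some true)
            (fun i => uheads T F blankMem i.succ.succ) i)
          (tapeCases (some Dir.right) (some Dir.right) (fun _ => none) i)
          ((ucfg .load T F blankMem).tapes i)) =
          tapeCases (T.move .right) ((F.write (some true)).move .right) blankMem.tapes :=
        tapeCases_ext (by rw [← hT]; exact actOn_head _ _) rfl fun i => actOn_head_none _
      rw [this]
      simp [ucfg]
    | false =>
      simp only [universal, h0, hT, Set.mem_singleton_iff, exists_eq_left]
      rw [perform_act]
      have : (fun i => actOn (tapeCases (some false) (uheads T F blankMem 1)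
            (Function.update (fun i => uheads T F blankMem i.succ.succ) 0 (some true)) i)
          (tapeCases (some Dir.right) (some Dir.left) (fun _ => none) i)
          ((ucfg .load T F blankMem).tapes i)) =
          tapeCases (T.move .right) (F.move .left) startMem.tapes := by
        refine tapeCases_ext (by rw [← hT]; exact actOn_head _ _) (actOn_head _ _) fun i => ?_
        simp only [tapeCases_work, startMem]
        by_cases hi : i = 0
        · subst hi; rfl
        · simp [hi, actOn, ucfg, blankMem, uheads]
      rw [this]
      simp [ucfg, startMem, blankMem]

theorem UStep.query_length_le {A : Oracle} {q q' : UState} {T T' : Tape (Option Bool)}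
    {σ σ' : Mem} (h : UStep A q T σ q' T' σ') : σ'.query.length ≤ σ.query.length + 1 := by
  cases h with
  | op o _ ho hrun =>
    cases o with
    | basic i t s d =>
      simp only [Op.run] at hrun
      split_ifs at hrun
      obtain rfl := Option.some.inj hrun
      simp
    | out b => obtain rfl := Option.some.inj hrun; simp
    | ask b => exact absurd rfl (ho b)
    | acc => cases hrun
  | _ => simp

theorem UStep.ne_load {A : Oracle} {q q' : UState} {T T' : Tape (Option Bool)}
    {σ σ' : Mem} (h : UStep A q T σ q' T' σ') : q' ≠ .load := by
  cases h <;> simp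

/-- A bound on the number of steps for which a state can be kept without using fuel. -/
def UState.rank : UState → ℕ
  | .ask _ => 2
  | _ => 1

theorem UState.one_le_rank (q : UState) : 1 ≤ q.rank := by cases q <;> simp [rank]

theorem UState.rank_le_two (q : UState) : q.rank ≤ 2 := by cases q <;> simp [rank]

/-- A unit of fuel pays for two steps: one that burns it, and possibly the query after it, which
`rank` accounts for. It also pays for at most one bit on the query tape, whence the bound on query
length plus remaining fuel. -/
theorem universal_inv {A : Oracle} {w : List Bool} {n : ℕ} {c : Config UState 4}
    (h : universal.Reaches A n (universal.init w) c) :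
    (n ≤ w.length ∧ ∃ T F, c = ucfg .load T F blankMem ∧ Holds T (listContent w) n ∧
      Holds F (listContent (List.replicate n true)) n) ∨
    (∃ (t f : ℕ) (q : UState) (T F : Tape (Option Bool)) (σ : Mem), q ≠ UState.load ∧ c = ucfg q T F σ ∧ t < w.length ∧
      Holds F (listContent (List.replicate t true)) ((f : ℤ) - 1) ∧ σ.query.length + f ≤ t ∧
      n + 2 * f + q.rank ≤ 3 * w.length + 2) ∨
    (∃ b, c.status = Sum.inr b ∧ n ≤ 3 * w.length + 3 ∧ (b = true → w ≠ [])) := by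
  induction n generalizing c with
  | zero =>
    rw [← OracleTM.reaches_zero h, universal_init]
    exact Or.inl ⟨Nat.zero_le _, _, _, rfl, holds_mk₁ w, holds_mk₁ []⟩
  | succ n ih =>
    obtain ⟨d, hd, hs⟩ := OracleTM.reaches_succ h
    rcases ih hd with ⟨hn, T, F, rfl, hT, hF⟩ | ⟨t, f, q, T, F, σ, hq, rfl, ht, hF, hlen, hn⟩ |
      ⟨b, hb, -⟩
    · rcases universal_step_load_iff.1 hs with ⟨h1, rfl⟩ | ⟨h1, rfl⟩ | ⟨h1, rfl⟩
      · have hlt : n < w.length := by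
          rw [hT.head] at h1
          by_contra hcon
          obtain rfl : n = w.length := by omega
          rw [listContent_length] at h1
          cases h1
        refine Or.inl ⟨hlt, _, _, rfl, ?_, ?_⟩
        · simpa [dirShift] using hT.move .right
        · have := (hF.write (some true)).move .right
          have h2 := update_listContent (List.replicate n true) true
          rw [List.length_replicate] at h2
          rw [h2] at this
          simpa [dirShift, List.replicate_succ'] using this
      · have hlt : n < w.length := by
          rw [hT.head] at h1
          by_contra hcon
          obtain rfl : n = w.length := by omega
          rw [listContent_length] at h1
          cases h1
        refine Or.inr (Or.inl ⟨n, n, _, _, _, _, by simp, rfl, hlt, ?_, ?_, ?_⟩)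
        · exact hF.move .left
        · simp [startMem]
        · simp only [UState.rank]; omega
      · exact Or.inr (Or.inr ⟨false, rfl, by omega, by simp⟩)
    · have hr := q.one_le_rank
      rcases universal_step_cases hq hs with h1 | ⟨h1, -, -⟩ | ⟨hF1, q', T', σ', hU, rfl⟩ |
        ⟨b, rfl, rfl⟩
      · exact Or.inr (Or.inr ⟨false, h1, by omega, by simp⟩)
      · refine Or.inr (Or.inr ⟨true, h1, by omega, fun _ => ?_⟩)
        rintro rfl; simp at ht
      · have hf : f ≠ 0 := by
          rintro rfl
          rw [hF.head, listContent_neg _ (by simp)] at hF1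
          cases hF1
        have h1 := hU.query_length_le
        have h2 := q'.rank_le_two
        obtain ⟨g, rfl⟩ := Nat.exists_eq_succ_of_ne_zero hf
        refine Or.inr (Or.inl ⟨t, g, q', T', _, σ', hU.ne_load, rfl, ht, ?_, by omega, ?_⟩)
        · simpa [dirShift, ← sub_eq_add_neg] using hF.move .left
        · omega
      · refine Or.inr (Or.inl ⟨t, f, _, _, _, _, ?_, rfl, ht, hF, ?_, ?_⟩)
        · split_ifs <;> simp
        · simp only [List.length_nil]; omega
        · have : (if A σ.query = b then UState.exec 0 else .reject).rank = 1 := by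
            split_ifs <;> rfl
          rw [this]
          simp only [UState.rank] at hn
          omega
    · exact absurd hs (OracleTM.not_step_of_halted hb)

theorem universal_runsInTime (A : Oracle) :
    universal.RunsInTime A fun n => (3 * Polynomial.X + 3 : Polynomial ℕ).eval n := by
  intro w n c h
  simp only [Polynomial.eval_add, Polynomial.eval_mul, Polynomial.eval_ofNat, Polynomial.eval_X]
  rcases universal_inv h with ⟨hn, -⟩ | ⟨t, f, q, T, F, σ, -, -, -, -, -, hn⟩ | ⟨-, -, hn, -⟩ <;>
    omega

/-- Queries are no longer than the fuel, and the fuel is shorter than the input, since the `false`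
that ends it takes one symbol. This strictness makes the fixed oracle well defined. -/
theorem universal_accepts_congr {A A' : Oracle} {w : List Bool}
    (hA : ∀ v : List Bool, v.length < w.length → A v = A' v) (h : universal.Accepts A w) :
    universal.Accepts A' w := by
  obtain ⟨n, c, hc, hst⟩ := h
  -- Agreement is required on the query tape of every running configuration. While loading this is
  -- the empty string, which is shorter than `w` only if `w` is nonempty.
  have hw : w ≠ [] := by
    rcases universal_inv hc with ⟨_, T, F, rfl, -⟩ | ⟨t, f, q, T, F, σ, -, rfl, -⟩ | ⟨b, hb, -, hw⟩
    · cases hst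
    · cases hst
    · rw [hb] at hst
      exact hw (Sum.inr.inj hst)
  have hpos := List.length_pos_iff.2 hw
  refine ⟨n, c, hc.congr fun m d q hd hq => hA _ ?_, hst⟩
  rcases universal_inv hd with ⟨_, T, F, rfl, -⟩ | ⟨t, f, q, T, F, σ, -, rfl, ht, -, hl, -⟩ |
    ⟨b, hb, -⟩
  · exact hpos
  · simp only [ucfg]; omega
  · rw [hb] at hq; cases hq

/-! ### An oracle that equals its own complete language -/

open Classical in
/-- The oracle to which the universal machine accepts precisely the strings in the oracle. -/
noncomputable def fixedOracleAux : ℕ → Oracle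
  | 0 => fun _ => false
  | n + 1 => fun w => decide (universal.Accepts (fixedOracleAux n) w)

/-- The value at `w` depends only on strictly shorter strings one stage earlier, so stage `m` is
final below length `m`. -/
theorem fixedOracleAux_eq {w : List Bool} {m n : ℕ} (hm : w.length < m) (hn : w.length < n) :
    fixedOracleAux m w = fixedOracleAux n w := by
  induction m generalizing w n with
  | zero => omega
  | succ m ih =>
    cases n with
    | zero => omega
    | succ n =>
      simp only [fixedOracleAux, decide_eq_decide]
      constructor <;> refine universal_accepts_congr fun v hv => ?_
      · exact ih (by omega) (by omega)
      · exact (ih (by omega) (by omega)).symm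

/-- An oracle with which the universal machine accepts precisely the strings in the oracle. -/
noncomputable def fixedOracle : Oracle := fun w => fixedOracleAux (w.length + 1) w

theorem fixedOracle_eq_true_iff (w : List Bool) :
    fixedOracle w = true ↔ universal.Accepts fixedOracle w := by
  simp only [fixedOracle, fixedOracleAux, decide_eq_true_iff]
  constructor <;> refine universal_accepts_congr fun v hv => ?_
  · exact fixedOracleAux_eq (by omega) (by omega)
  · exact fixedOracleAux_eq (by omega) (by omega)

/-- Copy the input to the query tape, and query. -/
def oracleMachine : OracleTM (Fin 3) 0 where
  start := 0
  δ q s :=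
    {if q = 0 then
      if s 0 = none then .query 1 2 else .act 0 s (fun _ => some .right) (s 0)
    else .halt (q == 1)}

theorem oracleMachine_inv {A : Oracle} {x : List Bool} {n : ℕ} {c : Config (Fin 3) 0}
    (h : oracleMachine.Reaches A n (oracleMachine.init x) c) :
    (n ≤ x.length ∧ c.status = Sum.inl 0 ∧ Holds (c.tapes 0) (listContent x) n ∧
      c.queryTape = x.take n) ∨
    (n = x.length + 1 ∧ c.status = Sum.inl (if A x then 1 else 2)) ∨
    (n = x.length + 2 ∧ c.status = Sum.inr (A x)) := by
  induction n generalizing c with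
  | zero =>
    rw [← OracleTM.reaches_zero h]
    exact Or.inl ⟨Nat.zero_le _, rfl, by simpa [OracleTM.init] using holds_mk₁ x, rfl⟩
  | succ n ih =>
    obtain ⟨d, hd, q, hq, a, ha, rfl⟩ := OracleTM.reaches_succ h
    rcases ih hd with ⟨hn, hst, hT, hl⟩ | ⟨rfl, hst⟩ | ⟨rfl, hst⟩
    · rw [hst] at hq
      obtain rfl := Sum.inl.inj hq
      simp only [oracleMachine, if_true] at ha
      rcases hn.lt_or_eq with hlt | rfl
      · have hv : (d.tapes 0).head = some x[n] := by
          rw [hT.head, listContent]; simp [hlt]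
        rw [if_neg (by rw [hv]; simp)] at ha
        obtain rfl := ha
        refine Or.inl ⟨hlt, rfl, ?_, ?_⟩
        · rw [perform_act]
          simpa [dirShift] using hT.actOn_self hT.head (some .right)
        · simp only [Config.perform, hl, hv, Option.toList_some]
          exact List.take_concat_get' x n hlt
      · have he : (d.tapes 0).head = none := by rw [hT.head, listContent_length]
        rw [if_pos he] at ha
        obtain rfl := ha
        refine Or.inr (Or.inl ⟨rfl, ?_⟩)
        simp [Config.perform, hl]
    · rw [hst] at hq
      obtain rfl := Sum.inl.inj hq
      refine Or.inr (Or.inr ⟨rfl, ?_⟩)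
      cases hA : A x <;> simp [hA, oracleMachine] at ha <;> subst ha <;> rfl
    · rw [hst] at hq; cases hq

theorem oracle_mem_P {A : Oracle} {L : Language Bool} (hL : ∀ x, x ∈ L ↔ A x = true) : L ∈ P A := by
  have hdet : oracleMachine.Deterministic := fun q s => ⟨_, rfl, fun _ h => h⟩
  have htime : oracleMachine.RunsInTime A fun n => (Polynomial.X + 2 : Polynomial ℕ).eval n := by
    intro x n c hc
    simp only [Polynomial.eval_add, Polynomial.eval_X, Polynomial.eval_ofNat]
    rcases oracleMachine_inv hc with h | h | h <;> omega
  refine ⟨Fin 3, inferInstance, 0, oracleMachine, hdet, ⟨_, htime⟩, fun x => (hL x).trans ?_⟩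
  obtain ⟨n, c, b, -, hc, hb⟩ := hdet.exists_halted (A := A) (htime x)
  have hAb : A x = b := by
    rcases oracleMachine_inv hc with h | h | h
    · rw [h.2.1] at hb; cases hb
    · rw [h.2] at hb; cases hb
    · exact Sum.inr.inj (h.2.symm.trans hb)
  constructor
  · intro h
    exact ⟨n, c, hc, by rw [hb, ← hAb, h]⟩
  · rintro ⟨n', c', hc', hb'⟩
    rw [hAb]
    exact hdet.halted_unique hc hb hc' hb'

theorem fixedOracle_language_mem_P : universal.language fixedOracle ∈ P fixedOracle :=
  oracle_mem_P fun x => (fixedOracle_eq_true_iff x).symm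

/-! ### Programs of the universal machine -/

/-- The code of an operation, or of the separator of blocks. -/
noncomputable def letterCode : Option Op → List Bool
  | none => [false]
  | some o => List.replicate (opCode o + 1) true ++ [false]

/-- The code of a string of operations and separators. -/
noncomputable def encodeLetters (l : List (Option Op)) : List Bool := l.flatMap letterCode

/-- The letters of a program, except for the first separator. -/
def blockLetters (D : List (List Op)) : List (Option Op) :=
  D.flatMap fun b => b.map some ++ [none]

/-- The text of a program. -/
noncomputable def programText (D : List (List Op)) : List Bool :=
  false :: encodeLetters (none :: blockLetters D)

theorem encodeLetters_cons (a : Option Op) (l : List (Option Op)) :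
    encodeLetters (a :: l) = letterCode a ++ encodeLetters l := rfl

theorem encodeLetters_append (l l' : List (Option Op)) :
    encodeLetters (l ++ l') = encodeLetters l ++ encodeLetters l' := by
  simp [encodeLetters]

theorem blockLetters_cons (b : List Op) (D : List (List Op)) :
    blockLetters (b :: D) = b.map some ++ none :: blockLetters D := by
  simp [blockLetters]

theorem blockLetters_append (D D' : List (List Op)) :
    blockLetters (D ++ D') = blockLetters D ++ blockLetters D' := by
  simp [blockLetters]

theorem replicate_append_false_inj {a b : ℕ} {x y : List Bool}
    (h : List.replicate a true ++ false :: x = List.replicate b true ++ false :: y) :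
    a = b ∧ x = y := by
  induction a generalizing b with
  | zero =>
    cases b with
    | zero => simpa using h
    | succ b => simp [List.replicate_succ] at h
  | succ a ih =>
    cases b with
    | zero => simp [List.replicate_succ] at h
    | succ b =>
      simp only [List.replicate_succ, List.cons_append, List.cons.injEq, true_and] at h
      obtain ⟨rfl, rfl⟩ := ih h
      exact ⟨rfl, rfl⟩

/-- The leading ones contain no `false`, so a chosen `false` is the one closing them or comes later.
Parsing peels off one code word at a time in this way. -/
theorem replicate_append_false_split {t : ℕ} {R S l : List Bool}
    (h : List.replicate t true ++ false :: R = l ++ false :: S) :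
    R = S ∨ ∃ l', l = List.replicate t true ++ false :: l' ∧ R = l' ++ false :: S := by
  induction t generalizing l with
  | zero =>
    cases l with
    | nil => left; simpa using h
    | cons a l =>
      simp only [List.replicate_zero, List.nil_append, List.cons_append, List.cons.injEq] at h
      obtain ⟨rfl, rfl⟩ := h
      exact Or.inr ⟨l, rfl, rfl⟩
  | succ t ih =>
    cases l with
    | nil => simp [List.replicate_succ] at h
    | cons a l =>
      simp only [List.replicate_succ, List.cons_append, List.cons.injEq] at h
      obtain ⟨rfl, h⟩ := h
      rcases ih h with h' | ⟨l', rfl, h'⟩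
      · exact Or.inl h'
      · exact Or.inr ⟨l', rfl, h'⟩

/-- The code of an operation begins with `true`, so a `false` right after another one must be a
separator. Two consecutive `false` are thus a safe landmark for a head that wanders freely over the
text. -/
theorem exists_split_of_two_false {t : ℕ} {ls : List (Option Op)} {l l' : List Bool}
    (h : List.replicate t true ++ false :: encodeLetters ls = l ++ false :: false :: l') :
    ∃ ls₁ ls₂, ls = ls₁ ++ none :: ls₂ ∧ l' = encodeLetters ls₂ := by
  induction ls generalizing t l with
  | nil =>
    rcases replicate_append_false_split h with h | ⟨l'', -, h⟩
    · simp [encodeLetters] at h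
    · simp [encodeLetters] at h
  | cons a ls ih =>
    rw [encodeLetters_cons] at h
    cases a with
    | none =>
      simp only [letterCode, List.singleton_append] at h
      rcases replicate_append_false_split h with h | ⟨l'', -, h⟩
      · exact ⟨[], ls, rfl, (List.cons.inj h).2.symm⟩
      · obtain ⟨ls₁, ls₂, rfl, hl⟩ := ih (t := 0) h
        exact ⟨none :: ls₁, ls₂, rfl, hl⟩
    | some o =>
      simp only [letterCode, List.append_assoc, List.singleton_append] at h
      rcases replicate_append_false_split h with h | ⟨l'', -, h⟩
      · simp [List.replicate_succ] at h
      · obtain ⟨ls₁, ls₂, rfl, hl⟩ := ih h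
        exact ⟨some o :: ls₁, ls₂, rfl, hl⟩

theorem map_some_append_none_split {b : List Op} {R S l : List (Option Op)}
    (h : b.map some ++ none :: R = l ++ none :: S) :
    R = S ∨ ∃ l', R = l' ++ none :: S := by
  induction b generalizing l with
  | nil =>
    cases l with
    | nil => left; simpa using h
    | cons a l =>
      simp only [List.map_nil, List.nil_append, List.cons_append, List.cons.injEq] at h
      exact Or.inr ⟨l, h.2⟩
  | cons o b ih =>
    cases l with
    | nil => simp at h
    | cons a l =>
      simp only [List.map_cons, List.cons_append, List.cons.injEq] at h
      exact ih h.2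

/-- What follows any separator is a tail of the list of blocks, so execution can start only at the
beginning of a block of `D`, or at the end of the text. -/
theorem exists_blocks_of_split {D : List (List Op)} {ls₁ ls₂ : List (Option Op)}
    (h : none :: blockLetters D = ls₁ ++ none :: ls₂) :
    ∃ D' : List (List Op), D' ⊆ D ∧ ls₂ = blockLetters D' := by
  induction D generalizing ls₁ with
  | nil =>
    rcases map_some_append_none_split (b := []) h with h | ⟨l, h⟩
    · exact ⟨[], by simp, h.symm⟩
    · simp [blockLetters] at h
  | cons b D ih =>
    rcases map_some_append_none_split (b := []) h with h | ⟨l, h⟩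
    · exact ⟨b :: D, by simp, h.symm⟩
    · rw [blockLetters_cons] at h
      rcases map_some_append_none_split h with h | ⟨l', h⟩
      · exact ⟨D, by simp, h.symm⟩
      · obtain ⟨D', hD', h'⟩ := ih (ls₁ := none :: l') (by rw [h]; rfl)
        exact ⟨D', List.subset_cons_of_subset _ hD', h'⟩

theorem exists_split_of_listContent {w : List Bool} {z : ℤ} (h : listContent w z = some false)
    (h' : listContent w (z + 1) = some false) :
    ∃ l l', w = l ++ false :: false :: l' ∧ z = l.length := by
  rcases lt_or_ge z 0 with hz | hz
  · rw [listContent_neg _ hz] at h; cases h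
  obtain ⟨n, rfl⟩ := Int.eq_ofNat_of_zero_le hz
  rw [listContent, if_pos hz, Int.toNat_natCast] at h
  rw [listContent, if_pos (by omega), show ((n : ℤ) + 1).toNat = n + 1 by omega] at h'
  obtain ⟨h1, h2⟩ := List.getElem?_eq_some_iff.1 h
  obtain ⟨h3, h4⟩ := List.getElem?_eq_some_iff.1 h'
  refine ⟨w.take n, w.drop (n + 1 + 1), ?_, by simp; omega⟩
  conv_lhs => rw [← List.take_append_drop n w]
  rw [List.drop_eq_getElem_cons h1, List.drop_eq_getElem_cons h3, h2, h4]

/-- The text to the right of the head, with the scanned symbol. -/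
def Reads (T : Tape (Option Bool)) (l : List Bool) : Prop := ∀ i : ℕ, T.nth i = l[i]?

theorem Reads.head {T : Tape (Option Bool)} {l : List Bool} (h : Reads T l) : T.head = l[0]? := by
  simpa using h 0

theorem Reads.tail {T : Tape (Option Bool)} {a : Bool} {l : List Bool} (h : Reads T (a :: l)) :
    Reads (T.move .right) l := by
  intro i
  have := h (i + 1)
  rw [Tape.move_right_nth]
  push_cast at this
  rw [this]
  simp

theorem Holds.reads {T : Tape (Option Bool)} {l l' : List Bool} {z : ℤ}
    (h : Holds T (listContent (l ++ l')) z) (hz : z = l.length) : Reads T l' := by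
  intro i
  rw [h i, hz, listContent, if_pos (by omega)]
  rw [show ((l.length : ℤ) + i).toNat = l.length + i by omega,
    List.getElem?_append_right (by omega), Nat.add_sub_cancel_left]

/-- `BlockReaches A D r σ σ'`: the memory `σ'` results from `σ` by executing `r` blocks of `D`. -/
inductive BlockReaches (A : Oracle) (D : List (List Op)) : ℕ → Mem → Mem → Prop where
  | refl (σ : Mem) : BlockReaches A D 0 σ σ
  | tail {r : ℕ} {σ σ₁ σ₂ : Mem} {b : List Op} : BlockReaches A D r σ σ₁ → b ∈ D →
      runOps A b σ₁ = some σ₂ → BlockReaches A D (r + 1) σ σ₂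

/-- The program accepts after `r` blocks. -/
def ProgramAccepts (A : Oracle) (D : List (List Op)) (r : ℕ) : Prop :=
  ∃ σ, BlockReaches A D r startMem σ ∧ ∃ pre suf σ₁, pre ++ Op.acc :: suf ∈ D ∧
    runOps A pre σ = some σ₁

/-! ### Soundness -/

/-- The memory `σ` occurs within the execution of a block, when `pre` has been executed and `suf` is
to be executed. -/
def InBlock (A : Oracle) (D : List (List Op)) (pre suf : List Op) (σ : Mem) : Prop :=
  ∃ r σ₁, BlockReaches A D r startMem σ₁ ∧ pre ++ suf ∈ D ∧ runOps A pre σ₁ = some σ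

/-- The property of configurations that proves the soundness of the universal machine. -/
def USound (A : Oracle) (D : List (List Op)) (w : List Bool) (z : ℤ) (T : Tape (Option Bool))
    (σ : Mem) : UState → Prop
  | .load => False
  | .idle => ∃ r, BlockReaches A D r startMem σ
  | .check => (∃ r, BlockReaches A D r startMem σ) ∧ listContent w (z - 1) = some false
  | .exec j => T.head = none ∨ ∃ pre suf rest l, InBlock A D pre suf σ ∧ Reads T l ∧
      List.replicate j true ++ l = encodeLetters (suf.map some ++ none :: rest)
  | .ask b => ∃ pre suf rest, InBlock A D pre (.ask b :: suf) σ ∧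
      Reads T (encodeLetters (suf.map some ++ none :: rest))
  | .reject => True

theorem Reads.exists_cons {T : Tape (Option Bool)} {l : List Bool} {b : Bool}
    (h : Reads T l) (hT : T.head = some b) :
    ∃ l', l = b :: l' ∧ Reads (T.move .right) l' := by
  cases l with
  | nil => rw [h.head] at hT; simp at hT
  | cons a l =>
    rw [h.head] at hT
    simp only [List.length_cons, Nat.zero_lt_succ, getElem?_pos, List.getElem_cons_zero,
      Option.some.injEq] at hT
    subst hT
    exact ⟨l, rfl, h.tail⟩

theorem exec_zero_cases {suf : List Op} {rest : List (Option Op)} {l : List Bool}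
    (h : false :: l = encodeLetters (suf.map some ++ none :: rest)) : suf = [] := by
  cases suf with
  | nil => rfl
  | cons o suf =>
    simp [encodeLetters_cons, letterCode, List.replicate_succ] at h

/-- Unary codes closed by `false` are a prefix code: the number of ones counted determines the
operation. -/
theorem exec_succ_cases {suf : List Op} {rest : List (Option Op)} {l : List Bool} {o : Op}
    (h : List.replicate ((opCode o).succ : Fin (opCount + 1)) true ++ false :: l =
      encodeLetters (suf.map some ++ none :: rest)) :
    ∃ suf', suf = o :: suf' ∧ l = encodeLetters (suf'.map some ++ none :: rest) := by
  cases suf with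
  | nil =>
    simp [encodeLetters_cons, letterCode, List.replicate_succ] at h
  | cons o' suf =>
    simp only [List.map_cons, List.cons_append, encodeLetters_cons, letterCode,
      List.append_assoc, List.nil_append] at h
    obtain ⟨h1, h2⟩ := replicate_append_false_inj h
    simp only [Fin.val_succ, add_left_inj] at h1
    obtain rfl := opCode.injective (Fin.ext h1)
    exact ⟨suf, rfl, h2⟩

theorem USound.of_UStep {A : Oracle} {D : List (List Op)} {t : ℕ} {z : ℤ}
    {T T' : Tape (Option Bool)} {σ σ' : Mem} {q q' : UState}
    (hT : Holds T (listContent (List.replicate t true ++ programText D)) z)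
    (h : USound A D (List.replicate t true ++ programText D) z T σ q)
    (hstep : UStep A q T σ q' T' σ') :
    ∃ z', Holds T' (listContent (List.replicate t true ++ programText D)) z' ∧
      USound A D (List.replicate t true ++ programText D) z' T' σ' q' := by
  have hR : Holds (T.move .right) (listContent (List.replicate t true ++ programText D)) (z + 1) :=
    hT.move .right
  cases hstep with
  | left => exact ⟨_, hT.move .left, h⟩
  | right => exact ⟨_, hR, h⟩
  | start hd =>
    refine ⟨_, hR, h, ?_⟩
    rw [add_sub_cancel_right, ← hT.head, hd]
  | begin hd =>
    refine ⟨_, hR, ?_⟩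
    obtain ⟨⟨r, hr⟩, hz⟩ := h
    obtain ⟨l, l', hw, hzl⟩ := exists_split_of_listContent hz
      (by rw [sub_add_cancel, ← hT.head, hd])
    obtain ⟨ls₁, ls₂, hls, rfl⟩ := exists_split_of_two_false hw
    obtain ⟨D', hD', rfl⟩ := exists_blocks_of_split hls
    have hreads : Reads (T.move .right) (encodeLetters (blockLetters D')) := by
      have h1 : List.replicate t true ++ programText D =
          (l ++ [false, false]) ++ encodeLetters (blockLetters D') := by rw [hw]; simp
      rw [h1] at hR
      refine hR.reads ?_
      simp only [List.length_append, List.length_cons, List.length_nil]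
      omega
    cases D' with
    -- The separator found is the last one. The head is on the blank after the text, where the
    -- machine can only reject.
    | nil => left; rw [hreads.head]; rfl
    | cons b D' =>
      refine Or.inr ⟨[], b, blockLetters D', _, ⟨r, σ, hr, ?_, rfl⟩, hreads, ?_⟩
      · exact hD' List.mem_cons_self
      · rw [blockLetters_cons]; rfl
  | count j hj hd =>
    refine ⟨_, hR, ?_⟩
    rcases h with h | ⟨pre, suf, rest, l, hin, hreads, hl⟩
    · rw [h] at hd; cases hd
    · obtain ⟨l', rfl, hreads'⟩ := Reads.exists_cons hreads hd
      refine Or.inr ⟨pre, suf, rest, l', hin, hreads', ?_⟩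
      rw [← hl, List.replicate_succ']
      simp
  | finish hd =>
    refine ⟨_, hR, ?_⟩
    rcases h with h | ⟨pre, suf, rest, l, hin, hreads, hl⟩
    · rw [h] at hd; cases hd
    · obtain ⟨l', rfl, hreads'⟩ := Reads.exists_cons hreads hd
      obtain rfl := exec_zero_cases hl
      obtain ⟨r, σ₁, hr, hmem, hrun⟩ := hin
      rw [List.append_nil] at hmem
      exact ⟨r + 1, hr.tail hmem hrun⟩
  | op o hd ho hrun =>
    refine ⟨_, hR, ?_⟩
    rcases h with h | ⟨pre, suf, rest, l, hin, hreads, hl⟩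
    · rw [h] at hd; cases hd
    · obtain ⟨l', rfl, hreads'⟩ := Reads.exists_cons hreads hd
      obtain ⟨suf', rfl, rfl⟩ := exec_succ_cases hl
      obtain ⟨r, σ₁, hr, hmem, hpre⟩ := hin
      refine Or.inr ⟨pre ++ [o], suf', rest, _, ⟨r, σ₁, hr, by simpa using hmem, ?_⟩, hreads', rfl⟩
      rw [runOps_append, hpre]
      simp [runOps, hrun]
  | ask b hd =>
    refine ⟨_, hR, ?_⟩
    rcases h with h | ⟨pre, suf, rest, l, hin, hreads, hl⟩
    · rw [h] at hd; cases hd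
    · obtain ⟨l', rfl, hreads'⟩ := Reads.exists_cons hreads hd
      obtain ⟨suf', rfl, rfl⟩ := exec_succ_cases hl
      exact ⟨pre, suf', rest, hin, hreads'⟩

theorem universal_sound_inv {A : Oracle} {D : List (List Op)} {t n : ℕ} {c : Config UState 4}
    (h : universal.Reaches A n (universal.init (List.replicate t true ++ programText D)) c) :
    (∃ z T F, c = ucfg .load T F blankMem ∧
      Holds T (listContent (List.replicate t true ++ programText D)) z) ∨
    (∃ z q T F σ, c = ucfg q T F σ ∧
      Holds T (listContent (List.replicate t true ++ programText D)) z ∧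
      USound A D (List.replicate t true ++ programText D) z T σ q) ∨
    c.status = Sum.inr false ∨ (c.status = Sum.inr true ∧ ∃ r, ProgramAccepts A D r) := by
  induction n generalizing c with
  | zero =>
    rw [← OracleTM.reaches_zero h, universal_init]
    exact Or.inl ⟨0, _, _, rfl, holds_mk₁ _⟩
  | succ n ih =>
    obtain ⟨d, hd, hs⟩ := OracleTM.reaches_succ h
    rcases ih hd with ⟨z, T, F, rfl, hT⟩ | ⟨z, q, T, F, σ, rfl, hT, hq⟩ | hb | ⟨hb, -⟩
    · rcases universal_step_load_iff.1 hs with ⟨h1, rfl⟩ | ⟨h1, rfl⟩ | ⟨h1, rfl⟩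
      · exact Or.inl ⟨_, _, _, rfl, hT.move .right⟩
      · exact Or.inr (Or.inl ⟨_, _, _, _, _, rfl, hT.move .right, 0, .refl _⟩)
      · exact Or.inr (Or.inr (Or.inl rfl))
    · have hne : q ≠ .load := by rintro rfl; exact hq
      rcases universal_step_cases hne hs with h1 | ⟨h1, rfl, hd'⟩ | ⟨-, q', T', σ', hU, rfl⟩ |
        ⟨b, rfl, rfl⟩
      · exact Or.inr (Or.inr (Or.inl h1))
      · refine Or.inr (Or.inr (Or.inr ⟨h1, ?_⟩))
        rcases hq with h | ⟨pre, suf, rest, l, hin, hreads, hl⟩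
        · rw [h] at hd'; cases hd'
        · obtain ⟨l', rfl, hreads'⟩ := Reads.exists_cons hreads hd'
          obtain ⟨suf', rfl, rfl⟩ := exec_succ_cases hl
          obtain ⟨r, σ₁, hr, hmem, hpre⟩ := hin
          exact ⟨r, σ₁, hr, pre, suf', _, hmem, hpre⟩
      · obtain ⟨z', h1, h2⟩ := hq.of_UStep hT hU
        exact Or.inr (Or.inl ⟨z', _, _, _, _, rfl, h1, h2⟩)
      · refine Or.inr (Or.inl ⟨z, _, _, _, _, rfl, hT, ?_⟩)
        split_ifs with hA
        · obtain ⟨pre, suf, rest, ⟨r, σ₁, hr, hmem, hpre⟩, hreads⟩ := hq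
          refine Or.inr ⟨pre ++ [.ask b], suf, rest, _, ⟨r, σ₁, hr, by simpa using hmem, ?_⟩,
            hreads, rfl⟩
          rw [runOps_append, hpre]
          simp [runOps, Op.run, hA]
        · trivial
    · exact absurd hs (OracleTM.not_step_of_halted hb)
    · exact absurd hs (OracleTM.not_step_of_halted hb)

theorem universal_sound {A : Oracle} {D : List (List Op)} {t : ℕ}
    (h : universal.Accepts A (List.replicate t true ++ programText D)) :
    ∃ r, ProgramAccepts A D r := by
  obtain ⟨n, c, hc, hst⟩ := h
  rcases universal_sound_inv hc with ⟨z, T, F, rfl, -⟩ | ⟨z, q, T, F, σ, rfl, -⟩ | hb | ⟨-, h⟩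
  · cases hst
  · cases hst
  · rw [hb] at hst; cases hst
  · exact h

/-! ### Completeness -/

theorem iterate_move_left_nth (T : Tape (Option Bool)) (n : ℕ) (i : ℤ) :
    ((Tape.move .left)^[n] T).nth i = T.nth (i - n) := by
  induction n generalizing i with
  | zero => simp
  | succ n ih =>
    rw [Function.iterate_succ_apply', Tape.move_left_nth, ih]
    congr 1
    push_cast
    ring

theorem iterate_move_right_nth (T : Tape (Option Bool)) (n : ℕ) (i : ℤ) :
    ((Tape.move .right)^[n] T).nth i = T.nth (i + n) := by
  induction n generalizing i with
  | zero => simp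
  | succ n ih =>
    rw [Function.iterate_succ_apply', Tape.move_right_nth, ih]
    congr 1
    push_cast
    ring

/-- With `f` units of fuel, the universal machine can go from one configuration to another. -/
def Burns (A : Oracle) (f : ℕ) (q : UState) (T : Tape (Option Bool)) (σ : Mem) (q' : UState)
    (T' : Tape (Option Bool)) (σ' : Mem) : Prop :=
  ∀ F : Tape (Option Bool), (∀ i : ℕ, i < f → F.nth (-i) = some true) →
    ∃ n, universal.Reaches A n (ucfg q T F σ) (ucfg q' T' ((Tape.move .left)^[f] F) σ')

section Burns

variable {A : Oracle} {f g : ℕ} {q q' q'' : UState} {T T' T'' : Tape (Option Bool)}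
  {σ σ' σ'' : Mem}

theorem Burns.refl : Burns A 0 q T σ q T σ := fun _ _ => ⟨0, .refl _⟩

theorem Burns.trans (h : Burns A f q T σ q' T' σ') (h' : Burns A g q' T' σ' q'' T'' σ'') :
    Burns A (f + g) q T σ q'' T'' σ'' := by
  intro F hF
  obtain ⟨n, hn⟩ := h F fun i hi => hF i (by omega)
  obtain ⟨m, hm⟩ := h' ((Tape.move .left)^[f] F) fun i hi => by
    rw [iterate_move_left_nth, show -(i : ℤ) - f = -((i + f : ℕ) : ℤ) by push_cast; ring]
    exact hF _ (by omega)
  rw [← Function.iterate_add_apply, add_comm g f] at hm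
  exact ⟨n + m, hn.trans hm⟩

theorem Burns.of_UStep (h : UStep A q T σ q' T' σ') : Burns A 1 q T σ q' T' σ' := by
  intro F hF
  refine ⟨1, .one (universal_step_of_UStep h ?_)⟩
  simpa using hF 0 (by omega)

theorem Burns.ask {b : Bool} (hb : A σ.query = b) :
    Burns A 0 (.ask b) T σ (.exec 0) T { σ with query := [] } := by
  intro F hF
  have := universal_step_ask (A := A) (T := T) (F := F) (σ := σ) b
  rw [if_pos hb] at this
  exact ⟨1, .one this⟩

theorem Burns.idle_right (n : ℕ) :
    Burns A n .idle T σ .idle ((Tape.move .right)^[n] T) σ := by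
  induction n with
  | zero => exact .refl
  | succ n ih =>
    rw [Function.iterate_succ_apply']
    exact ih.trans (.of_UStep .right)

theorem Burns.idle_left (n : ℕ) :
    Burns A n .idle ((Tape.move .right)^[n] T) σ .idle T σ := by
  induction n with
  | zero => exact .refl
  | succ n ih =>
    rw [Function.iterate_succ_apply', add_comm]
    refine Burns.trans (.of_UStep .left) ?_
    rw [Tape.move_right_left]
    exact ih

theorem Reads.iterate {l l' : List Bool} (h : Reads T (l ++ l')) :
    Reads ((Tape.move .right)^[l.length] T) l' := by
  intro i
  have := h (i + l.length)
  rw [iterate_move_right_nth]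
  push_cast at this
  rw [this, List.getElem?_append_right (by omega), Nat.add_sub_cancel]

theorem Burns.count {l : List Bool} (c : ℕ) {j : ℕ} (hj : j + c < opCount + 1)
    (h : Reads T (List.replicate c true ++ l)) :
    Burns A c (.exec ⟨j, by omega⟩) T σ (.exec ⟨j + c, hj⟩) ((Tape.move .right)^[c] T) σ := by
  induction c generalizing l with
  | zero => exact .refl
  | succ c ih =>
    rw [Function.iterate_succ_apply']
    have h' : Reads T (List.replicate c true ++ (true :: l)) := by
      rw [List.replicate_succ'] at h; simpa using h
    refine (ih (by omega) h').trans (.of_UStep (.count ⟨j + c, by omega⟩ _ ?_))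
    have := h'.iterate.head
    rw [List.length_replicate] at this
    rw [this]
    rfl

theorem Burns.count_op {l : List Bool} {o : Op} (h : Reads T (letterCode (some o) ++ l)) :
    Burns A (opCode o + 1) (.exec 0) T σ (.exec (opCode o).succ)
      ((Tape.move .right)^[opCode o + 1] T) σ ∧
    ((Tape.move .right)^[opCode o + 1] T).head = some false := by
  simp only [letterCode, List.append_assoc] at h
  constructor
  · have := Burns.count (A := A) (σ := σ) (j := 0) (opCode o + 1) (by omega) h
    have hsucc : (opCode o).succ = ⟨0 + ((opCode o : ℕ) + 1), by omega⟩ := Fin.ext (by simp)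
    rw [hsucc]
    exact this
  · have := h.iterate.head
    rw [List.length_replicate] at this
    rw [this]
    rfl

theorem letterCode_length (o : Op) : (letterCode (some o)).length = opCode o + 1 + 1 := by
  simp [letterCode]

/-- One unit of fuel per symbol of the code; the query step of `ask` is free. -/
theorem Burns.op {l : List Bool} {o : Op} (h : Reads T (letterCode (some o) ++ l))
    (hrun : o.run A σ = some σ') :
    Burns A (letterCode (some o)).length (.exec 0) T σ (.exec 0)
      ((Tape.move .right)^[(letterCode (some o)).length] T) σ' := by
  obtain ⟨h1, h2⟩ := Burns.count_op (A := A) (σ := σ) h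
  rw [letterCode_length, Function.iterate_succ_apply']
  refine h1.trans ?_
  by_cases ho : ∃ b, o = .ask b
  · obtain ⟨b, rfl⟩ := ho
    simp only [Op.run] at hrun
    split_ifs at hrun with hA
    obtain rfl := Option.some.inj hrun
    exact (Burns.of_UStep (.ask b h2)).trans (.ask hA)
  · exact .of_UStep (.op o h2 (not_exists.1 ho) hrun)

theorem Burns.ops {l : List Bool} {b : List Op} (h : Reads T (encodeLetters (b.map some) ++ l))
    (hrun : runOps A b σ = some σ') :
    Burns A (encodeLetters (b.map some)).length (.exec 0) T σ (.exec 0)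
      ((Tape.move .right)^[(encodeLetters (b.map some)).length] T) σ' := by
  induction b generalizing T σ with
  | nil => obtain rfl := Option.some.inj hrun; exact .refl
  | cons o b ih =>
    simp only [runOps] at hrun
    obtain ⟨τ, hτ, hrun⟩ := Option.bind_eq_some_iff.1 hrun
    rw [List.map_cons, encodeLetters_cons, List.append_assoc] at h
    rw [List.map_cons, encodeLetters_cons, List.length_append]
    rw [add_comm, Function.iterate_add_apply, add_comm]
    exact (Burns.op h hτ).trans (ih h.iterate hrun)

theorem Burns.enter {l : List Bool} (h : Reads T (false :: false :: l)) :
    Burns A 2 .idle T σ (.exec 0) ((Tape.move .right)^[2] T) σ ∧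
      Reads ((Tape.move .right)^[2] T) l := by
  refine ⟨Burns.trans (f := 1) (g := 1) (.of_UStep (.start ?_)) (.of_UStep (.begin ?_)),
    h.tail.tail⟩
  · rw [h.head]; rfl
  · rw [h.tail.head]; rfl

theorem Burns.block {l : List Bool} {b : List Op}
    (h : Reads T (false :: false :: (encodeLetters (b.map some) ++ false :: l)))
    (hrun : runOps A b σ = some σ') :
    Burns A ((encodeLetters (b.map some)).length + 3) .idle T σ .idle
      ((Tape.move .right)^[(encodeLetters (b.map some)).length + 3] T) σ' := by
  obtain ⟨h1, h2⟩ := Burns.enter (A := A) (σ := σ) h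
  have h3 := Burns.ops h2 hrun
  have h4 := h2.iterate.head
  rw [show (encodeLetters (b.map some)).length + 3 =
    (encodeLetters (b.map some)).length + 1 + 2 by omega, Function.iterate_add_apply,
    Function.iterate_succ_apply', add_comm, ]
  exact h1.trans (h3.trans (.of_UStep (.finish (by rw [h4]; rfl))))

end Burns

theorem encodeLetters_map_some_eq (b : List Op) :
    encodeLetters (b.map some) = [] ∨ ∃ l, encodeLetters (b.map some) = l ++ [false] := by
  induction b using List.reverseRecOn with
  | nil => exact Or.inl rfl
  | append_singleton b o _ =>
    refine Or.inr ⟨encodeLetters (b.map some) ++ List.replicate (opCode o + 1) true, ?_⟩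
    rw [List.map_append, encodeLetters_append]
    simp [encodeLetters, letterCode]

/-- The landmark before the next block. The last separator follows the `false` closing an operation,
or, after an empty block, the previous separator; for the first block the extra `false` in front of
the text serves. -/
theorem programText_ends (D : List (List Op)) :
    ∃ l, programText D = l ++ [false, false] := by
  induction D using List.reverseRecOn with
  | nil => exact ⟨[], rfl⟩
  | append_singleton D b ih =>
    obtain ⟨l, hl⟩ := ih
    have h1 : programText (D ++ [b]) = programText D ++ encodeLetters (b.map some) ++ [false] := by
      simp [programText, blockLetters, encodeLetters, letterCode]
    rw [h1, hl]
    rcases encodeLetters_map_some_eq b with h | ⟨l', h⟩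
    · exact ⟨l ++ [false], by rw [h]; simp⟩
    · exact ⟨l ++ [false, false] ++ l', by rw [h]; simp⟩

theorem programText_split {D : List (List Op)} {b : List Op} (hb : b ∈ D) :
    ∃ l l', programText D =
      l ++ false :: false :: (encodeLetters (b.map some) ++ false :: l') := by
  obtain ⟨D₁, D₂, rfl⟩ := List.append_of_mem hb
  obtain ⟨l, hl⟩ := programText_ends D₁
  refine ⟨l, encodeLetters (blockLetters D₂), ?_⟩
  have h1 : programText (D₁ ++ b :: D₂) =
      programText D₁ ++ (encodeLetters (b.map some) ++ false :: encodeLetters (blockLetters D₂)) := by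
    simp [programText, blockLetters, encodeLetters, letterCode]
  rw [h1, hl]
  simp

/-- The tape with the string `w` and the head on its `n`-th symbol. -/
noncomputable def tapeAt (w : List Bool) (n : ℕ) : Tape (Option Bool) :=
  (Tape.move .right)^[n] (Tape.mk₁ (w.map some))

theorem iterate_tapeAt (w : List Bool) (m n : ℕ) :
    (Tape.move .right)^[m] (tapeAt w n) = tapeAt w (m + n) := by
  rw [tapeAt, tapeAt, Function.iterate_add_apply]

theorem reads_tapeAt (l l' : List Bool) : Reads (tapeAt (l ++ l') l.length) l' := by
  refine Reads.iterate (T := Tape.mk₁ ((l ++ l').map some)) ?_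
  exact (holds_mk₁ (l ++ l')).reads (l := []) rfl

theorem Burns.travel (A : Oracle) (w : List Bool) (m n : ℕ) (σ : Mem) :
    Burns A (max m n - min m n) .idle (tapeAt w m) σ .idle (tapeAt w n) σ := by
  rcases le_total m n with h | h
  · obtain ⟨k, rfl⟩ := Nat.exists_eq_add_of_le h
    rw [max_eq_right h, min_eq_left h, Nat.add_sub_cancel_left, add_comm, ← iterate_tapeAt]
    exact .idle_right k
  · obtain ⟨k, rfl⟩ := Nat.exists_eq_add_of_le h
    rw [max_eq_left h, min_eq_right h, Nat.add_sub_cancel_left, add_comm, ← iterate_tapeAt]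
    exact .idle_left k

/-- Between blocks the head stays within the program text, so the walk to a block costs at most the
length of the text, and executing it costs at most as much again. -/
theorem exists_burns_of_blockReaches {A : Oracle} {D : List (List Op)} {t r : ℕ} {σ : Mem}
    (h : BlockReaches A D r startMem σ) :
    ∃ f n, f ≤ r * (2 * (programText D).length) ∧ t ≤ n ∧ n ≤ t + (programText D).length ∧
      Burns A f .idle (tapeAt (List.replicate t true ++ programText D) (t + 1)) startMem
        .idle (tapeAt (List.replicate t true ++ programText D) n) σ := by
  generalize hσ : startMem = σ₀ at h
  induction h with
  | refl =>
    refine ⟨0, t + 1, by simp, by omega, ?_, .refl⟩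
    simp [programText]
  | @tail r σ₁ σ σ' b h hb hrun ih =>
    obtain ⟨f, n, hf, htn, hnt, hB⟩ := ih hσ
    obtain ⟨l, l', hl⟩ := programText_split hb
    set L := (programText D).length with hL
    have hlen : L = l.length + 2 + (encodeLetters (b.map some)).length + 1 + l'.length := by
      rw [hL, hl]; simp; omega
    have hr : Reads (tapeAt (List.replicate t true ++ programText D) (t + l.length))
        (false :: false :: (encodeLetters (b.map some) ++ false :: l')) := by
      have := reads_tapeAt (List.replicate t true ++ l)
        (false :: false :: (encodeLetters (b.map some) ++ false :: l'))
      rw [List.append_assoc, ← hl, List.length_append, List.length_replicate] at this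
      exact this
    have h1 := Burns.block hr hrun
    rw [iterate_tapeAt] at h1
    refine ⟨_, _, ?_, ?_, ?_, hB.trans ((Burns.travel A _ n (t + l.length) _).trans h1)⟩
    · rw [add_mul]
      refine add_le_add hf ?_
      have : max n (t + l.length) - min n (t + l.length) ≤ L := by omega
      omega
    · omega
    · omega

theorem universal_load {A : Oracle} {t : ℕ} {w : List Bool} :
    ∀ j ≤ t, ∃ F, universal.Reaches A j (universal.init (List.replicate t true ++ w))
      (ucfg .load (tapeAt (List.replicate t true ++ w) j) F blankMem) ∧
      Holds F (listContent (List.replicate j true)) j := by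
  intro j
  induction j with
  | zero =>
    intro _
    exact ⟨_, by rw [universal_init]; exact .refl _, holds_mk₁ []⟩
  | succ j ih =>
    intro hj
    obtain ⟨F, hF, hFc⟩ := ih (by omega)
    have hd : (tapeAt (List.replicate t true ++ w) j).head = some true := by
      have h1 := reads_tapeAt (List.replicate j true) (List.replicate (t - j) true ++ w)
      rw [← List.append_assoc, List.replicate_append_replicate, Nat.add_sub_cancel' (by omega),
        List.length_replicate] at h1
      rw [h1.head, List.getElem?_append_left (by simp; omega), List.getElem?_replicate,
        if_pos (by omega)]
    refine ⟨(F.write (some true)).move .right,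
      hF.tail (universal_step_load_iff.2 (Or.inl ⟨hd, ?_⟩)), ?_⟩
    · rw [tapeAt, tapeAt, Function.iterate_succ_apply']
    · have := (hFc.write (some true)).move .right
      have h2 := update_listContent (List.replicate j true) true
      rw [List.length_replicate] at h2
      rw [h2] at this
      simpa [dirShift, List.replicate_succ'] using this

theorem universal_complete {A : Oracle} {D : List (List Op)} {t r : ℕ}
    (h : ProgramAccepts A D r) (ht : (r + 1) * (2 * (programText D).length) ≤ t) :
    universal.Accepts A (List.replicate t true ++ programText D) := by
  obtain ⟨σ, hσ, pre, suf, σ', hmem, hrun⟩ := h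
  obtain ⟨f, n, hf, htn, hnt, hB⟩ := exists_burns_of_blockReaches (t := t) hσ
  obtain ⟨l, l', hl⟩ := programText_split hmem
  set L := (programText D).length with hL
  rw [List.map_append, List.map_cons, encodeLetters_append, encodeLetters_cons,
    List.append_assoc, List.append_assoc] at hl
  have hlen : l.length + 2 + (encodeLetters (pre.map some)).length + (opCode .acc + 1 + 1) ≤ L := by
    rw [hL, hl]; simp [letterCode_length]; omega
  have hr : Reads (tapeAt (List.replicate t true ++ programText D) (t + l.length))
      (false :: false :: (encodeLetters (pre.map some) ++ (letterCode (some .acc) ++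
        (encodeLetters (suf.map some) ++ false :: l')))) := by
    have := reads_tapeAt (List.replicate t true ++ l)
      (false :: false :: (encodeLetters (pre.map some) ++ (letterCode (some .acc) ++
        (encodeLetters (suf.map some) ++ false :: l'))))
    rw [List.append_assoc, ← hl, List.length_append, List.length_replicate] at this
    exact this
  obtain ⟨h1, h2⟩ := Burns.enter (A := A) (σ := σ) hr
  have h3 := Burns.ops h2 hrun
  obtain ⟨h4, h5⟩ := Burns.count_op (A := A) (σ := σ') h2.iterate
  have hB' := hB.trans ((Burns.travel A _ n (t + l.length) _).trans (h1.trans (h3.trans h4)))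
  set g := f + (max n (t + l.length) - min n (t + l.length) +
    (2 + ((encodeLetters (pre.map some)).length + (opCode .acc + 1)))) with hg
  -- The last portion `2 * L` of the budget covers the accepting block. The inequality is strict
  -- because the accepting step needs to scan an unburnt unit.
  have hgt : g < t := by
    have : max n (t + l.length) - min n (t + l.length) ≤ L := by omega
    rw [add_mul] at ht
    omega
  obtain ⟨F, hF, hFc⟩ := universal_load (A := A) (w := programText D) t le_rfl
  have hfuel : ∀ i : ℕ, i < t → (F.move .left).nth (-i) = some true := by
    intro i hi
    rw [Tape.move_left_nth, hFc, listContent, if_pos (by omega), List.getElem?_replicate,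
      if_pos (by omega)]
  have hd : (tapeAt (List.replicate t true ++ programText D) t).head = some false := by
    have h1 := reads_tapeAt (List.replicate t true) (programText D)
    rw [List.length_replicate] at h1
    rw [h1.head]
    rfl
  have hs : universal.Reaches A (t + 1) (universal.init (List.replicate t true ++ programText D))
      (ucfg .idle (tapeAt (List.replicate t true ++ programText D) (t + 1)) (F.move .left)
        startMem) := by
    refine hF.tail (universal_step_load_iff.2 (Or.inr (Or.inl ⟨hd, ?_⟩)))
    rw [tapeAt, tapeAt, Function.iterate_succ_apply']
  obtain ⟨m, hm⟩ := hB' (F.move .left) fun i hi => hfuel i (by omega)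
  refine ⟨_, _, (hs.trans hm).tail (universal_step_acc h5 ?_), rfl⟩
  rw [← Tape.nth_zero, iterate_move_left_nth, zero_sub]
  exact hfuel g hgt

/-! ### Memory with a program counter -/

/-- The tape with one mark, and the head `j` cells to the right of the mark. -/
def counterTape (j : ℕ) : Tape (Option Bool) :=
  (Tape.move .right)^[j] ((Tape.mk₁ []).write (some true))

/-- The memory with program counter `j`, work tape `W`, and mark tape `X`. -/
def memAt (j : ℕ) (W X : Tape (Option Bool)) (q : List Bool) : Mem := ⟨![counterTape j, W, X], q⟩

theorem memAt_zero : memAt 0 (Tape.mk₁ []) (Tape.mk₁ []) [] = startMem := by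
  simp only [memAt, startMem, Mem.mk.injEq, and_true]
  funext i
  fin_cases i <;> rfl

section Run

variable {A : Oracle} {C W X : Tape (Option Bool)} {q : List Bool}

theorem run_counter {t s : Option (Option Bool)} {d : Option Dir} :
    (Op.basic 0 t s d).run A ⟨![C, W, X], q⟩ =
      if ∀ v ∈ t, C.head = v then some ⟨![actOn (s.getD C.head) d C, W, X], q⟩ else none := by
  simp only [Op.run, Matrix.cons_val_zero]
  congr 3
  funext i
  fin_cases i <;> rfl

theorem run_work {t s : Option (Option Bool)} {d : Option Dir} :
    (Op.basic 1 t s d).run A ⟨![C, W, X], q⟩ =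
      if ∀ v ∈ t, W.head = v then some ⟨![C, actOn (s.getD W.head) d W, X], q⟩ else none := by
  simp only [Op.run, Matrix.cons_val_one, Matrix.cons_val_zero]
  congr 3
  funext i
  fin_cases i <;> rfl

theorem run_mark {t s : Option (Option Bool)} {d : Option Dir} :
    (Op.basic 2 t s d).run A ⟨![C, W, X], q⟩ =
      if ∀ v ∈ t, X.head = v then some ⟨![C, W, actOn (s.getD X.head) d X], q⟩ else none := by
  simp only [Op.run, Matrix.cons_val]
  congr 3
  funext i
  fin_cases i <;> rfl

theorem run_counter_moves (d : Dir) (n : ℕ) :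
    runOps A (List.replicate n (Op.basic 0 none none (some d))) ⟨![C, W, X], q⟩ =
      some ⟨![(Tape.move d)^[n] C, W, X], q⟩ := by
  induction n generalizing C with
  | zero => rfl
  | succ n ih =>
    simp only [List.replicate_succ, runOps, run_counter]
    simp [actOn_head, ih]

theorem run_work_moves (d : Dir) (n : ℕ) :
    runOps A (List.replicate n (Op.basic 1 none none (some d))) ⟨![C, W, X], q⟩ =
      some ⟨![C, (Tape.move d)^[n] W, X], q⟩ := by
  induction n generalizing W with
  | zero => rfl
  | succ n ih =>
    simp only [List.replicate_succ, runOps, run_work]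
    simp [actOn_head, ih]

theorem run_mark_moves (d : Dir) (n : ℕ) :
    runOps A (List.replicate n (Op.basic 2 none none (some d))) ⟨![C, W, X], q⟩ =
      some ⟨![C, W, (Tape.move d)^[n] X], q⟩ := by
  induction n generalizing X with
  | zero => rfl
  | succ n ih =>
    simp only [List.replicate_succ, runOps, run_mark]
    simp [actOn_head, ih]

/-- Test that the program counter is `j`, and change it to `j'`. -/
def guardOps (j j' : ℕ) : List Op :=
  List.replicate j (Op.basic 0 none none (some .left)) ++
    Op.basic 0 (some (some true)) none none ::
      List.replicate j' (Op.basic 0 none none (some .right))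

theorem holds_mark : Holds ((Tape.mk₁ []).write (some true))
    (fun z => if z = 0 then some true else none) 0 := by
  refine (holds_mk₁_nil.write (some true)).congr fun z => ?_
  simp [Function.update_apply]

/-- Tape `0` has a single mark, so going left `j` cells finds it exactly when the counter is `j`.
The arbitrary choice of blocks thereby becomes a controlled jump. -/
theorem run_guardOps (i j j' : ℕ) (W X : Tape (Option Bool)) (q : List Bool) :
    runOps A (guardOps j j') (memAt i W X q) =
      if i = j then some (memAt j' W X q) else none := by
  have hhead : ((Tape.move .left)^[j] (counterTape i)).head =
      if i = j then some true else none := by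
    rw [← Tape.nth_zero, iterate_move_left_nth, counterTape, iterate_move_right_nth, holds_mark]
    have : (0 + (0 - (j : ℤ) + i) = 0) ↔ i = j := by omega
    simp only [this]
  rw [guardOps, runOps_append, memAt, run_counter_moves, Option.bind_some, runOps, run_counter]
  by_cases h : i = j
  · subst h
    have hback : (Tape.move .left)^[i] (counterTape i) = counterTape 0 := by
      refine tape_ext fun z => ?_
      rw [iterate_move_left_nth, counterTape, iterate_move_right_nth, sub_add_cancel]
      rfl
    rw [if_pos (by rw [hhead]; simp), Option.bind_some, Option.getD_none, actOn_head_none, hback,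
      run_counter_moves, if_pos rfl]
    rfl
  · rw [if_neg (by rw [hhead]; simp [h]), if_neg h]
    rfl

/-- Move the heads of the work tape and of the mark tape by `n` cells. -/
def moveOps (d : Dir) (n : ℕ) : List Op :=
  List.replicate n (Op.basic 1 none none (some d)) ++
    List.replicate n (Op.basic 2 none none (some d))

theorem run_moveOps (d : Dir) (n j : ℕ) :
    runOps A (moveOps d n) (memAt j W X q) =
      some (memAt j ((Tape.move d)^[n] W) ((Tape.move d)^[n] X) q) := by
  rw [moveOps, runOps_append, memAt, run_work_moves, Option.bind_some, run_mark_moves]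
  rfl

/-- Move the heads of both tapes by `n` cells in the direction `d`, if any. -/
def optMoveOps (n : ℕ) : Option Dir → List Op
  | none => []
  | some d => moveOps d n

/-- At a marked cell, check the symbol `s` and replace it by `w`, move the mark by `n` cells if
`d` is a direction, and go to the next cell. -/
def slotOps (n : ℕ) (s w : Option Bool) (d : Option Dir) : List Op :=
  [Op.basic 2 (some (some true)) (some none) none, Op.basic 1 (some s) (some w) none] ++
    (optMoveOps n d ++
    [Op.basic 2 none (some (some true)) (some .right), Op.basic 1 none none (some .right)])

/-- Move `n` cells in the direction `d`, if any. -/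
def iterMove (d : Option Dir) (n : ℕ) (T : Tape (Option Bool)) : Tape (Option Bool) :=
  match d with
  | none => T
  | some d => (Tape.move d)^[n] T

theorem run_slotOps (n j : ℕ) (s w : Option Bool) (d : Option Dir) :
    runOps A (slotOps n s w d) (memAt j W X q) =
      if X.head = some true ∧ W.head = s then
        some (memAt j ((iterMove d n (W.write w)).move .right)
          (((iterMove d n (X.write none)).write (some true)).move .right) q)
      else none := by
  have hmid : ∀ W X : Tape (Option Bool),
      runOps A (optMoveOps n d) (memAt j W X q) =
        some (memAt j (iterMove d n W) (iterMove d n X) q) := by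
    intro W X
    cases d with
    | none => rfl
    | some d => exact run_moveOps d n j
  have hlast : ∀ W X : Tape (Option Bool),
      runOps A [Op.basic 2 none (some (some true)) (some .right),
        Op.basic 1 none none (some .right)] (memAt j W X q) =
        some (memAt j (W.move .right) ((X.write (some true)).move .right) q) := by
    intro W X
    simp only [runOps, memAt, run_mark]
    simp [actOn, run_work]
  rw [slotOps, runOps_append]
  by_cases hX : X.head = some true
  · by_cases hW : W.head = s
    · have h1 : runOps A [Op.basic 2 (some (some true)) (some none) none,
          Op.basic 1 (some s) (some w) none] (memAt j W X q) =
          some (memAt j (W.write w) (X.write none) q) := by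
        simp only [runOps, memAt, run_mark]
        simp [hX, run_work, hW, actOn]
      rw [h1, Option.bind_some, runOps_append, hmid, Option.bind_some, hlast, if_pos ⟨hX, hW⟩]
    · have h1 : runOps A [Op.basic 2 (some (some true)) (some none) none,
          Op.basic 1 (some s) (some w) none] (memAt j W X q) = none := by
        simp only [runOps, memAt, run_mark]
        simp [hX, run_work, hW]
      rw [h1, if_neg (by tauto)]
      rfl
  · have h1 : runOps A [Op.basic 2 (some (some true)) (some none) none,
        Op.basic 1 (some s) (some w) none] (memAt j W X q) = none := by
      simp only [runOps, memAt, run_mark]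
      simp [hX]
    rw [h1, if_neg (by tauto)]
    rfl

end Run

/-! ### Several tapes on one -/

section Interleave

variable {k : ℕ}

/-- The number of the tape to which the cell `p` of the work tape belongs. -/
def residue (k : ℕ) (p : ℤ) : Fin (k + 1) :=
  ⟨(p % (k + 1 : ℕ)).toNat, by
    have h1 := Int.emod_nonneg p (b := ((k + 1 : ℕ) : ℤ)) (by omega)
    have h2 := Int.emod_lt_of_pos p (b := ((k + 1 : ℕ) : ℤ)) (by omega)
    omega⟩

theorem residue_val (p : ℤ) : ((residue k p : ℕ) : ℤ) = p % (k + 1 : ℕ) := by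
  have h1 := Int.emod_nonneg p (b := ((k + 1 : ℕ) : ℤ)) (by omega)
  simp only [residue]
  omega

theorem residue_mul_add (z : ℤ) (i : Fin (k + 1)) : residue k ((k + 1 : ℕ) * z + (i : ℕ)) = i := by
  apply Fin.ext
  have h : ((residue k ((k + 1 : ℕ) * z + (i : ℕ)) : ℕ) : ℤ) = (i : ℕ) := by
    rw [residue_val, Int.mul_add_emod_self_left]
    exact Int.emod_eq_of_lt (by omega) (by have := i.2; omega)
  exact_mod_cast h

theorem mul_add_ediv (z : ℤ) (i : Fin (k + 1)) :
    ((k + 1 : ℕ) * z + (i : ℕ) : ℤ) / (k + 1 : ℕ) = z := by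
  rw [Int.mul_add_ediv_left _ _ (by omega), Int.ediv_eq_zero_of_lt (by omega)
    (by have := i.2; omega), add_zero]

theorem eq_mul_add (p : ℤ) : p = (k + 1 : ℕ) * (p / (k + 1 : ℕ)) + (residue k p : ℕ) := by
  rw [residue_val]
  exact (Int.mul_ediv_add_emod p _).symm

/-- The tapes `tapes`, with contents `g` and heads at `h`, are interleaved on the work tape, whose
head is at `p`; the positions of the heads are marked on the mark tape. -/
structure Interleaved (g : Fin (k + 1) → ℤ → Option Bool) (h : Fin (k + 1) → ℤ) (p : ℤ)
    (tapes : Fin (k + 1) → Tape (Option Bool)) (W X : Tape (Option Bool)) : Prop where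
  tape : ∀ i, Holds (tapes i) (g i) (h i)
  work : Holds W (fun p => g (residue k p) (p / (k + 1 : ℕ))) p
  mark : Holds X (fun p => if p / (k + 1 : ℕ) = h (residue k p) then some true else none) p

theorem Holds.iterate_move {T : Tape (Option Bool)} {f : ℤ → Option Bool} {p : ℤ}
    (h : Holds T f p) (d : Dir) (n : ℕ) :
    Holds ((Tape.move d)^[n] T) f (p + n * dirShift (some d)) := by
  induction n with
  | zero => simpa using h
  | succ n ih =>
    rw [Function.iterate_succ_apply']
    have := ih.move d
    rwa [add_assoc, ← add_one_mul, ← Nat.cast_succ] at this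

theorem Holds.iterMove {T : Tape (Option Bool)} {f : ℤ → Option Bool} {p : ℤ}
    (h : Holds T f p) (d : Option Dir) (n : ℕ) :
    Holds (iterMove d n T) f (p + n * dirShift d) := by
  cases d with
  | none => simpa [OracleSeparation.iterMove, dirShift] using h
  | some d => exact h.iterate_move d n

variable {g : Fin (k + 1) → ℤ → Option Bool} {h : Fin (k + 1) → ℤ} {p : ℤ}
  {tapes : Fin (k + 1) → Tape (Option Bool)} {W X : Tape (Option Bool)}

theorem Interleaved.moveOps (H : Interleaved g h p tapes W X) (d : Dir) :
    Interleaved g h (p + (k + 1 : ℕ) * dirShift (some d)) tapes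
      ((Tape.move d)^[k + 1] W) ((Tape.move d)^[k + 1] X) :=
  ⟨H.tape, H.work.iterate_move d _, H.mark.iterate_move d _⟩

theorem Interleaved.slot (z : ℤ) (i : Fin (k + 1))
    (H : Interleaved g h ((k + 1 : ℕ) * z + (i : ℕ)) tapes W X) :
    (X.head = some true ↔ z = h i) ∧ (z = h i → W.head = (tapes i).head) := by
  have h1 := H.mark.head
  have h2 := H.work.head
  simp only [residue_mul_add, mul_add_ediv] at h1 h2
  constructor
  · rw [h1]; split_ifs <;> simp_all
  · rintro rfl
    rw [h2, (H.tape i).head]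

/-- One cell on tape `i` is `k + 1` cells on the work tape, so the move preserves the residue, and
the final step to the right leads to the cells of the next tape. -/
theorem Interleaved.slotOps (i : Fin (k + 1)) (w : Option Bool) (d : Option Dir)
    (H : Interleaved g h ((k + 1 : ℕ) * h i + (i : ℕ)) tapes W X) :
    Interleaved (Function.update g i (Function.update (g i) (h i) w))
      (Function.update h i (h i + dirShift d))
      ((k + 1 : ℕ) * (h i + dirShift d) + (i : ℕ) + 1)
      (Function.update tapes i (actOn w d (tapes i)))
      ((iterMove d (k + 1) (W.write w)).move .right)
      (((iterMove d (k + 1) (X.write none)).write (some true)).move .right) := by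
  have hpos : ((k + 1 : ℕ) * h i + (i : ℕ) + (k + 1 : ℕ) * dirShift d : ℤ) =
      (k + 1 : ℕ) * (h i + dirShift d) + (i : ℕ) := by ring
  refine ⟨fun j => ?_, ?_, ?_⟩
  · by_cases hj : j = i
    · subst hj
      simp only [Function.update_self]
      exact (H.tape j).actOn w d
    · simp only [Function.update_of_ne hj]
      exact H.tape j
  · have h1 := ((H.work.write w).iterMove d (k + 1)).move .right
    rw [hpos] at h1
    refine h1.congr fun p => ?_
    rw [Function.update_apply]
    by_cases hp : p = (k + 1 : ℕ) * h i + (i : ℕ)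
    · rw [if_pos hp, hp, residue_mul_add, mul_add_ediv]
      simp
    · rw [if_neg hp]
      by_cases hr : residue k p = i
      · rw [hr, Function.update_self, Function.update_of_ne]
        intro hz
        apply hp
        rw [← hz, ← hr]
        exact eq_mul_add p
      · rw [Function.update_of_ne hr]
  · have h1 := (((H.mark.write none).iterMove d (k + 1)).write (some true)).move .right
    rw [hpos] at h1
    refine h1.congr fun p => ?_
    rw [Function.update_apply, Function.update_apply]
    by_cases hr : residue k p = i
    · have hp : ∀ z, p = (k + 1 : ℕ) * z + (i : ℕ) ↔ p / (k + 1 : ℕ) = z := by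
        intro z
        constructor
        · rintro rfl; exact mul_add_ediv z i
        · rintro rfl; rw [← hr]; exact eq_mul_add p
      simp only [hp, hr, Function.update_self]
      split_ifs <;> rfl
    · have hp : ∀ z, p ≠ (k + 1 : ℕ) * z + (i : ℕ) := by
        rintro z rfl
        exact hr (residue_mul_add z i)
      rw [if_neg (hp _), if_neg (hp _), Function.update_of_ne hr]

end Interleave

/-! ### Loading the input -/

/-- Write a symbol of the input, and go one block to the left. -/
def loadOps (k : ℕ) (b : Bool) : List Op :=
  Op.basic 1 none (some (some b)) none :: moveOps .left (k + 1)

/-- Mark the first cells of all tapes. -/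
def markOps (k : ℕ) : List Op :=
  moveOps .right (k + 1) ++
    (List.replicate (k + 1) (Op.basic 2 none (some (some true)) (some .right)) ++
      List.replicate (k + 1) (Op.basic 1 none none (some .right)))

/-- Write the input, from its end, and mark the first cells of all tapes. -/
def prologueOps (k : ℕ) (x : List Bool) : List Op :=
  x.reverse.flatMap (loadOps k) ++ markOps k

theorem run_loadOps {A : Oracle} {k j : ℕ} {b : Bool} {W X : Tape (Option Bool)} {q : List Bool} :
    runOps A (loadOps k b) (memAt j W X q) =
      some (memAt j ((Tape.move .left)^[k + 1] (W.write (some b)))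
        ((Tape.move .left)^[k + 1] X) q) := by
  simp only [loadOps, runOps, memAt, run_work]
  simp only [reduceCtorEq, IsEmpty.forall_iff, implies_true, if_true, Option.mem_def,
    Option.getD_some, Option.bind_some]
  exact run_moveOps _ _ j

/-- The last symbol is written first, so the induction is on the remaining prefix `x`, and `f` holds
what has been written already. -/
theorem run_load {A : Oracle} {k j : ℕ} {q : List Bool} (x : List Bool)
    {f : ℤ → Option Bool} {W X : Tape (Option Bool)}
    (hW : Holds W f ((k + 1 : ℕ) * (x.length - 1))) (hX : ∃ p, Holds X (fun _ => none) p) :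
    ∃ W' X', runOps A (x.reverse.flatMap (loadOps k)) (memAt j W X q) = some (memAt j W' X' q) ∧
      (∃ p, Holds X' (fun _ => none) p) ∧
      Holds W' (fun p => if residue k p = 0 then (listContent x (p / (k + 1 : ℕ))).or (f p) else f p)
        (-(k + 1 : ℕ)) := by
  induction x using List.reverseRecOn generalizing f W X with
  | nil =>
    refine ⟨W, X, rfl, hX, ?_⟩
    have : ((k + 1 : ℕ) : ℤ) * (([] : List Bool).length - 1) = -(k + 1 : ℕ) := by simp
    rw [this] at hW
    exact hW.congr fun z => by simp [listContent]
  | append_singleton x b ih =>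
    obtain ⟨p, hX⟩ := hX
    have hpos : ((k + 1 : ℕ) : ℤ) * ((x ++ [b]).length - 1) = (k + 1 : ℕ) * x.length := by
      simp
    rw [hpos] at hW
    have hW' := (hW.write (some b)).iterate_move .left (k + 1)
    have hpos' : ((k + 1 : ℕ) : ℤ) * x.length + (k + 1 : ℕ) * dirShift (some .left) =
        (k + 1 : ℕ) * (x.length - 1) := by simp only [dirShift]; ring
    rw [hpos'] at hW'
    obtain ⟨W', X', h1, h2, h3⟩ := ih hW' ⟨_, hX.iterate_move .left (k + 1)⟩
    refine ⟨W', X', ?_, h2, h3.congr fun p => ?_⟩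
    · rw [List.reverse_append, List.reverse_singleton, List.singleton_append, List.flatMap_cons,
        runOps_append, run_loadOps, Option.bind_some, h1]
    · rw [← update_listContent, Function.update_apply, Function.update_apply]
      by_cases hr : residue k p = 0
      · rw [if_pos hr, if_pos hr]
        have hp : p = (k + 1 : ℕ) * (x.length : ℤ) ↔ p / (k + 1 : ℕ) = x.length := by
          have h0 := eq_mul_add (k := k) p
          rw [hr] at h0
          constructor
          · rintro rfl
            simpa using mul_add_ediv (k := k) (x.length : ℤ) 0
          · intro h
            rw [h] at h0
            simpa using h0
        by_cases hp' : p / (k + 1 : ℕ) = x.length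
        · rw [if_pos hp', if_pos (hp.2 hp'), hp', listContent_length]; rfl
        · rw [if_neg hp', if_neg (fun h => hp' (hp.1 h))]
      · rw [if_neg hr, if_neg hr, if_neg]
        rintro rfl
        apply hr
        simpa using residue_mul_add (k := k) (x.length : ℤ) 0

theorem run_marks {A : Oracle} {j : ℕ} {q : List Bool} (n : ℕ) {m : ℕ}
    {W X : Tape (Option Bool)}
    (hX : Holds X (fun p => if 0 ≤ p ∧ p < m then some true else none) m) :
    ∃ X', runOps A (List.replicate n (Op.basic 2 none (some (some true)) (some .right)))
      (memAt j W X q) = some (memAt j W X' q) ∧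
      Holds X' (fun p => if 0 ≤ p ∧ p < (m + n : ℕ) then some true else none) (m + n : ℕ) := by
  induction n generalizing m X with
  | zero => exact ⟨X, rfl, hX⟩
  | succ n ih =>
    have h1 : Holds ((X.write (some true)).move .right)
        (fun p => if 0 ≤ p ∧ p < (m + 1 : ℕ) then some true else none) (m + 1 : ℕ) := by
      have := (hX.write (some true)).move .right
      refine Holds.congr (by simpa [dirShift] using this) fun p => ?_
      rw [Function.update_apply]
      push_cast
      split_ifs <;> first | rfl | omega
    obtain ⟨X', h2, h3⟩ := ih h1
    refine ⟨X', ?_, by rwa [show m + (n + 1) = m + 1 + n by omega]⟩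
    rw [List.replicate_succ, runOps, memAt, run_mark]
    simp only [reduceCtorEq, IsEmpty.forall_iff, implies_true, if_true, Option.mem_def,
      Option.getD_some, Option.bind_some]
    exact h2

theorem run_prologueOps {A : Oracle} {Q : Type} {k j : ℕ} (N : OracleTM Q k) (x : List Bool) :
    ∃ W X, runOps A (prologueOps k x) (memAt j (Tape.mk₁ []) (Tape.mk₁ []) []) =
      some (memAt j W X []) ∧
      Interleaved (fun i => if i = 0 then listContent x else fun _ => none) (fun _ => 0)
        ((k + 1 : ℕ) * 1) (N.init x).tapes W X := by
  -- A blank tape looks the same from every cell, so the starting cell may be given the coordinate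
  -- of the last input symbol. Loading then ends at `-(k + 1)` whatever the length of the input, and
  -- no rewinding is needed.
  have hblank : ∀ p, Holds (Tape.mk₁ []) (fun _ => none) p := fun p i => holds_mk₁_nil i
  obtain ⟨W₁, X₁, h1, ⟨p, hX₁⟩, hW₁⟩ := run_load (A := A) (k := k) (j := j) (q := []) x
    (hblank _) ⟨0, hblank 0⟩
  have hX₁' : Holds X₁ (fun _ => none) (-(k + 1 : ℕ)) := fun i => hX₁ i
  have hX₂ := hX₁'.iterate_move .right (k + 1)
  have hW₂ := hW₁.iterate_move .right (k + 1)
  have hz : (-(k + 1 : ℕ) + (k + 1 : ℕ) * dirShift (some .right) : ℤ) = 0 := by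
    simp [dirShift]
  rw [hz] at hX₂ hW₂
  obtain ⟨X₃, h3, hX₃⟩ := run_marks (A := A) (j := j) (q := [])
    (W := (Tape.move .right)^[k + 1] W₁) (k + 1) (m := 0)
    (hX₂.congr fun p => by rw [if_neg (by simp)])
  have hW₃ := hW₂.iterate_move .right (k + 1)
  refine ⟨(Tape.move .right)^[k + 1] ((Tape.move .right)^[k + 1] W₁), X₃, ?_, fun i => ?_, ?_, ?_⟩
  · rw [prologueOps, runOps_append, h1, Option.bind_some, markOps, runOps_append, run_moveOps,
      Option.bind_some, runOps_append, h3, Option.bind_some, memAt, run_work_moves]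
    rfl
  · by_cases hi : i = 0
    · simp only [OracleTM.init, hi, if_true]; exact holds_mk₁ x
    · simp only [OracleTM.init, hi, if_false]; exact holds_mk₁_nil
  · refine Holds.congr (by simpa [dirShift] using hW₃) fun p => ?_
    by_cases hr : residue k p = 0 <;> simp [hr]
  · rw [zero_add] at hX₃
    rw [mul_one]
    refine hX₃.congr fun p => ?_
    have : (0 ≤ p ∧ p < (k + 1 : ℕ)) ↔ p / (k + 1 : ℕ) = 0 := by
      constructor
      · rintro ⟨h1, h2⟩
        exact Int.ediv_eq_zero_of_lt h1 h2
      · intro h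
        have h0 := eq_mul_add (k := k) p
        have h1 := (residue k p).2
        rw [h, mul_zero, zero_add] at h0
        omega
    rw [if_congr this rfl rfl]

/-! ### The program that simulates a machine -/

section Simulation

variable {Q : Type} {k : ℕ}

/-- The labels of the simulation. -/
inductive Label (Q : Type) (k : ℕ) : Type where
  /-- The machine is in state `q`. -/
  | state (q : Q)
  /-- The action `a` is performed; the first `i` tapes are done. -/
  | trans (q : Q) (s : Fin (k + 1) → Option Bool) (a : Action Q k) (i : Fin (k + 2))
  /-- The machine has accepted. -/
  | final

instance [Finite Q] : Finite (Label Q k) := by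
  let f : Label Q k → Q ⊕ (Q × (Fin (k + 1) → Option Bool) × Action Q k × Fin (k + 2)) ⊕ Unit :=
    fun l => match l with
    | .state q => .inl q
    | .trans q s a i => .inr (.inl (q, s, a, i))
    | .final => .inr (.inr ())
  refine Finite.of_injective f ?_
  intro a b h
  cases a <;> cases b <;> simp_all [f]

/-- A numbering of the labels; `none` is the initial label. -/
noncomputable def labelCode [Finite Q] : Option (Label Q k) → ℕ
  | none => 0
  | some l => Finite.equivFin (Label Q k) l + 1

theorem labelCode_injective [Finite Q] :
    Function.Injective (labelCode : Option (Label Q k) → ℕ) := by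
  intro a b h
  cases a <;> cases b <;> simp [labelCode, Fin.val_inj] at h ⊢
  exact h

/-- A labelled list of operations. -/
structure Edge (Q : Type) (k : ℕ) : Type where
  /-- The label before the operations. -/
  src : Option (Label Q k)
  /-- The operations. -/
  ops : List Op
  /-- The label after the operations. -/
  dst : Option (Label Q k)

/-- The block of the program. -/
noncomputable def Edge.block [Finite Q] (e : Edge Q k) : List Op :=
  guardOps (labelCode e.src) (labelCode e.dst) ++ e.ops

/-- The symbol that an action writes on tape `i`, when `s` are the scanned symbols. -/
def Action.symbol (a : Action Q k) (s : Fin (k + 1) → Option Bool) (i : Fin (k + 1)) :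
    Option Bool :=
  match a with
  | .act _ w _ _ => w i
  | _ => s i

/-- The direction in which an action moves the head of tape `i`. -/
def Action.dir (a : Action Q k) (i : Fin (k + 1)) : Option Dir :=
  match a with
  | .act _ _ d _ => d i
  | _ => none

/-- The edges of the program that simulates a machine. -/
inductive SimEdge (N : OracleTM Q k) : Edge Q k → Prop where
  | choose (q s a) : a ∈ N.δ q s → SimEdge N ⟨some (.state q), [], some (.trans q s a 0)⟩
  | seek (q s a i d) :
      SimEdge N ⟨some (.trans q s a i), moveOps d (k + 1), some (.trans q s a i)⟩
  | slot (q s a) (i : Fin (k + 1)) :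
      SimEdge N ⟨some (.trans q s a i.castSucc),
        slotOps (k + 1) (s i) (a.symbol s i) (a.dir i), some (.trans q s a i.succ)⟩
  | act (q s q' w d o) :
      SimEdge N ⟨some (.trans q s (.act q' w d o) (Fin.last _)), o.toList.map .out,
        some (.state q')⟩
  | yes (q s y n) :
      SimEdge N ⟨some (.trans q s (.query y n) (Fin.last _)), [.ask true], some (.state y)⟩
  | no (q s y n) :
      SimEdge N ⟨some (.trans q s (.query y n) (Fin.last _)), [.ask false], some (.state n)⟩
  | accept (q s) :
      SimEdge N ⟨some (.trans q s (.halt true) (Fin.last _)), [], some .final⟩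
  | final : SimEdge N ⟨some .final, [.acc], some .final⟩

theorem finite_simEdge [Finite Q] (N : OracleTM Q k) : {e | SimEdge N e}.Finite := by
  let S := Fin (k + 1) → Option Bool
  let f₁ : Q × S × Action Q k → Edge Q k :=
    fun t => ⟨some (.state t.1), [], some (.trans t.1 t.2.1 t.2.2 0)⟩
  let f₂ : Q × S × Action Q k × Fin (k + 2) × Dir → Edge Q k :=
    fun t => ⟨some (.trans t.1 t.2.1 t.2.2.1 t.2.2.2.1), moveOps t.2.2.2.2 (k + 1),
      some (.trans t.1 t.2.1 t.2.2.1 t.2.2.2.1)⟩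
  let f₃ : Q × S × Action Q k × Fin (k + 1) → Edge Q k :=
    fun t => ⟨some (.trans t.1 t.2.1 t.2.2.1 t.2.2.2.castSucc),
      slotOps (k + 1) (t.2.1 t.2.2.2) (t.2.2.1.symbol t.2.1 t.2.2.2) (t.2.2.1.dir t.2.2.2),
      some (.trans t.1 t.2.1 t.2.2.1 t.2.2.2.succ)⟩
  let f₄ : Q × S × Q × S × (Fin (k + 1) → Option Dir) × Option Bool → Edge Q k :=
    fun t => ⟨some (.trans t.1 t.2.1 (.act t.2.2.1 t.2.2.2.1 t.2.2.2.2.1 t.2.2.2.2.2)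
      (Fin.last _)), t.2.2.2.2.2.toList.map .out, some (.state t.2.2.1)⟩
  let f₅ : Q × S × Q × Q → Edge Q k :=
    fun t => ⟨some (.trans t.1 t.2.1 (.query t.2.2.1 t.2.2.2) (Fin.last _)), [.ask true],
      some (.state t.2.2.1)⟩
  let f₆ : Q × S × Q × Q → Edge Q k :=
    fun t => ⟨some (.trans t.1 t.2.1 (.query t.2.2.1 t.2.2.2) (Fin.last _)), [.ask false],
      some (.state t.2.2.2)⟩
  let f₇ : Q × S → Edge Q k :=
    fun t => ⟨some (.trans t.1 t.2 (.halt true) (Fin.last _)), [], some .final⟩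
  refine ((Set.finite_range f₁).union ((Set.finite_range f₂).union ((Set.finite_range f₃).union
    ((Set.finite_range f₄).union ((Set.finite_range f₅).union ((Set.finite_range f₆).union
    ((Set.finite_range f₇).union (Set.finite_singleton
      (⟨some .final, [.acc], some .final⟩ : Edge Q k))))))))).subset ?_
  intro e he
  cases he with
  | choose q s a _ => exact Or.inl ⟨(q, s, a), rfl⟩
  | seek q s a i d => exact Or.inr (Or.inl ⟨(q, s, a, i, d), rfl⟩)
  | slot q s a i => exact Or.inr (Or.inr (Or.inl ⟨(q, s, a, i), rfl⟩))
  | act q s q' w d o => exact Or.inr (Or.inr (Or.inr (Or.inl ⟨(q, s, q', w, d, o), rfl⟩)))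
  | yes q s y n => exact Or.inr (Or.inr (Or.inr (Or.inr (Or.inl ⟨(q, s, y, n), rfl⟩))))
  | no q s y n => exact Or.inr (Or.inr (Or.inr (Or.inr (Or.inr (Or.inl ⟨(q, s, y, n), rfl⟩)))))
  | accept q s =>
    exact Or.inr (Or.inr (Or.inr (Or.inr (Or.inr (Or.inr (Or.inl ⟨(q, s), rfl⟩))))))
  | final => exact Or.inr (Or.inr (Or.inr (Or.inr (Or.inr (Or.inr (Or.inr rfl))))))

/-- The blocks of the simulation, except for the first one. -/
noncomputable def simBlocks [Finite Q] (N : OracleTM Q k) : List (List Op) :=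
  (finite_simEdge N).toFinset.toList.map Edge.block

theorem mem_simBlocks [Finite Q] {N : OracleTM Q k} {b : List Op} :
    b ∈ simBlocks N ↔ ∃ e, SimEdge N e ∧ e.block = b := by
  simp [simBlocks]

/-- The edge that loads the input. -/
def prologueEdge (N : OracleTM Q k) (x : List Bool) : Edge Q k :=
  ⟨none, prologueOps k x, some (.state N.start)⟩

/-- The program that simulates a machine on a given input. -/
noncomputable def simProgram [Finite Q] (N : OracleTM Q k) (x : List Bool) : List (List Op) :=
  simBlocks N ++ [(prologueEdge N x).block]

theorem mem_simProgram [Finite Q] {N : OracleTM Q k} {x : List Bool} {b : List Op} :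
    b ∈ simProgram N x ↔ ∃ e, (SimEdge N e ∨ e = prologueEdge N x) ∧ e.block = b := by
  simp only [simProgram, List.mem_append, mem_simBlocks, List.mem_singleton]
  constructor
  · rintro (⟨e, he, rfl⟩ | rfl)
    · exact ⟨e, Or.inl he, rfl⟩
    · exact ⟨_, Or.inr rfl, rfl⟩
  · rintro ⟨e, he | rfl, rfl⟩
    · exact Or.inl ⟨e, he, rfl⟩
    · exact Or.inr rfl

theorem run_block_src [Finite Q] {A : Oracle} (e : Edge Q k) (W X : Tape (Option Bool))
    (u : List Bool) :
    runOps A e.block (memAt (labelCode e.src) W X u) =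
      runOps A e.ops (memAt (labelCode e.dst) W X u) := by
  rw [Edge.block, runOps_append, run_guardOps, if_pos rfl, Option.bind_some]

theorem eq_src_of_run [Finite Q] {A : Oracle} {e : Edge Q k} {ops : List Op}
    {l : Option (Label Q k)} {W X : Tape (Option Bool)} {u : List Bool} {σ : Mem}
    (h : runOps A (guardOps (labelCode e.src) (labelCode e.dst) ++ ops)
      (memAt (labelCode l) W X u) = some σ) : l = e.src := by
  rw [runOps_append, run_guardOps] at h
  split_ifs at h with h'
  · exact labelCode_injective h'
  · cases h

/-- The tapes when the action `a` has been performed on the first `i` tapes. -/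
def partialTapes (tapes : Fin (k + 1) → Tape (Option Bool)) (s : Fin (k + 1) → Option Bool)
    (a : Action Q k) (i : ℕ) (j : Fin (k + 1)) : Tape (Option Bool) :=
  if (j : ℕ) < i then actOn (a.symbol s j) (a.dir j) (tapes j) else tapes j

theorem partialTapes_zero (tapes : Fin (k + 1) → Tape (Option Bool))
    (s : Fin (k + 1) → Option Bool) (a : Action Q k) : partialTapes tapes s a 0 = tapes := by
  funext j; simp [partialTapes]

theorem partialTapes_self (tapes : Fin (k + 1) → Tape (Option Bool))
    (s : Fin (k + 1) → Option Bool) (a : Action Q k) (i : Fin (k + 1)) :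
    partialTapes tapes s a i i = tapes i := by
  simp [partialTapes]

theorem partialTapes_succ (tapes : Fin (k + 1) → Tape (Option Bool))
    (s : Fin (k + 1) → Option Bool) (a : Action Q k) (i : Fin (k + 1)) :
    partialTapes tapes s a (i + 1) = Function.update (partialTapes tapes s a i) i
      (actOn (a.symbol s i) (a.dir i) (tapes i)) := by
  funext j
  by_cases hj : j = i
  · subst hj; simp [partialTapes]
  · have hne : (j : ℕ) ≠ i := fun h => hj (Fin.ext h)
    have : (j : ℕ) < i + 1 ↔ (j : ℕ) < i := by omega
    simp [partialTapes, hj, this]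

theorem perform_eq_of_partialTapes {A : Oracle} {c : Config Q k} {s : Fin (k + 1) → Option Bool}
    (hs : ∀ i, (c.tapes i).head = s i) (a : Action Q k) :
    (c.perform A a).tapes = partialTapes c.tapes s a (k + 1) := by
  funext i
  simp only [partialTapes, i.2, if_true]
  cases a with
  | halt b => simp [Config.perform, Action.symbol, Action.dir, ← hs, actOn_head_none]
  | query y n => simp [Config.perform, Action.symbol, Action.dir, ← hs, actOn_head_none]
  | act q w d o => rw [perform_act]; rfl

/-! ### Soundness of the simulation -/

/-- The property of memories that proves the soundness of the simulation. -/
def SimSound (A : Oracle) (N : OracleTM Q k) (x : List Bool) (W X : Tape (Option Bool))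
    (u : List Bool) : Option (Label Q k) → Prop
  | none => W = Tape.mk₁ [] ∧ X = Tape.mk₁ [] ∧ u = []
  | some (.state q) => ∃ n c g h z, N.Reaches A n (N.init x) c ∧ c.status = Sum.inl q ∧
      c.queryTape = u ∧ Interleaved g h ((k + 1 : ℕ) * z) c.tapes W X
  | some (.trans q s a i) => ∃ n c g h z, N.Reaches A n (N.init x) c ∧ c.status = Sum.inl q ∧
      c.queryTape = u ∧ a ∈ N.δ q s ∧ (∀ j : Fin (k + 1), (j : ℕ) < i → (c.tapes j).head = s j) ∧
      Interleaved g h ((k + 1 : ℕ) * z + (i : ℕ)) (partialTapes c.tapes s a i) W X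
  | some .final => N.Accepts A x

theorem run_outs {A : Oracle} (l : List Bool) (j : ℕ) (W X : Tape (Option Bool)) (u : List Bool) :
    runOps A (l.map .out) (memAt j W X u) = some (memAt j W X (u ++ l)) := by
  induction l generalizing u with
  | nil => simp [runOps]
  | cons b l ih =>
    have : (Op.out b).run A (memAt j W X u) = some (memAt j W X (u ++ [b])) := rfl
    rw [List.map_cons, runOps, this, Option.bind_some, ih]
    simp

theorem run_ask {A : Oracle} (b : Bool) (j : ℕ) (W X : Tape (Option Bool)) (u : List Bool) :
    runOps A [.ask b] (memAt j W X u) = if A u = b then some (memAt j W X []) else none := by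
  simp only [runOps, Op.run, memAt]
  split_ifs with h <;> simp [h]

theorem Interleaved.of_last {g : Fin (k + 1) → ℤ → Option Bool} {h : Fin (k + 1) → ℤ} {z : ℤ}
    {tapes : Fin (k + 1) → Tape (Option Bool)} {W X : Tape (Option Bool)}
    (H : Interleaved g h ((k + 1 : ℕ) * z + (k + 1 : ℕ)) tapes W X) :
    Interleaved g h ((k + 1 : ℕ) * (z + 1)) tapes W X := by
  rwa [mul_add, mul_one]

/-- The edge `choose` guesses the scanned symbols and an action allowed for them; each `slot`
verifies one symbol. Once all tapes are done the guess was right, so the action was a legal step. A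
wrong guess can never leave its label chain. -/
theorem SimSound.run_edge [Finite Q] {A : Oracle} {N : OracleTM Q k} {x : List Bool}
    {W X : Tape (Option Bool)} {u : List Bool} {e : Edge Q k} {σ : Mem}
    (hI : SimSound A N x W X u e.src) (he : SimEdge N e ∨ e = prologueEdge N x)
    (hrun : runOps A e.ops (memAt (labelCode e.dst) W X u) = some σ) :
    ∃ l W' X' u', σ = memAt (labelCode l) W' X' u' ∧ SimSound A N x W' X' u' l := by
  rcases he with he | rfl
  · cases he with
    | choose q s a ha =>
      obtain ⟨n, c, g, h, z, hc, hq, hu, H⟩ := hI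
      cases hrun
      refine ⟨some (.trans q s a 0), W, X, u, rfl, n, c, g, h, z, hc, hq, hu, ha, ?_, ?_⟩
      · intro j hj; simp at hj
      · simpa [partialTapes_zero] using H
    | seek q s a i d =>
      obtain ⟨n, c, g, h, z, hc, hq, hu, ha, hs, H⟩ := hI
      rw [run_moveOps] at hrun
      cases hrun
      refine ⟨some (.trans q s a i), _, _, u, rfl, n, c, g, h, z + dirShift (some d), hc, hq, hu,
        ha, hs, ?_⟩
      have := H.moveOps d
      rwa [show ((k + 1 : ℕ) * z + (i : ℕ) + (k + 1 : ℕ) * dirShift (some d) : ℤ) =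
        (k + 1 : ℕ) * (z + dirShift (some d)) + (i : ℕ) by ring] at this
    | slot q s a i =>
      obtain ⟨n, c, g, h, z, hc, hq, hu, ha, hs, H⟩ := hI
      rw [run_slotOps] at hrun
      split_ifs at hrun with hcond
      cases hrun
      simp only [Fin.val_castSucc] at hs H
      obtain ⟨h1, h2⟩ := H.slot z i
      -- However `seek` wandered, a slot succeeds only on a marked cell, which is the head position
      -- of tape `i`.
      obtain rfl := h1.1 hcond.1
      have hhead : (c.tapes i).head = s i := by
        rw [← hcond.2, h2 rfl, partialTapes_self]
      have H' := H.slotOps i (a.symbol s i) (a.dir i)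
      rw [partialTapes_self, ← partialTapes_succ, add_assoc, ← Nat.cast_succ,
        ← Fin.val_succ] at H'
      refine ⟨some (.trans q s a i.succ), _, _, u, rfl, n, c, _, _, _, hc, hq, hu, ha, fun j hj => ?_,
        H'⟩
      rw [Fin.val_succ] at hj
      rcases Nat.lt_succ_iff_lt_or_eq.1 hj with hj | hj
      · exact hs j hj
      · rw [Fin.ext hj]; exact hhead
    | act q s q' w d o =>
      obtain ⟨n, c, g, h, z, hc, hq, hu, ha, hs, H⟩ := hI
      simp only [Fin.val_last] at hs H
      have hs' : ∀ j, (c.tapes j).head = s j := fun j => hs j j.2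
      rw [run_outs] at hrun
      cases hrun
      refine ⟨some (.state q'), W, X, _, rfl, n + 1, c.perform A (.act q' w d o), g, h, z + 1,
        hc.tail ⟨q, hq, _, by rwa [funext hs'], rfl⟩, rfl, by rw [← hu]; rfl, ?_⟩
      rw [perform_eq_of_partialTapes hs']
      exact H.of_last
    | yes q s y m =>
      obtain ⟨n, c, g, h, z, hc, hq, hu, ha, hs, H⟩ := hI
      simp only [Fin.val_last] at hs H
      have hs' : ∀ j, (c.tapes j).head = s j := fun j => hs j j.2
      rw [run_ask] at hrun
      split_ifs at hrun with hA
      cases hrun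
      refine ⟨some (.state y), W, X, _, rfl, n + 1, c.perform A (.query y m), g, h, z + 1,
        hc.tail ⟨q, hq, _, by rwa [funext hs'], rfl⟩, by simp [Config.perform, hu, hA], rfl, ?_⟩
      rw [perform_eq_of_partialTapes hs']
      exact H.of_last
    | no q s y m =>
      obtain ⟨n, c, g, h, z, hc, hq, hu, ha, hs, H⟩ := hI
      simp only [Fin.val_last] at hs H
      have hs' : ∀ j, (c.tapes j).head = s j := fun j => hs j j.2
      rw [run_ask] at hrun
      split_ifs at hrun with hA
      cases hrun
      refine ⟨some (.state m), W, X, _, rfl, n + 1, c.perform A (.query y m), g, h, z + 1,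
        hc.tail ⟨q, hq, _, by rwa [funext hs'], rfl⟩, by simp [Config.perform, hu, hA], rfl, ?_⟩
      rw [perform_eq_of_partialTapes hs']
      exact H.of_last
    | accept q s =>
      obtain ⟨n, c, g, h, z, hc, hq, hu, ha, hs, H⟩ := hI
      simp only [Fin.val_last] at hs H
      have hs' : ∀ j, (c.tapes j).head = s j := fun j => hs j j.2
      cases hrun
      exact ⟨some .final, W, X, u, rfl, n + 1, c.perform A (.halt true),
        hc.tail ⟨q, hq, _, by rwa [funext hs'], rfl⟩, rfl⟩
    | final => simp [runOps, Op.run] at hrun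
  · obtain ⟨rfl, rfl, rfl⟩ := hI
    obtain ⟨W, X, h1, H⟩ := run_prologueOps (A := A) (j := labelCode (k := k) (some (.state N.start))) N x
    rw [show (prologueEdge N x).ops = prologueOps k x from rfl,
      show (prologueEdge N x).dst = some (.state N.start) from rfl, h1] at hrun
    cases hrun
    exact ⟨some (.state N.start), W, X, [], rfl, 0, N.init x, _, _, 1, .refl _, rfl, rfl, H⟩

theorem simSound_of_blockReaches [Finite Q] {A : Oracle} {N : OracleTM Q k} {x : List Bool}
    {r : ℕ} {σ : Mem} (h : BlockReaches A (simProgram N x) r startMem σ) :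
    ∃ l W X u, σ = memAt (labelCode l) W X u ∧ SimSound A N x W X u l := by
  generalize hσ : startMem = σ₀ at h
  induction h with
  | refl σ₀ => exact ⟨none, _, _, _, by rw [← hσ, ← memAt_zero]; rfl, rfl, rfl, rfl⟩
  | tail h hb hrun ih =>
    obtain ⟨l, W, X, u, rfl, hI⟩ := ih hσ
    obtain ⟨e, he, rfl⟩ := mem_simProgram.1 hb
    obtain rfl := eq_src_of_run hrun
    rw [run_block_src] at hrun
    exact hI.run_edge he hrun

theorem acc_not_mem_guardOps (i j : ℕ) : Op.acc ∉ guardOps i j := by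
  simp [guardOps, List.mem_replicate]

theorem acc_not_mem_moveOps (d : Dir) (n : ℕ) : Op.acc ∉ moveOps d n := by
  simp [moveOps, List.mem_replicate]

theorem acc_not_mem_prologueOps (x : List Bool) : Op.acc ∉ prologueOps k x := by
  simp [prologueOps, loadOps, markOps, acc_not_mem_moveOps, List.mem_replicate]

/-- The operation `acc` occurs only in the edge at the label `final`, whose invariant is acceptance
by `N`. -/
theorem accepts_of_programAccepts [Finite Q] {A : Oracle} {N : OracleTM Q k} {x : List Bool}
    {r : ℕ} (h : ProgramAccepts A (simProgram N x) r) : N.Accepts A x := by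
  obtain ⟨σ, hr, pre, suf, σ', hb, hrun⟩ := h
  obtain ⟨l, W, X, u, rfl, hI⟩ := simSound_of_blockReaches hr
  obtain ⟨e, he, heq⟩ := mem_simProgram.1 hb
  -- The guard contains no `acc`, so it has been executed completely before `acc` is met, and it
  -- certifies the label.
  have hpre : ∃ ops, pre = guardOps (labelCode e.src) (labelCode e.dst) ++ ops ∧
      e.ops = ops ++ Op.acc :: suf := by
    rcases List.append_eq_append_iff.1 heq with ⟨l, h1, h2⟩ | ⟨l, h1, h2⟩
    · exact ⟨l, h1, h2⟩
    · cases l with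
      | nil => exact ⟨[], by simpa using h1.symm, by simpa using h2.symm⟩
      | cons a l =>
        simp only [List.cons_append, List.cons.injEq] at h2
        refine absurd ?_ (acc_not_mem_guardOps (labelCode e.src) (labelCode e.dst))
        rw [h1, h2.1]; simp
  obtain ⟨ops, rfl, hops⟩ := hpre
  obtain rfl := eq_src_of_run hrun
  have hacc : Op.acc ∈ e.ops := by rw [hops]; simp
  rcases he with he | rfl
  · cases he with
    | choose => simp at hacc
    | seek q s a i d => exact absurd hacc (acc_not_mem_moveOps _ _)
    | slot q s a i =>
      cases hd : a.dir i <;> simp [slotOps, optMoveOps, hd, acc_not_mem_moveOps] at hacc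
    | act => simp at hacc
    | yes => simp at hacc
    | no => simp at hacc
    | accept => simp at hacc
    | final => exact hI
  · exact absurd hacc (acc_not_mem_prologueOps x)

/-! ### Completeness of the simulation -/

theorem BlockReaches.trans {A : Oracle} {D : List (List Op)} {r r' : ℕ} {σ σ' σ'' : Mem}
    (h : BlockReaches A D r σ σ') (h' : BlockReaches A D r' σ' σ'') :
    BlockReaches A D (r + r') σ σ'' := by
  induction h' with
  | refl => exact h
  | tail _ hb hrun ih => exact (ih h).tail hb hrun

theorem blockReaches_edge [Finite Q] {A : Oracle} {N : OracleTM Q k} {x : List Bool}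
    {e : Edge Q k} (he : SimEdge N e ∨ e = prologueEdge N x) {W X : Tape (Option Bool)}
    {u : List Bool} {σ : Mem}
    (hrun : runOps A e.ops (memAt (labelCode e.dst) W X u) = some σ) :
    BlockReaches A (simProgram N x) 1 (memAt (labelCode e.src) W X u) σ := by
  refine (BlockReaches.refl _).tail (mem_simProgram.2 ⟨e, he, rfl⟩) ?_
  rw [run_block_src, hrun]

theorem blockReaches_seek [Finite Q] {A : Oracle} {N : OracleTM Q k} {x : List Bool} {q : Q}
    {s : Fin (k + 1) → Option Bool} {a : Action Q k} {i : Fin (k + 2)} {u : List Bool}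
    {g : Fin (k + 1) → ℤ → Option Bool} {h : Fin (k + 1) → ℤ}
    {tapes : Fin (k + 1) → Tape (Option Bool)} (n : ℕ) {z z' : ℤ} (hn : (z' - z).natAbs = n)
    {W X : Tape (Option Bool)} (H : Interleaved g h ((k + 1 : ℕ) * z + (i : ℕ)) tapes W X) :
    ∃ W' X', BlockReaches A (simProgram N x) n (memAt (labelCode (some (.trans q s a i))) W X u)
      (memAt (labelCode (some (.trans q s a i))) W' X' u) ∧
      Interleaved g h ((k + 1 : ℕ) * z' + (i : ℕ)) tapes W' X' := by
  induction n generalizing z W X with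
  | zero =>
    obtain rfl : z' = z := by omega
    exact ⟨W, X, .refl _, H⟩
  | succ n ih =>
    obtain ⟨d, hd⟩ : ∃ d : Dir, (z' - (z + dirShift (some d))).natAbs = n := by
      rcases lt_or_ge z z' with h | h
      · exact ⟨.right, by simp only [dirShift]; omega⟩
      · exact ⟨.left, by simp only [dirShift]; omega⟩
    have H' := H.moveOps d
    rw [show ((k + 1 : ℕ) * z + (i : ℕ) + (k + 1 : ℕ) * dirShift (some d) : ℤ) =
        (k + 1 : ℕ) * (z + dirShift (some d)) + (i : ℕ) by ring] at H'
    obtain ⟨W', X', h1, h2⟩ := ih hd H'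
    refine ⟨W', X', ?_, h2⟩
    rw [add_comm]
    exact (blockReaches_edge (Or.inl (.seek q s a i d)) (run_moveOps _ _ _)).trans h1

theorem abs_add_dirShift_le {z : ℤ} {m : ℕ} (h : z.natAbs ≤ m) (d : Option Dir) :
    (z + dirShift d).natAbs ≤ m + 1 := by
  rcases d with _ | _ | _ <;> simp only [dirShift] <;> omega

/-- Heads not yet treated are within `m` of the origin and the working position is within `m + 1`,
so a tape needs at most `2 * m + 1` seeks and one slot. Afterwards the working position is a head
that has just moved, again within `m + 1`. -/
theorem blockReaches_trans_tapes [Finite Q] {A : Oracle} {N : OracleTM Q k} {x : List Bool} {q : Q}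
    {s : Fin (k + 1) → Option Bool} {a : Action Q k} {u : List Bool}
    {g : Fin (k + 1) → ℤ → Option Bool} {h : Fin (k + 1) → ℤ}
    {tapes : Fin (k + 1) → Tape (Option Bool)} {z : ℤ} {W X : Tape (Option Bool)} {m : ℕ}
    (H : Interleaved g h ((k + 1 : ℕ) * z) tapes W X) (hs : ∀ i, (tapes i).head = s i)
    (hh : ∀ i, (h i).natAbs ≤ m) (hz : z.natAbs ≤ m + 1) (i : Fin (k + 2)) :
    ∃ r g' h' z' W' X', r ≤ i * (2 * m + 2) ∧
      BlockReaches A (simProgram N x) r (memAt (labelCode (some (.trans q s a 0))) W X u)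
        (memAt (labelCode (some (.trans q s a i))) W' X' u) ∧
      Interleaved g' h' ((k + 1 : ℕ) * z' + (i : ℕ)) (partialTapes tapes s a i) W' X' ∧
      (∀ j, (h' j).natAbs ≤ m + 1) ∧ (∀ j : Fin (k + 1), (i : ℕ) ≤ j → h' j = h j) ∧
      z'.natAbs ≤ m + 1 := by
  induction i using Fin.induction with
  | zero =>
    refine ⟨0, g, h, z, W, X, Nat.zero_le _, .refl _, ?_, fun j => (hh j).trans (by omega),
      fun _ _ => rfl, hz⟩
    simpa [partialTapes_zero] using H
  | succ i ih =>
    obtain ⟨r, g', h', z', W', X', hr, h1, H', hh', hsame, hz'⟩ := ih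
    have hi : h' i = h i := hsame i le_rfl
    have hhi := hh i
    obtain ⟨W₁, X₁, h2, H₁⟩ := blockReaches_seek (A := A) (N := N) (x := x) (q := q) (s := s)
      (a := a) (u := u) _ (z' := h' i) rfl H'
    simp only [Fin.val_castSucc] at H₁ hr
    obtain ⟨hX, hW⟩ := H₁.slot (h' i) i
    have hW' : W₁.head = s i := by rw [hW rfl, partialTapes_self, hs]
    have H₂ := H₁.slotOps i (a.symbol s i) (a.dir i)
    rw [partialTapes_self, ← partialTapes_succ, add_assoc, ← Nat.cast_succ, ← Fin.val_succ] at H₂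
    have h3 := blockReaches_edge (A := A) (N := N) (x := x) (W := W₁) (X := X₁) (u := u)
      (Or.inl (.slot q s a i)) (by rw [run_slotOps, if_pos ⟨hX.2 rfl, hW'⟩])
    refine ⟨_, _, _, h' i + dirShift (a.dir i), _, _, ?_, (h1.trans h2).trans h3, H₂, ?_, ?_,
      ?_⟩
    · rw [Fin.val_succ, add_mul, one_mul]
      omega
    · intro j
      by_cases hj : j = i
      · subst hj
        rw [Function.update_self]
        exact abs_add_dirShift_le (by omega) _
      · rw [Function.update_of_ne hj]
        exact hh' j
    · intro j hj
      rw [Fin.val_succ] at hj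
      rw [Function.update_of_ne (by rintro rfl; omega)]
      exact hsame j (by simp only [Fin.val_castSucc]; omega)
    · exact abs_add_dirShift_le (by omega) _

/-- The number of blocks that simulate one step is bounded by this, when the heads are at most
`m` cells away from their initial positions. -/
def stepCost (k m : ℕ) : ℕ := 2 + (k + 1) * (2 * m + 2)

theorem stepCost_mono (k : ℕ) {m m' : ℕ} (h : m ≤ m') : stepCost k m ≤ stepCost k m' := by
  unfold stepCost; gcongr

/-- One block for `choose`, then all tapes. The spare unit in `r + 1` is for the edge that completes
the action. -/
theorem blockReaches_trans_last [Finite Q] {A : Oracle} {N : OracleTM Q k} {x : List Bool} {q : Q}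
    {c : Config Q k} {a : Action Q k} (ha : a ∈ N.δ q fun i => (c.tapes i).head)
    {g : Fin (k + 1) → ℤ → Option Bool} {h : Fin (k + 1) → ℤ} {z : ℤ} {W X : Tape (Option Bool)}
    {m : ℕ} (H : Interleaved g h ((k + 1 : ℕ) * z) c.tapes W X)
    (hh : ∀ i, (h i).natAbs ≤ m) (hz : z.natAbs ≤ m + 1) :
    ∃ r g' h' z' W' X', r + 1 ≤ stepCost k m ∧
      BlockReaches A (simProgram N x) r (memAt (labelCode (k := k) (some (.state q))) W X c.queryTape)
        (memAt (labelCode (some (.trans q (fun i => (c.tapes i).head) a (Fin.last _)))) W' X'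
          c.queryTape) ∧
      Interleaved g' h' ((k + 1 : ℕ) * z') (c.perform A a).tapes W' X' ∧
      (∀ j, (h' j).natAbs ≤ m + 1) ∧ z'.natAbs ≤ m + 1 + 1 := by
  obtain ⟨r, g', h', z', W', X', hr, h1, H', hh', -, hz'⟩ := blockReaches_trans_tapes (A := A)
    (N := N) (x := x) (q := q) (a := a) (u := c.queryTape) H (fun _ => rfl) hh hz (Fin.last _)
  have h0 := blockReaches_edge (A := A) (x := x) (W := W) (X := X) (u := c.queryTape)
    (Or.inl (.choose q _ a ha)) rfl
  refine ⟨1 + r, g', h', z' + 1, W', X', ?_, h0.trans h1, ?_, hh', by omega⟩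
  · simp only [Fin.val_last] at hr
    unfold stepCost
    omega
  · rw [perform_eq_of_partialTapes fun _ => rfl]
    exact H'.of_last

/-- A head is displaced by at most `n` in `n` steps, which bounds the cost of every step by
`stepCost k n`; the summand `1` is the prologue. -/
theorem exists_blockReaches_of_reaches [Finite Q] {A : Oracle} {N : OracleTM Q k} {x : List Bool}
    {n : ℕ} {c : Config Q k} (hc : N.Reaches A n (N.init x) c) {q : Q}
    (hq : c.status = Sum.inl q) :
    ∃ r g h z W X, r ≤ 1 + n * stepCost k n ∧
      BlockReaches A (simProgram N x) r startMem
        (memAt (labelCode (k := k) (some (.state q))) W X c.queryTape) ∧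
      Interleaved g h ((k + 1 : ℕ) * z) c.tapes W X ∧ (∀ j, (h j).natAbs ≤ n) ∧
      z.natAbs ≤ n + 1 := by
  generalize hc₀ : N.init x = c₀ at hc
  induction hc generalizing q with
  | refl c₀ =>
    subst hc₀
    cases hq
    obtain ⟨W, X, h1, H⟩ := run_prologueOps (A := A) (j := labelCode (k := k) (some (.state N.start))) N x
    refine ⟨1, _, _, 1, W, X, by omega, ?_, H, by simp, by simp⟩
    rw [← memAt_zero]
    exact blockReaches_edge (e := prologueEdge N x) (Or.inr rfl) h1
  | @tail n _ c c' hc hstep ih =>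
    obtain ⟨q₀, hq₀, a, ha, rfl⟩ := hstep
    obtain ⟨r, g, h, z, W, X, hr, h1, H, hh, hz⟩ := ih hq₀ hc₀
    obtain ⟨r', g', h', z', W', X', hr', h2, H', hh', hz'⟩ :=
      blockReaches_trans_last (A := A) (x := x) ha H hh hz
    refine ⟨r + r' + 1, g', h', z', W', X', ?_, (h1.trans h2).trans ?_, H', hh', hz'⟩
    · have := stepCost_mono k (Nat.le_succ n)
      calc r + r' + 1 ≤ 1 + n * stepCost k n + stepCost k n := by omega
        _ ≤ 1 + n * stepCost k (n + 1) + stepCost k (n + 1) := by gcongr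
        _ = 1 + (n + 1) * stepCost k (n + 1) := by ring
    · cases a with
      | halt b => simp [Config.perform] at hq
      | query y m =>
        simp only [Config.perform, Sum.inl.injEq] at hq
        by_cases hA : A c.queryTape = true
        · rw [if_pos hA] at hq
          subst hq
          exact blockReaches_edge (Or.inl (.yes q₀ _ y m)) (by rw [run_ask, if_pos hA]; rfl)
        · rw [if_neg hA] at hq
          subst hq
          exact blockReaches_edge (Or.inl (.no q₀ _ y m))
            (by rw [run_ask, if_pos (by simpa using hA)]; rfl)
      | act q' w d o =>
        cases hq
        exact blockReaches_edge (Or.inl (.act q₀ _ q w d o)) (run_outs _ _ _ _ _)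

theorem programAccepts_of_accepts [Finite Q] {A : Oracle} {N : OracleTM Q k} {x : List Bool}
    {S : ℕ} (hS : ∀ n c, N.Reaches A n (N.init x) c → n ≤ S) (h : N.Accepts A x) :
    ∃ r ≤ 1 + S * stepCost k S, ProgramAccepts A (simProgram N x) r := by
  obtain ⟨n, c, hc, hacc⟩ := h
  have hn := hS n c hc
  cases hc with
  | refl => simp [OracleTM.init] at hacc
  | @tail n _ c _ hc hstep =>
    obtain ⟨q, hq, a, ha, rfl⟩ := hstep
    cases a with
    | query y m => simp [Config.perform] at hacc
    | act q' w d o => simp [Config.perform] at hacc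
    | halt b =>
      simp only [Config.perform, Sum.inr.injEq] at hacc
      subst hacc
      obtain ⟨r, g, h, z, W, X, hr, h1, H, hh, hz⟩ := exists_blockReaches_of_reaches hc hq
      obtain ⟨r', g', h', z', W', X', hr', h2, H', hh', hz'⟩ :=
        blockReaches_trans_last (A := A) (x := x) ha H hh hz
      have h3 := blockReaches_edge (A := A) (x := x) (W := W') (X := X') (u := c.queryTape)
        (Or.inl (.accept (N := N) q fun i => (c.tapes i).head)) rfl
      have h4 := run_guardOps (A := A) (labelCode (some (Label.final (Q := Q) (k := k))))
        (labelCode (some (Label.final (Q := Q) (k := k))))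
        (labelCode (some (Label.final (Q := Q) (k := k)))) W' X' c.queryTape
      rw [if_pos rfl] at h4
      refine ⟨_, ?_, _, (h1.trans h2).trans h3, _, [], _,
        mem_simProgram.2 ⟨_, Or.inl .final, rfl⟩, h4⟩
      have := stepCost_mono k (show n ≤ S by omega)
      calc r + r' + 1 ≤ 1 + n * stepCost k n + stepCost k n := by omega
        _ ≤ 1 + n * stepCost k S + stepCost k S := by gcongr
        _ = 1 + (n + 1) * stepCost k S := by ring
        _ ≤ 1 + S * stepCost k S := by gcongr

/-! ### The reduction to the universal machine -/

/-- The input enters only through the prologue, the last block, and there letter by letter from its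
end. This form is simple enough to be printed by one explicit machine. -/
theorem exists_programText_simProgram [Finite Q] (N : OracleTM Q k) :
    ∃ (l r : List Bool) (g : Bool → List Bool), ∀ x,
      programText (simProgram N x) = l ++ x.reverse.flatMap g ++ r := by
  refine ⟨false :: encodeLetters (none :: (blockLetters (simBlocks N) ++
    (guardOps (labelCode (none : Option (Label Q k)))
      (labelCode (some (Label.state (k := k) N.start)))).map some)),
    encodeLetters ((markOps k).map some ++ [none]),
    fun b => encodeLetters ((loadOps k b).map some), fun x => ?_⟩
  have hload : ∀ y : List Bool, encodeLetters ((y.flatMap (loadOps k)).map some) =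
      y.flatMap fun b => encodeLetters ((loadOps k b).map some) := by
    intro y
    induction y with
    | nil => rfl
    | cons b y ih => rw [List.flatMap_cons, List.map_append, encodeLetters_append, ih]; rfl
  rw [← hload, List.cons_append, List.cons_append, ← encodeLetters_append, ← encodeLetters_append,
    programText, simProgram, blockLetters_append, blockLetters_cons]
  congr 2
  simp [blockLetters, Edge.block, prologueEdge, prologueOps]

theorem length_flatMap_le (g : Bool → List Bool) (x : List Bool) :
    (x.flatMap g).length ≤ x.length * ((g true).length + (g false).length) := by
  induction x with
  | nil => simp
  | cons b x ih =>
    rw [List.flatMap_cons, List.length_append, List.length_cons, add_mul, one_mul]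
    cases b <;> omega

theorem exists_reduction_to_universal [Finite Q] {A : Oracle} {N : OracleTM Q k}
    {p : Polynomial ℕ} (hp : N.RunsInTime A fun n => p.eval n) :
    ∃ (d : ℕ) (l r : List Bool) (g : Bool → List Bool), ∀ x,
      N.Accepts A x ↔ universal.Accepts A
        (List.replicate ((x.length + 1) ^ d) true ++ (l ++ x.reverse.flatMap g ++ r)) := by
  obtain ⟨l, r, g, htext⟩ := exists_programText_simProgram N
  -- The fuel needed: number of blocks plus one, times twice a bound on the length of the program
  -- text.
  let S : Polynomial ℕ := (1 + p * (2 + ((k : Polynomial ℕ) + 1) * (2 * p + 2)) + 1) *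
    (2 * ((l.length : Polynomial ℕ) + Polynomial.X * (((g true).length : Polynomial ℕ) +
      ((g false).length : Polynomial ℕ)) + (r.length : Polynomial ℕ)))
  obtain ⟨c, d, hcd⟩ := exists_poly_bound S
  -- Only pure powers of `x.length + 1` will be printed, so the coefficient `c` must be absorbed: by
  -- the additional exponent if `c ≤ x.length + 1`, and by the constant supply `c * c ^ d` of fuel
  -- otherwise.
  refine ⟨d + 1, List.replicate (c * c ^ d) true ++ l, r, g, fun x => ?_⟩
  have hlen : (programText (simProgram N x)).length ≤
      l.length + x.length * ((g true).length + (g false).length) + r.length := by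
    have := length_flatMap_le g x.reverse
    rw [List.length_reverse] at this
    rw [htext, List.length_append, List.length_append]
    omega
  rw [List.append_assoc (List.replicate _ true) l, List.append_assoc (List.replicate _ true),
    ← htext, ← List.append_assoc, ← List.replicate_add]
  constructor
  · intro h
    obtain ⟨r', hr', h'⟩ := programAccepts_of_accepts (hp x) h
    refine universal_complete h' ?_
    calc (r' + 1) * (2 * (programText (simProgram N x)).length) ≤ S.eval x.length := by
          simp only [S, Polynomial.eval_mul, Polynomial.eval_add, Polynomial.eval_one,
            Polynomial.eval_ofNat, Polynomial.eval_natCast, Polynomial.eval_X, Nat.cast_id]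
          unfold stepCost at hr'
          gcongr
      _ ≤ c * (x.length + 1) ^ d := hcd _
      _ ≤ _ := by
        rcases le_total c (x.length + 1) with h | h
        · calc c * (x.length + 1) ^ d ≤ (x.length + 1) * (x.length + 1) ^ d := by gcongr
            _ = (x.length + 1) ^ (d + 1) := by ring
            _ ≤ _ := Nat.le_add_right _ _
        · calc c * (x.length + 1) ^ d ≤ c * c ^ d := by gcongr
            _ ≤ _ := Nat.le_add_left _ _
  · intro h
    obtain ⟨r', h'⟩ := universal_sound h
    exact accepts_of_programAccepts h'

end Simulation

/-! ### Functions computed on the query tape -/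

/-- The machine computes the function `f` in time `p`, without asking queries: when it halts, the
value is on the query tape. -/
structure OracleTM.Computes {Q : Type} {k : ℕ} (F : OracleTM Q k) (f : List Bool → List Bool)
    (p : ℕ → ℕ) : Prop where
  det : F.Deterministic
  no_query : ∀ q s y n, Action.query y n ∉ F.δ q s
  out : ∀ (A : Oracle) x, ∃ n ≤ p x.length, ∃ c b, F.Reaches A n (F.init x) c ∧
    c.status = Sum.inr b ∧ c.queryTape = f x

/-- The tape on which `w` has been written from left to right. -/
def writtenTape (w : List Bool) : Tape (Option Bool) :=
  (Tape.move .right)^[w.length] (Tape.mk₁ (w.map some))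

theorem holds_writtenTape (w : List Bool) : Holds (writtenTape w) (listContent w) w.length := by
  simpa [dirShift, writtenTape] using (holds_mk₁ w).iterate_move .right w.length

theorem writtenTape_append (w : List Bool) (o : Option Bool) :
    actOn o (o.map fun _ => .right) (writtenTape w) = writtenTape (w ++ o.toList) := by
  have h := (holds_writtenTape w).actOn o (o.map fun _ => .right)
  cases o with
  | none =>
    rw [← listContent_length w, Function.update_eq_self, listContent_length] at h
    exact h.eq (by simpa [dirShift] using holds_writtenTape w)
  | some b =>
    rw [update_listContent] at h
    exact h.eq (by simpa [dirShift] using holds_writtenTape (w ++ [b]))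

/-- The states of the composition of two machines. -/
inductive CompState (Q Q' : Type) : Type where
  /-- The first machine runs. -/
  | fst (q : Q)
  /-- The head goes back to the beginning of the intermediate string. -/
  | back
  /-- The second machine runs. -/
  | snd (q : Q')

instance {Q Q' : Type} [Finite Q] [Finite Q'] : Finite (CompState Q Q') := by
  let f : CompState Q Q' → Q ⊕ Unit ⊕ Q' := fun l => match l with
    | .fst q => .inl q
    | .back => .inr (.inl ())
    | .snd q => .inr (.inr q)
  refine Finite.of_injective f ?_
  intro a b h
  cases a <;> cases b <;> simp_all [f]

section Comp

variable {Q Q' : Type} {k k' : ℕ}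

/-- The action of the composition when the first machine does `a`. -/
def fstAction (s : Fin (k + 1 + k' + 1) → Option Bool) :
    Action Q k → Action (CompState Q Q') (k + 1 + k')
  | .act q w d o =>
    .act (.fst q) (Fin.append (n := k' + 1) w fun j => if j = 0 then o else none)
      (Fin.append (n := k' + 1) d fun j => if j = 0 then o.map fun _ => .right else none) none
  | _ => .act .back s
      (Fin.append (n := k' + 1) (fun _ => none) fun j => if j = 0 then some .left else none) none

/-- The action of the composition when the second machine does `a`. -/
def sndAction (s : Fin (k + 1 + k' + 1) → Option Bool) :
    Action Q' k' → Action (CompState Q Q') (k + 1 + k')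
  | .halt b => .halt b
  | .query y n => .query (.snd y) (.snd n)
  | .act q w d o => .act (.snd q) (Fin.append (n := k' + 1) (fun i => s (Fin.castAdd (k' + 1) i)) w)
      (Fin.append (n := k' + 1) (fun _ => none) d) o

/-- The action of the composition when it goes back to the beginning of the intermediate string. -/
def backAction (q : Q') (s : Fin (k + 1 + k' + 1) → Option Bool) :
    Action (CompState Q Q') (k + 1 + k') :=
  if s (Fin.natAdd (k + 1) (0 : Fin (k' + 1))) = none then
    .act (.snd q) s
      (Fin.append (n := k' + 1) (fun _ => none) fun j => if j = 0 then some .right else none) none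
  else
    .act .back s
      (Fin.append (n := k' + 1) (fun _ => none) fun j => if j = 0 then some .left else none) none

/-- The composition of two machines. -/
def OracleTM.comp (F : OracleTM Q k) (M : OracleTM Q' k') :
    OracleTM (CompState Q Q') (k + 1 + k') where
  start := .fst F.start
  δ q s := match q with
    | .fst q => fstAction s '' F.δ q fun i => s (Fin.castAdd (k' + 1) i)
    | .back => {backAction M.start s}
    | .snd q => sndAction s '' M.δ q fun j => s (Fin.natAdd (k + 1) j)

theorem existsUnique_mem_image {α β : Type*} {S : Set α} (h : ∃! a, a ∈ S) (f : α → β) :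
    ∃! b, b ∈ f '' S := by
  obtain ⟨a, ha, hu⟩ := h
  refine ⟨f a, ⟨a, ha, rfl⟩, ?_⟩
  rintro _ ⟨b, hb, rfl⟩
  rw [hu b hb]

theorem OracleTM.Deterministic.comp {F : OracleTM Q k} {M : OracleTM Q' k'}
    (hF : F.Deterministic) (hM : M.Deterministic) : (F.comp M).Deterministic := by
  intro q s
  cases q with
  | fst q => exact existsUnique_mem_image (hF q _) _
  | back => exact ⟨_, rfl, fun _ h => h⟩
  | snd q => exact existsUnique_mem_image (hM q _) _

/-- The configuration of the composition with given tapes of the two machines. -/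
def compConfig (st : CompState Q Q' ⊕ Bool) (T : Fin (k + 1) → Tape (Option Bool))
    (T' : Fin (k' + 1) → Tape (Option Bool)) (u : List Bool) :
    Config (CompState Q Q') (k + 1 + k') :=
  ⟨st, Fin.append (n := k' + 1) T T', u⟩

theorem append_ext {α : Type*} {m n : ℕ} {f g : Fin (m + n) → α}
    (h1 : ∀ i, f (Fin.castAdd n i) = g (Fin.castAdd n i))
    (h2 : ∀ j, f (Fin.natAdd m j) = g (Fin.natAdd m j)) : f = g := by
  funext i
  refine Fin.addCases (motive := fun i => f i = g i) h1 h2 i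

/-- The tapes of the second machine, when `T` is on its first tape. -/
def inputTapes (T : Tape (Option Bool)) (j : Fin (k' + 1)) : Tape (Option Bool) :=
  if j = 0 then T else Tape.mk₁ []

theorem mk₁_nil_head : (Tape.mk₁ ([] : List (Option Bool))).head = none := holds_mk₁_nil.head

theorem actOn_none_mk₁_nil : actOn none none (Tape.mk₁ []) = Tape.mk₁ [] := by
  rw [← mk₁_nil_head]; exact actOn_head_none _

theorem perform_fst_act {A : Oracle} {st : CompState Q Q' ⊕ Bool}
    {T : Fin (k + 1) → Tape (Option Bool)} {w : List Bool} {q : Q}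
    {s : Fin (k + 1 + k' + 1) → Option Bool} {v : Fin (k + 1) → Option Bool}
    {d : Fin (k + 1) → Option Dir} {o : Option Bool} :
    (compConfig (k' := k') st T (inputTapes (writtenTape w)) []).perform A
      (fstAction s (.act q v d o)) =
      compConfig (.inl (.fst q)) (fun i => actOn (v i) (d i) (T i))
        (inputTapes (writtenTape (w ++ o.toList))) [] := by
  rw [fstAction, perform_act]
  simp only [compConfig, Option.toList_none, List.append_nil, Config.mk.injEq, true_and, and_true]
  refine append_ext (n := k' + 1) (fun i => ?_) fun j => ?_
  · simp only [Fin.append_left]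
  · simp only [Fin.append_right, inputTapes]
    split_ifs with hj
    · exact writtenTape_append w o
    · exact actOn_none_mk₁_nil

theorem perform_move_first {A : Oracle} {st : CompState Q Q' ⊕ Bool}
    {T : Fin (k + 1) → Tape (Option Bool)} {T' : Tape (Option Bool)} {q : CompState Q Q'} (d : Dir)
    {c : Config (CompState Q Q') (k + 1 + k')} (hc : c = compConfig st T (inputTapes T') []) :
    c.perform A (.act q (fun i => (c.tapes i).head)
      (Fin.append (n := k' + 1) (fun _ => none) fun j => if j = 0 then some d else none) none) =
      compConfig (.inl q) T (inputTapes (T'.move d)) [] := by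
  subst hc
  rw [perform_act]
  simp only [compConfig, Option.toList_none, List.append_nil, Config.mk.injEq, true_and, and_true]
  refine append_ext (n := k' + 1) (fun i => ?_) fun j => ?_
  · simp only [Fin.append_left, actOn_head_none]
  · simp only [Fin.append_right, inputTapes]
    split_ifs with hj
    · exact actOn_head _ _
    · exact actOn_head_none _

/-- Output of `F` is diverted from the query tape to the first tape of `M`. The query tape thus
stays empty, as `M` expects at its start. -/
theorem comp_reaches_fst {A : Oracle} {F : OracleTM Q k} {M : OracleTM Q' k'}
    (hF : ∀ q s y n, Action.query y n ∉ F.δ q s) {x : List Bool} {n : ℕ} {c : Config Q k}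
    (h : F.Reaches A n (F.init x) c) {q : Q} (hq : c.status = Sum.inl q) :
    (F.comp M).Reaches A n ((F.comp M).init x)
      (compConfig (.inl (.fst q)) c.tapes (inputTapes (writtenTape c.queryTape)) []) := by
  generalize hc₀ : F.init x = c₀ at h
  induction h generalizing q with
  | refl c₀ =>
    subst hc₀
    cases hq
    convert OracleTM.Reaches.refl _
    simp only [OracleTM.init, compConfig, Config.mk.injEq, and_true]
    refine ⟨rfl, append_ext (n := k' + 1) (fun i => ?_) fun j => ?_⟩
    · simp only [Fin.append_left]
      have : Fin.castAdd (k' + 1) i = (0 : Fin (k + 1 + k' + 1)) ↔ i = 0 := by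
        constructor
        · intro h
          have h' : (i : ℕ) = 0 := congrArg Fin.val h
          exact Fin.ext h'
        · rintro rfl
          rfl
      simp only [this]
    · have : ¬ Fin.natAdd (k + 1) j = (0 : Fin (k + 1 + k' + 1)) := by
        intro h
        have := congrArg Fin.val h
        simp at this
      simp only [Fin.append_right, inputTapes, writtenTape]
      rw [if_neg this]
      split_ifs <;> rfl
  | tail h hs ih =>
    obtain ⟨q₀, hq₀, a, ha, rfl⟩ := hs
    refine (ih hq₀ hc₀).tail ⟨_, rfl, _, ⟨a, ?_, rfl⟩, ?_⟩
    · simpa only [compConfig, Fin.append_left] using ha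
    · cases a with
      | halt b => simp [Config.perform] at hq
      | query y m => exact absurd ha (hF _ _ _ _)
      | act q' v d o =>
        rw [perform_fst_act]
        rw [perform_act] at hq ⊢
        cases hq
        rfl

theorem comp_step_back {A : Oracle} {F : OracleTM Q k} {M : OracleTM Q' k'}
    {T : Fin (k + 1) → Tape (Option Bool)} {T' : Tape (Option Bool)} :
    (F.comp M).Step A (compConfig (.inl .back) T (inputTapes T') [])
      (if T'.head = none then compConfig (.inl (.snd M.start)) T (inputTapes (T'.move .right)) []
        else compConfig (.inl .back) T (inputTapes (T'.move .left)) []) := by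
  refine ⟨.back, rfl, _, rfl, ?_⟩
  have hhead : ((compConfig (Q := Q) (Q' := Q') (.inl .back) T (inputTapes (k' := k') T')
      []).tapes (Fin.natAdd (k + 1) (0 : Fin (k' + 1)))).head = T'.head := by
    simp only [compConfig, Fin.append_right, inputTapes, if_true]
  rw [backAction, hhead]
  split_ifs
  · exact (perform_move_first .right rfl).symm
  · exact (perform_move_first .left rfl).symm

/-- From `n - 1` there are `n` moves to the blank at `-1`; one more step turns round and starts `M`.
-/
theorem comp_reaches_back {A : Oracle} {F : OracleTM Q k} {M : OracleTM Q' k'}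
    {T : Fin (k + 1) → Tape (Option Bool)} {w : List Bool} (n : ℕ) {T' : Tape (Option Bool)}
    (hn : n ≤ w.length) (hT' : Holds T' (listContent w) (n - 1)) :
    (F.comp M).Reaches A (n + 1) (compConfig (.inl .back) T (inputTapes T') [])
      (compConfig (.inl (.snd M.start)) T (inputTapes (Tape.mk₁ (w.map some))) []) := by
  induction n generalizing T' with
  | zero =>
    have hstep := comp_step_back (A := A) (F := F) (M := M) (T := T) (T' := T')
    rw [if_pos (by rw [hT'.head, listContent_neg _ (by simp)])] at hstep
    have : T'.move .right = Tape.mk₁ (w.map some) := by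
      have h := hT'.move .right
      simp only [dirShift, CharP.cast_eq_zero, zero_sub, neg_add_cancel] at h
      exact h.eq (holds_mk₁ w)
    rw [this] at hstep
    exact .one hstep
  | succ n ih =>
    have hstep := comp_step_back (A := A) (F := F) (M := M) (T := T) (T' := T')
    have hhead : T'.head ≠ none := by
      rw [hT'.head]
      simp only [listContent, Nat.cast_succ, add_sub_cancel_right, Nat.cast_nonneg, if_true,
        Int.toNat_natCast]
      simp
      omega
    rw [if_neg hhead] at hstep
    refine .head hstep (ih (by omega) ?_)
    have h := hT'.move .left
    simpa [dirShift, sub_eq_add_neg] using h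

/-- The configuration of the composition when the second machine runs. -/
def sndConfig (T : Fin (k + 1) → Tape (Option Bool)) (c : Config Q' k') :
    Config (CompState Q Q') (k + 1 + k') :=
  compConfig (c.status.map .snd id) T c.tapes c.queryTape

theorem perform_snd {A : Oracle} {T : Fin (k + 1) → Tape (Option Bool)} {c : Config Q' k'}
    {a : Action Q' k'} :
    (sndConfig (Q := Q) T c).perform A
      (sndAction (fun i => ((sndConfig (Q := Q) T c).tapes i).head) a) =
      sndConfig T (c.perform A a) := by
  cases a with
  | halt b => rfl
  | query y n =>
    by_cases h : A c.queryTape <;> simp [Config.perform, sndConfig, compConfig, sndAction, h]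
  | act q v d o =>
    rw [sndAction, perform_act, perform_act]
    simp only [sndConfig, compConfig, Sum.map_inl, Config.mk.injEq, true_and, and_true]
    refine append_ext (n := k' + 1) (fun i => ?_) fun j => ?_
    · simp only [Fin.append_left, actOn_head_none]
    · simp only [Fin.append_right]

theorem comp_step_snd_iff {A : Oracle} {F : OracleTM Q k} {M : OracleTM Q' k'}
    {T : Fin (k + 1) → Tape (Option Bool)} (c : Config Q' k')
    (d : Config (CompState Q Q') (k + 1 + k')) :
    (F.comp M).Step A (sndConfig T c) d ↔ ∃ c', M.Step A c c' ∧ d = sndConfig T c' := by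
  have hheads : (fun j => ((sndConfig (Q := Q) T c).tapes (Fin.natAdd (k + 1) j)).head) =
      fun j => (c.tapes j).head := by
    funext j
    simp only [sndConfig, compConfig, Fin.append_right]
  constructor
  · rintro ⟨q, hq, a, ha, rfl⟩
    cases hst : c.status with
    | inr b => simp [sndConfig, compConfig, hst] at hq
    | inl q' =>
      simp only [sndConfig, compConfig, hst, Sum.map_inl, Sum.inl.injEq] at hq
      subst hq
      obtain ⟨a, ha, rfl⟩ := ha
      rw [hheads] at ha
      exact ⟨_, ⟨q', hst, a, ha, rfl⟩, perform_snd⟩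
  · rintro ⟨_, ⟨q, hq, a, ha, rfl⟩, rfl⟩
    refine ⟨.snd q, by simp [sndConfig, compConfig, hq], _, ⟨a, ?_, rfl⟩, perform_snd.symm⟩
    rw [hheads]
    exact ha

theorem eval_mono (p : Polynomial ℕ) {m n : ℕ} (h : m ≤ n) : p.eval m ≤ p.eval n := by
  rw [Polynomial.eval_eq_sum, Polynomial.eval_eq_sum]
  exact Finset.sum_le_sum fun i _ => Nat.mul_le_mul_left _ (Nat.pow_le_pow_left h i)

/-- Run `F`, rewind, run `M`. Since `F` prints at most one bit per step, `f x` has length at most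
`p`, so `M` needs at most `p'.comp p` steps; polynomials over `ℕ` are monotone. -/
theorem preimage_mem_P [Finite Q] {A : Oracle} {F : OracleTM Q k} {f : List Bool → List Bool}
    {p : Polynomial ℕ} (hF : F.Computes f fun n => p.eval n) {L L' : Language Bool}
    (hL : L ∈ P A) (hL' : ∀ x, x ∈ L' ↔ f x ∈ L) : L' ∈ P A := by
  obtain ⟨Q', _, k', M, hM, ⟨p', hp'⟩, hML⟩ := hL
  have hdet : (F.comp M).Deterministic := hF.det.comp hM
  have key : ∀ x, (f x).length ≤ p.eval x.length ∧ ∃ n ≤ p.eval x.length + (p.eval x.length + 1),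
      ∃ T, (F.comp M).Reaches A n ((F.comp M).init x) (sndConfig T (M.init (f x))) := by
    intro x
    obtain ⟨n, hn, c, b, hc, hb, hout⟩ := hF.out A x
    have hlen : (f x).length ≤ p.eval x.length := by
      have := hc.queryTape_length_le
      rw [hout] at this
      simp only [OracleTM.init, List.length_nil, zero_add] at this
      exact this.trans hn
    refine ⟨hlen, n + ((f x).length + 1), by omega, c.tapes, ?_⟩
    have hsnd : sndConfig c.tapes (M.init (f x)) = compConfig (Q := Q) (.inl (.snd M.start)) c.tapes
        (inputTapes (Tape.mk₁ ((f x).map some))) [] := by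
      simp only [sndConfig, compConfig, OracleTM.init, Sum.map_inl, Config.mk.injEq, true_and,
        and_true]
      congr 1
      funext j
      simp only [inputTapes]
      split_ifs <;> rfl
    rw [hsnd]
    cases hc with
    | refl => simp [OracleTM.init] at hb
    | @tail n _ c _ hc hs =>
      obtain ⟨q, hq, a, ha, rfl⟩ := hs
      cases a with
      | query y m => exact absurd ha (hF.no_query _ _ _ _)
      | act q' v d o => simp [Config.perform] at hb
      | halt b' =>
        have hout' : c.queryTape = f x := hout
        have h1 := comp_reaches_fst (M := M) hF.no_query hc hq
        rw [hout'] at h1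
        refine (h1.tail ⟨_, rfl, _, ⟨.halt b', ?_, rfl⟩, (perform_move_first .left rfl).symm⟩).trans
          (comp_reaches_back _ le_rfl ?_)
        · simpa only [compConfig, Fin.append_left] using ha
        · simpa [dirShift, sub_eq_add_neg] using (holds_writtenTape (f x)).move .left
  refine ⟨CompState Q Q', inferInstance, _, F.comp M, hdet,
    ⟨p + (p + 1) + p'.comp p, fun x n c hc => ?_⟩, fun x => ?_⟩
  · obtain ⟨hlen, m, hm, T, hT⟩ := key x
    have hmono : p'.eval (f x).length ≤ p'.eval (p.eval x.length) :=
      eval_mono p' hlen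
    simp only [Polynomial.eval_add, Polynomial.eval_one, Polynomial.eval_comp]
    -- By determinism a computation of at least `m` steps passes through the configuration in which
    -- `M` takes over, and the rest is a computation of `M`.
    rcases le_total n m with h | h
    · omega
    · obtain ⟨r, rfl⟩ := Nat.exists_eq_add_of_le h
      obtain ⟨d, hd, hr⟩ := hc.split
      obtain rfl := hdet.reaches_unique hT hd
      obtain ⟨c', hc', -⟩ := (OracleTM.reaches_map_iff comp_step_snd_iff).1 hr
      have := hp' _ _ _ hc'
      dsimp only at this
      omega
  · obtain ⟨-, m, -, T, hT⟩ := key x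
    rw [hL', hML]
    constructor
    · rintro ⟨n, c, hc, hst⟩
      refine ⟨m + n, sndConfig T c,
        hT.trans ((OracleTM.reaches_map_iff comp_step_snd_iff).2 ⟨c, hc, rfl⟩), ?_⟩
      simp [sndConfig, compConfig, hst]
    · rintro ⟨n, c, hc, hst⟩
      obtain ⟨n', c', b, -, hc', hb⟩ := hM.exists_halted (hp' (f x))
      have h' := hT.trans ((OracleTM.reaches_map_iff comp_step_snd_iff).2 ⟨c', hc', rfl⟩)
      have : b = true := hdet.halted_unique (b := b) h' (by simp [sndConfig, compConfig, hb]) hc hst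
      subst this
      exact ⟨n', c', hc', hb⟩

end Comp

/-! ### Odometers -/

/-- The value of the digits `r`, in base `n + 1`. -/
def odoValue (n : ℕ) {d : ℕ} (r : Fin d → ℕ) : ℕ := ∑ i, r i * (n + 1) ^ (i : ℕ)

/-- Count down by one. -/
def odoNext (n : ℕ) {d : ℕ} (r : Fin d → ℕ) (i : Fin d) : ℕ :=
  if ∀ j < i, r j = 0 then (if r i = 0 then n else r i - 1) else r i

theorem odoValue_succ (n : ℕ) {d : ℕ} (r : Fin (d + 1) → ℕ) :
    odoValue n r = r 0 + (n + 1) * odoValue n (fun i => r i.succ) := by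
  rw [odoValue, Fin.sum_univ_succ, odoValue, Finset.mul_sum]
  simp only [Fin.val_zero, pow_zero, mul_one, Fin.val_succ, pow_succ]
  congr 1
  exact Finset.sum_congr rfl fun i _ => by ring

theorem odoValue_const (n d : ℕ) : odoValue n (fun _ : Fin d => n) + 1 = (n + 1) ^ d := by
  induction d with
  | zero => simp [odoValue]
  | succ d ih =>
    rw [odoValue_succ, pow_succ, ← ih]
    ring

theorem odoValue_eq_zero {n d : ℕ} {r : Fin d → ℕ} (h : ∀ i, r i = 0) : odoValue n r = 0 := by
  simp [odoValue, h]

/-- Subtraction with borrowing: a zero lowest digit becomes `n`, and the number formed by the other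
digits decreases by one. -/
theorem odoValue_next {n d : ℕ} {r : Fin d → ℕ} (h : ¬ ∀ i, r i = 0) :
    odoValue n (odoNext n r) + 1 = odoValue n r := by
  induction d with
  | zero => exact absurd (fun i => i.elim0) h
  | succ d ih =>
    rw [odoValue_succ, odoValue_succ]
    by_cases h0 : r 0 = 0
    · have h' : ¬ ∀ i : Fin d, r i.succ = 0 := by
        intro h'
        exact h (Fin.cases h0 h')
      have h1 : (fun i : Fin d => odoNext n r i.succ) = odoNext n fun i => r i.succ := by
        funext i
        have : (∀ j < i.succ, r j = 0) ↔ ∀ j < i, r j.succ = 0 := by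
          constructor
          · intro h j hj
            exact h _ (Fin.succ_lt_succ_iff.2 hj)
          · intro h j hj
            cases j using Fin.cases with
            | zero => exact h0
            | succ j => exact h j (Fin.succ_lt_succ_iff.1 hj)
        simp only [odoNext, this]
      rw [h1, ← ih h']
      simp [odoNext, h0]
      ring
    · have h1 : (fun i : Fin d => odoNext n r i.succ) = fun i => r i.succ := by
        funext i
        rw [odoNext, if_neg]
        intro h
        exact h0 (h 0 (Fin.succ_pos i))
      have h2 : odoNext n r 0 = r 0 - 1 := by simp [odoNext, h0]
      rw [h1, h2]
      omega

theorem odoNext_le {n d : ℕ} {r : Fin d → ℕ} (h : ∀ i, r i ≤ n) (i : Fin d) :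
    odoNext n r i ≤ n := by
  have := h i
  unfold odoNext
  split_ifs <;> omega

/-- The position of the head for the digit `r`, when the head moves to the left, or to the right. -/
def odoPos (n : ℕ) (v : Bool) (r : ℕ) : ℤ := if v then r - 1 else n - r

/-- In either direction of travel the digit counts the cells of the input still ahead, the scanned
one included, so the head has just left the input exactly at digit zero. -/
theorem listContent_odoPos {x : List Bool} {v : Bool} {r : ℕ} (hr : r ≤ x.length) :
    listContent x (odoPos x.length v r) = none ↔ r = 0 := by
  unfold odoPos listContent
  cases v
  · simp only [Bool.false_eq_true, if_false]
    rw [if_pos (by omega), List.getElem?_eq_none_iff]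
    omega
  · simp only [if_true]
    split_ifs with h
    · rw [List.getElem?_eq_none_iff]
      omega
    · simp
      omega

/-! ### Padding -/

/-- The states of the padding machine. -/
inductive PadState (d N : ℕ) : Type where
  /-- The input is copied to all tapes. -/
  | copy
  /-- The odometer runs; the digits whose heads move to the left have the value `true`. -/
  | odo (v : Fin d → Bool)
  /-- A string is printed, then the scan of the input goes on. -/
  | emit (l : {l : List Bool // l.length ≤ N + 1})
  /-- A string is printed, then the machine halts. -/
  | last (l : {l : List Bool // l.length ≤ N + 1})

instance {d N : ℕ} : Finite (PadState d N) := by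
  let f : PadState d N → Unit ⊕ (Fin d → Bool) ⊕ {l : List Bool // l.length ≤ N + 1} ⊕
      {l : List Bool // l.length ≤ N + 1} := fun q => match q with
    | .copy => .inl ()
    | .odo v => .inr (.inl v)
    | .emit l => .inr (.inr (.inl l))
    | .last l => .inr (.inr (.inr l))
  refine Finite.of_injective f ?_
  intro a b h
  cases a <;> cases b <;> simp_all [f]

section Pad

variable {d N : ℕ} (l r : {l : List Bool // l.length ≤ N + 1})
  (g : Bool → {l : List Bool // l.length ≤ N + 1})

/-- The directions of the heads of the odometer after one step. -/
def odoDirs (v : Fin d → Bool) (s : Fin (d + 1) → Option Bool) (i : Fin d) : Bool :=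
  if (∀ j < i, s j.succ = none) ∧ s i.succ = none then !v i else v i

/-- The moves of the heads of the odometer. -/
def odoMoves (v : Fin d → Bool) (s : Fin (d + 1) → Option Bool) : Fin (d + 1) → Option Dir :=
  Fin.cons none fun i => if ∀ j < i, s j.succ = none then
    some (if odoDirs v s i then .left else .right) else none

/-- The transition function of the padding machine. -/
def padStep (q : PadState d N) (s : Fin (d + 1) → Option Bool) : Action (PadState d N) d :=
  match q with
  | .copy => match s 0 with
    | some b => .act .copy (fun _ => some b) (fun _ => some .right) none
    | none => .act (.odo fun _ => true) s (fun _ => some .left) none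
  | .odo v => if ∀ i : Fin d, s i.succ = none then .act (.emit l) s (fun _ => none) none
      else .act (.odo (odoDirs v s)) s (odoMoves v s) (some true)
  | .emit ⟨a :: l, h⟩ =>
    .act (.emit ⟨l, (Nat.le_succ _).trans h⟩) s (fun _ => none) (some a)
  | .emit ⟨[], _⟩ => match s 0 with
    | some b => .act (.emit (g b)) s (fun _ => some .left) none
    | none => .act (.last r) s (fun _ => none) none
  | .last ⟨a :: l, h⟩ =>
    .act (.last ⟨l, (Nat.le_succ _).trans h⟩) s (fun _ => none) (some a)
  | .last ⟨[], _⟩ => .halt true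

/-- The machine that prints a padding, followed by a simple translation of the reversed input. -/
def padder : OracleTM (PadState d N) d where
  start := .copy
  δ q s := {padStep l r g q s}

theorem padder_deterministic : (padder (d := d) l r g).Deterministic :=
  fun _ _ => ⟨_, rfl, fun _ h => h⟩

theorem padder_no_query (q : PadState d N) (s : Fin (d + 1) → Option Bool) (y n : PadState d N) :
    Action.query y n ∉ (padder l r g).δ q s := by
  intro h
  have h : Action.query y n = padStep l r g q s := h
  unfold padStep at h
  split at h
  · split at h <;> cases h
  · split_ifs at h
  · cases h
  · split at h <;> cases h
  · cases h
  · cases h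

variable {l r g} {A : Oracle} {c : Config (PadState d N) d} {x u : List Bool}

theorem padder_step {q q' : PadState d N} {w : Fin (d + 1) → Option Bool}
    {δ : Fin (d + 1) → Option Dir} {o : Option Bool} (hq : c.status = Sum.inl q)
    (ha : padStep l r g q (fun i => (c.tapes i).head) = .act q' w δ o) :
    ∃ c', (padder l r g).Step A c c' ∧ c'.status = Sum.inl q' ∧
      c'.queryTape = c.queryTape ++ o.toList ∧ ∀ i, c'.tapes i = actOn (w i) (δ i) (c.tapes i) := by
  refine ⟨c.perform A (.act q' w δ o), ⟨q, hq, _, ha.symm, rfl⟩, ?_⟩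
  rw [perform_act]
  exact ⟨rfl, rfl, fun _ => rfl⟩

theorem padder_copy {y z : List Bool} (hx : y ++ z = x) (hq : c.status = Sum.inl .copy)
    (h0 : Holds (c.tapes 0) (listContent x) y.length)
    (hi : ∀ i : Fin d, Holds (c.tapes i.succ) (listContent y) y.length) :
    ∃ c', (padder l r g).Reaches A (z.length + 1) c c' ∧
      c'.status = Sum.inl (.odo fun _ => true) ∧ c'.queryTape = c.queryTape ∧
      ∀ i, Holds (c'.tapes i) (listContent x) (x.length - 1) := by
  induction z generalizing y c with
  | nil =>
    obtain rfl : y = x := by simpa using hx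
    have hall : ∀ i, Holds (c.tapes i) (listContent y) y.length := Fin.cases h0 hi
    have hhead : (c.tapes 0).head = none := by rw [h0.head, listContent_length]
    obtain ⟨c', hs, hq', hu, ht⟩ := padder_step (l := l) (r := r) (g := g) (A := A) hq
      (by simp only [padStep, hhead]; rfl)
    refine ⟨c', .one hs, hq', by simpa using hu, fun i => ?_⟩
    rw [ht]
    simpa [dirShift, sub_eq_add_neg] using (hall i).actOn_self (hall i).head (some .left)
  | cons b z ih =>
    have hhead : (c.tapes 0).head = some b := by
      rw [h0.head, ← hx, listContent_append_length]
    obtain ⟨c₁, hs, hq', hu, ht⟩ := padder_step (l := l) (r := r) (g := g) (A := A) hq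
      (by simp only [padStep, hhead]; rfl)
    obtain ⟨c', h1, h2, h3, h4⟩ := ih (y := y ++ [b]) (by simpa using hx) hq'
      (by
        rw [ht]
        simpa [dirShift] using
          h0.actOn_self (s := some b) (by rw [← h0.head, hhead]) (some .right))
      (fun i => by
        have := (hi i).actOn (some b) (some .right)
        rw [update_listContent] at this
        rw [ht]
        simpa [dirShift] using this)
    exact ⟨c', .head hs h1, h2, by rw [h3, hu]; simp, h4⟩

/-- Resetting a digit from `0` to `n` needs no rewinding: the head is just beyond one end, reverses
its direction, and its first step back is the position of the digit `n`. So each decrement is one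
step of the machine. -/
theorem odoPos_next {n : ℕ} {v : Fin d → Bool} {s : Fin (d + 1) → Option Bool} {ρ : Fin d → ℕ}
    (hs : ∀ i : Fin d, s i.succ = none ↔ ρ i = 0) (i : Fin d) :
    odoPos n (v i) (ρ i) + dirShift (odoMoves v s i.succ) =
      odoPos n (odoDirs v s i) (odoNext n ρ i) := by
  have hmoves : odoMoves v s i.succ = if ∀ j < i, s j.succ = none then
    some (if odoDirs v s i then .left else .right) else none := rfl
  by_cases h1 : ∀ j < i, ρ j = 0
  · have h1' : ∀ j < i, s j.succ = none := fun j hj => (hs j).2 (h1 j hj)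
    rw [hmoves, if_pos h1', odoNext, if_pos h1]
    by_cases h2 : ρ i = 0
    · have e : odoDirs v s i = !v i := if_pos ⟨h1', (hs i).2 h2⟩
      rw [e, if_pos h2, h2]
      cases v i <;> simp [odoPos, dirShift, sub_eq_add_neg]
    · have e : odoDirs v s i = v i := if_neg fun h => h2 ((hs i).1 h.2)
      rw [e, if_neg h2]
      cases v i <;> simp [odoPos, dirShift] <;> omega
  · have h1' : ¬ ∀ j < i, s j.succ = none := fun h => h1 fun j hj => (hs j).1 (h j hj)
    have e : odoDirs v s i = v i := if_neg fun h => h1' h.1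
    rw [hmoves, if_neg h1', odoNext, if_neg h1, e]
    simp [dirShift]

theorem padder_odo (m : ℕ) {v : Fin d → Bool} {ρ : Fin d → ℕ} (hm : odoValue x.length ρ = m)
    (hρ : ∀ i, ρ i ≤ x.length) (hq : c.status = Sum.inl (.odo v))
    (h0 : Holds (c.tapes 0) (listContent x) (x.length - 1))
    (hi : ∀ i : Fin d, Holds (c.tapes i.succ) (listContent x) (odoPos x.length (v i) (ρ i))) :
    ∃ c', (padder l r g).Reaches A (m + 1) c c' ∧ c'.status = Sum.inl (.emit l) ∧
      c'.queryTape = c.queryTape ++ List.replicate m true ∧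
      Holds (c'.tapes 0) (listContent x) (x.length - 1) := by
  induction m generalizing v ρ c with
  | zero =>
    have hhead : ∀ i : Fin d, (c.tapes i.succ).head = none ↔ ρ i = 0 := fun i => by
      rw [(hi i).head, listContent_odoPos (hρ i)]
    have hall : ∀ i : Fin d, (c.tapes i.succ).head = none := by
      simp only [hhead]
      by_contra h
      have := odoValue_next (n := x.length) h
      omega
    obtain ⟨c', hs, hq', hu, ht⟩ := padder_step (l := l) (r := r) (g := g) (A := A) hq
      (if_pos hall)
    refine ⟨c', .one hs, hq', by simpa using hu, ?_⟩
    rw [ht]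
    simpa [dirShift] using h0.actOn_self h0.head none
  | succ m ih =>
    have hhead : ∀ i : Fin d, (c.tapes i.succ).head = none ↔ ρ i = 0 := fun i => by
      rw [(hi i).head, listContent_odoPos (hρ i)]
    have hall : ¬ ∀ i : Fin d, ρ i = 0 := fun h => by
      rw [odoValue_eq_zero h] at hm
      omega
    have hall' : ¬ ∀ i : Fin d, (c.tapes i.succ).head = none := by simpa only [hhead] using hall
    obtain ⟨c₁, hs, hq', hu, ht⟩ := padder_step (l := l) (r := r) (g := g) (A := A) hq
      (if_neg hall')
    obtain ⟨c', h1, h2, h3, h4⟩ := ih (ρ := odoNext x.length ρ)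
      (by have := odoValue_next (n := x.length) hall; omega) (odoNext_le hρ) hq'
      (by
        rw [ht]
        simpa [odoMoves, dirShift] using h0.actOn_self h0.head none)
      (fun i => by
        rw [ht, ← odoPos_next hhead]
        exact (hi i).actOn_self (hi i).head _)
    refine ⟨c', .head hs h1, h2, ?_, h4⟩
    rw [h3, hu]
    simp [List.replicate_succ]

theorem padder_emit {w : List Bool} {hw : w.length ≤ N + 1}
    (hq : c.status = Sum.inl (.emit ⟨w, hw⟩)) :
    ∃ c', (padder l r g).Reaches A w.length c c' ∧
      c'.status = Sum.inl (.emit ⟨[], Nat.zero_le _⟩) ∧ c'.queryTape = c.queryTape ++ w ∧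
      ∀ i, c'.tapes i = c.tapes i := by
  induction w generalizing c with
  | nil => exact ⟨c, .refl _, hq, by simp, fun _ => rfl⟩
  | cons a w ih =>
    obtain ⟨c₁, hs, hq', hu, ht⟩ := padder_step (l := l) (r := r) (g := g) (A := A) hq rfl
    obtain ⟨c', h1, h2, h3, h4⟩ := ih hq'
    exact ⟨c', .head hs h1, h2, by rw [h3, hu]; simp,
      fun i => by rw [h4, ht, actOn_head_none]⟩

theorem padder_last {w : List Bool} {hw : w.length ≤ N + 1}
    (hq : c.status = Sum.inl (.last ⟨w, hw⟩)) :
    ∃ c', (padder l r g).Reaches A (w.length + 1) c c' ∧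
      c'.status = Sum.inr true ∧ c'.queryTape = c.queryTape ++ w := by
  induction w generalizing c with
  | nil => exact ⟨c.perform A (.halt true), .one ⟨_, hq, _, rfl, rfl⟩, rfl, by simp [Config.perform]⟩
  | cons a w ih =>
    obtain ⟨c₁, hs, hq', hu, -⟩ := padder_step (l := l) (r := r) (g := g) (A := A) hq rfl
    obtain ⟨c', h1, h2, h3⟩ := ih hq'
    exact ⟨c', .head hs h1, h2, by rw [h3, hu]; simp⟩

theorem padder_scan (y : List Bool) {z : List Bool} (hx : x = y ++ z)
    (hq : c.status = Sum.inl (.emit ⟨[], Nat.zero_le _⟩))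
    (h0 : Holds (c.tapes 0) (listContent x) (y.length - 1)) :
    ∃ n ≤ y.length + y.length * (N + 1) + 1, ∃ c', (padder l r g).Reaches A n c c' ∧
      c'.status = Sum.inl (.last r) ∧
      c'.queryTape = c.queryTape ++ y.reverse.flatMap fun b => (g b).1 := by
  induction y using List.reverseRecOn generalizing c z with
  | nil =>
    have hhead : (c.tapes 0).head = none := by rw [h0.head, listContent_neg _ (by simp)]
    obtain ⟨c', hs, hq', hu, -⟩ := padder_step (l := l) (r := r) (g := g) (A := A) hq
      (by simp only [padStep, hhead]; rfl)
    exact ⟨1, by omega, c', .one hs, hq', by simpa using hu⟩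
  | append_singleton y b ih =>
    have h0' : Holds (c.tapes 0) (listContent x) y.length := by simpa using h0
    have hhead : (c.tapes 0).head = some b := by
      rw [h0'.head, hx, List.append_assoc, List.singleton_append, listContent_append_length]
    obtain ⟨c₁, hs, hq', hu, ht⟩ := padder_step (l := l) (r := r) (g := g) (A := A) hq
      (by simp only [padStep, hhead]; rfl)
    obtain ⟨c', h1, h2, h3, h4⟩ := padder_emit (A := A) (l := l) (r := r) (g := g)
      (w := (g b).1) (hw := (g b).2) hq'
    obtain ⟨n, hn, c'', h5, h6, h7⟩ := ih (z := b :: z) (by simpa using hx) h2 (by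
      rw [h4, ht]
      simpa [dirShift, sub_eq_add_neg] using h0'.actOn_self h0'.head (some .left))
    refine ⟨(g b).1.length + n + 1, ?_, c'', .head hs (h1.trans h5), h6, ?_⟩
    · have := (g b).2
      rw [List.length_append, List.length_singleton, add_mul]
      omega
    · rw [h7, h3, hu]
      simp

theorem padder_computes : ∃ p : Polynomial ℕ, (padder (d := d) l r g).Computes
    (fun x => List.replicate ((x.length + 1) ^ d - 1) true ++
      (l.1 ++ (x.reverse.flatMap fun b => (g b).1) ++ r.1)) fun n => p.eval n := by
  refine ⟨Polynomial.X + 1 + (Polynomial.X + 1) ^ d + ((N + 1 : ℕ) : Polynomial ℕ) +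
    (Polynomial.X + Polynomial.X * ((N + 1 : ℕ) : Polynomial ℕ) + 1) +
    ((N + 2 : ℕ) : Polynomial ℕ), padder_deterministic l r g, padder_no_query l r g,
    fun A x => ?_⟩
  obtain ⟨c₁, h1, hq1, hu1, ht1⟩ := padder_copy (A := A) (l := l) (r := r) (g := g) (y := [])
    (z := x) (x := x) rfl (c := (padder l r g).init x) rfl (by
      simpa [OracleTM.init] using holds_mk₁ x) (fun i => by
      have := holds_mk₁ []
      simpa [OracleTM.init] using this)
  -- Counting from the largest `d`-digit number in base `x.length + 1` down to zero takes one
  -- decrement less than the power.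
  have hval := odoValue_const x.length d
  obtain ⟨c₂, h2, hq2, hu2, ht2⟩ := padder_odo (A := A) (l := l) (r := r) (g := g)
    ((x.length + 1) ^ d - 1) (x := x) (ρ := fun _ => x.length)
    (Nat.eq_sub_of_add_eq hval) (fun _ => le_rfl) hq1
    (ht1 0) (fun i => by simpa [odoPos] using ht1 i.succ)
  obtain ⟨c₃, h3, hq3, hu3, ht3⟩ := padder_emit (A := A) (l := l) (r := r) (g := g) (w := l.1)
    (hw := l.2) hq2
  obtain ⟨n, hn, c₄, h4, hq4, hu4⟩ := padder_scan (A := A) (l := l) (r := r) (g := g) x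
    (z := []) (x := x) (by simp) hq3 (by rw [ht3]; exact ht2)
  obtain ⟨c₅, h5, hq5, hu5⟩ := padder_last (A := A) (l := l) (r := r) (g := g) (w := r.1)
    (hw := r.2) hq4
  refine ⟨_, ?_, c₅, true, (((h1.trans h2).trans h3).trans h4).trans h5, hq5, ?_⟩
  · simp only [Polynomial.eval_add, Polynomial.eval_one, Polynomial.eval_X, Polynomial.eval_pow,
      Polynomial.eval_mul, Polynomial.eval_natCast, Nat.cast_id]
    have := l.2
    have := r.2
    omega
  · rw [hu5, hu4, hu3, hu2, hu1]
    simp [OracleTM.init]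

end Pad

/-! ### The universal machine is complete -/

theorem NP_subset_P_of_universal_mem {A : Oracle} (h : universal.language A ∈ P A) :
    NP A ⊆ P A := by
  rintro L ⟨Q, _, k, M, ⟨p, hp⟩, hL⟩
  obtain ⟨d, l, r, g, hred⟩ := exists_reduction_to_universal hp
  let N := l.length + r.length + (g true).length + (g false).length
  -- The odometer prints one `true` too few; the missing one is put in front of `l`, and the bound
  -- `N + 1` on the stored strings leaves room for it.
  obtain ⟨p', hp'⟩ := padder_computes (d := d) (N := N) (l := ⟨true :: l, by simp [N]; omega⟩)
    (r := ⟨r, by omega⟩) (g := fun b => ⟨g b, by cases b <;> omega⟩)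
  refine preimage_mem_P hp' h fun x => ?_
  rw [hL, hred]
  have : List.replicate ((x.length + 1) ^ d) true =
      List.replicate ((x.length + 1) ^ d - 1) true ++ [true] := by
    rw [← List.replicate_succ', Nat.sub_add_cancel (Nat.one_le_pow _ _ (by omega))]
  rw [this]
  simp only [List.append_assoc, List.cons_append, List.nil_append]
  rfl

theorem fixedOracle_not_mem_O : fixedOracle ∉ O := fun h =>
  h ((P_subset_NP _).antisymm (NP_subset_P_of_universal_mem fixedOracle_language_mem_P))

end OracleSeparation

theorem mainTheorem6 :
    OracleSeparation.IsPiTwoHard OracleSeparation.O ∧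
    (∃ f : (ℕ → Bool) → OracleSeparation.Oracle, Continuous f ∧
      ∀ b, b ∈ OracleSeparation.H ↔ f b ∈ OracleSeparation.O) ∧
    OracleSeparation.IsPiTwoComplete OracleSeparation.O := by
  obtain ⟨f, hf, h⟩ :=
    OracleSeparation.exists_continuous_reduction OracleSeparation.fixedOracle_not_mem_O
  have hhard := OracleSeparation.isPiTwoHard_of_reduction hf h
  exact ⟨hhard, ⟨f, hf, h⟩, OracleSeparation.isPiTwo_of_complete OracleSeparation.universal _
    OracleSeparation.universal_runsInTime
    fun _ => OracleSeparation.NP_subset_P_of_universal_mem, hhard⟩
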